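/- **Setting.** Let $d\in\{1,2,3\}$, let $\mathscr O\subset\mathbb R^d$ be a nonempty bounded open set, $H=L^2(\mathscr O)$ with norm $\|\cdot\|$ and inner product $\langle\cdot,\cdot\rangle$, $\dot H^1=H^1_0(\mathscr O)$ (the $H^1$-closure of $C_c^\infty(\mathscr O)$), $\dot H^{-1}=(\dot H^1)^*$, $A$ the Dirichlet Laplacian, and $\lambda_1$ the first (smallest) eigenvalue of $-A$. Let $f:\mathbb R\to\mathbb R$ be differentiable, and let $L_1,\dots,L_5\in\mathbb R$ and $q\ge1$ (with $q\le 3$ if $d=3$) be such that for all $\xi,\eta\in\mathbb R$ $$(f(\xi)-f(\eta))(\xi-\eta)\le L_1(\xi-\eta)^2,\qquad f(\xi)\xi\le L_2|\xi|^2+L_3,\qquad |f'(\xi)|\le L_4|\xi|^{q-1}+L_5 ,$$ and let $F(x)(\xi)=f(x(\xi))$ be its Nemytskii operator. Let $\mathbf Q$ be a self-adjoint, positive definite, trace-class operator on $H$ with orthonormal eigenbasis $(g_k)$ and eigenvalues $q_k>0$, let $W$ be an $H$-valued $\mathbf Q$-Wiener process on a filtered probability space, $W(t)=\sum_k\sqrt{q_k}\,\beta_k(t)g_k$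 with independent Brownian motions $\beta_k$, and let $\|T\|_{\mathcal L_2^0}^2=\sum_k q_k\|Tg_k\|^2$ be the squared Hilbert--Schmidt norm of $T:\mathbf Q^{1/2}H\to H$. For $g:\mathbb R\to\mathbb R$ let $G(x)g_k(\xi)=g(x(\xi))g_k(\xi)$ define $G:H\to\mathcal L_2^0$, and suppose that for some constants $L_6,L_7,L_8\ge0$ and all $x,y\in H$ $$\|G(x)-G(y)\|^2_{\mathcal L_2^0}\le L_6\|x-y\|^2,\qquad \|G(x)\|^2_{\mathcal L_2^0}\le L_7\|x\|^2+L_8 .$$ For $\tau\in(0,1)$ and $t_m=m\tau$, the drift-implicit Euler scheme started at $x\in H$ is the adapted process $(X^x_m)_{m\in\mathbb N}$ with $X^x_0=x$, $X^x_{m+1}\in\dot H^1$ and, almost surely as an identity in $\dot H^{-1}$, $$X^x_{m+1}=X^x_m+\tau AX^x_{m+1}+\tau F(X^x_{m+1})+G(X^x_m)\,(W(t_{m+1})-W(t_m)),\qquad m\in\mathbb N. \tag{DIE}$$ Put $P_m\phi(x)=\mathbb E\,\phi(X_m^x)$. A probability measure $\mu$ on $H$ is invariant if $\int_H P_m\phi\,d\mu=\int_H\phi\,d\mu$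 for all $m\in\mathbb N$ and all bounded continuous $\phi:H\to\mathbb R$. **Theorem.** Assume that $\max\{L_1+L_6/2,\;L_2+L_7/2\}<\lambda_1$. Then for every $\tau\in(0,1)$ and every $x\in H$ the scheme (DIE) has an almost surely unique solution $(X_m^x)_{m\in\mathbb N}$, and (DIE) has a unique invariant measure $\pi_\tau$ on $H$. Moreover $\int_H\|y\|\,\pi_\tau(dy)<\infty$, and $\pi_\tau$ is exponentially mixing: for all $m\in\mathbb N$, $x\in H$ and all bounded Lipschitz functions $\phi:H\to\mathbb R$, $$\Big|P_m\phi(x)-\int_H\phi\,d\pi_\tau\Big|\le e^{-\gamma_6t_m/2}\,|\phi|_{\rm Lip}\int_H\|x-y\|\,\pi_\tau(dy),$$ where $|\phi|_{\rm Lip}=\sup_{x\ne y}|\phi(x)-\phi(y)|/\|x-y\|$ and $\gamma_6=\dfrac{2(\lambda_1-L_1)-L_6}{2(\lambda_1-L_1)+1}>0$ does not depend on $\tau$. -/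

import Mathlib

open MeasureTheory ProbabilityTheory Filter Topology
open scoped NNReal ENNReal BoundedContinuousFunction RealInnerProductSpace

noncomputable section

namespace DIE

/-- The Euclidean space `ℝᵈ`. -/
abbrev E (d : ℕ) : Type := EuclideanSpace ℝ (Fin d)

/-- `H = L²(O)`. -/
abbrev H {d : ℕ} (O : Set (E d)) : Type := Lp ℝ 2 (volume.restrict O)

/-- `L²(O; ℝᵈ)`, the space of gradients. -/
abbrev HVec {d : ℕ} (O : Set (E d)) : Type := Lp (E d) 2 (volume.restrict O)

/-- `H` carries its Borel `σ`-algebra. -/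
instance instMeasurableSpaceH {d : ℕ} (O : Set (E d)) : MeasurableSpace (H O) := borel _

instance instBorelSpaceH {d : ℕ} (O : Set (E d)) : BorelSpace (H O) := ⟨rfl⟩

/-! ### The Dirichlet Laplacian -/

/-- The pairs `(φ, ∇φ)` with `φ ∈ C_c^∞(O)`, seen in `L²(O) × L²(O; ℝᵈ)`. -/
def testPairs {d : ℕ} (O : Set (E d)) : Set (H O × HVec O) :=
  {z | ∃ φ : E d → ℝ, ContDiff ℝ ((⊤ : ℕ∞) : WithTop ℕ∞) φ ∧ HasCompactSupport φ ∧ tsupport φ ⊆ O ∧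
    z.1 =ᵐ[volume.restrict O] φ ∧ z.2 =ᵐ[volume.restrict O] gradient φ}

/-- `u ∈ Ḣ¹(O) = H¹₀(O)` with weak gradient `p`: the pair `(u, p)` lies in the closure of
`{(φ, ∇φ) : φ ∈ C_c^∞(O)}` in `L² × L²`, i.e. `u` is in the `H¹`-closure of `C_c^∞(O)`. -/
def IsH1Zero {d : ℕ} (O : Set (E d)) (u : H O) (p : HVec O) : Prop :=
  (u, p) ∈ closure (testPairs O)

/-- `lam` is an eigenvalue of the (negative) Dirichlet Laplacian `-A` on `O`: there is
`0 ≠ u ∈ Ḣ¹` with `⟨∇u, ∇v⟩ = lam ⟨u, v⟩` for all `v ∈ Ḣ¹`. -/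
def IsDirichletEigenvalue {d : ℕ} (O : Set (E d)) (lam : ℝ) : Prop :=
  ∃ (u : H O) (p : HVec O), IsH1Zero O u p ∧ u ≠ 0 ∧
    ∀ (v : H O) (r : HVec O), IsH1Zero O v r → ⟪p, r⟫ = lam * ⟪u, v⟫

/-- The first eigenvalue `λ₁` of the Dirichlet Laplacian on `O`. -/
def lambda1 {d : ℕ} (O : Set (E d)) : ℝ := sInf {lam | IsDirichletEigenvalue O lam}

/-! ### Assumptions on the coefficients -/

/-- The conditions on the drift function `f`, with constants `L₁, …, L₅` and growth exponent `q`;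
the restriction `q ≤ 3` for `d = 3` ensures `Ḣ¹ ⊆ L^{2q}`. -/
structure DriftAssumption (d : ℕ) (f : ℝ → ℝ) (L₁ L₂ L₃ L₄ L₅ q : ℝ) : Prop where
  differentiable : Differentiable ℝ f
  one_le_q : 1 ≤ q
  q_le_three : d = 3 → q ≤ 3
  monotone : ∀ ξ η : ℝ, (f ξ - f η) * (ξ - η) ≤ L₁ * (ξ - η) ^ 2
  coercive : ∀ ξ : ℝ, f ξ * ξ ≤ L₂ * |ξ| ^ 2 + L₃
  deriv_growth : ∀ ξ : ℝ, |deriv f ξ| ≤ L₄ * |ξ| ^ (q - 1) + L₅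

/-- The covariance operator `Q` of the noise (self-adjoint, positive definite and trace class),
given by its spectral decomposition `Q h = ∑ₖ qₖ ⟨gₖ, h⟩ gₖ`. -/
structure Covariance {d : ℕ} (O : Set (E d)) where
  /-- the orthonormal basis `(gₖ)` of eigenvectors of `Q` -/
  basis : HilbertBasis ℕ ℝ (H O)
  /-- the eigenvalues `(qₖ)` of `Q` -/
  eig : ℕ → ℝ
  eig_pos : ∀ k, 0 < eig k
  summable_eig : Summable eig

/-- The squared Hilbert–Schmidt norm `‖T‖²_{HS(H₀; H)} = ∑ₖ ‖T (√qₖ gₖ)‖² = ∑ₖ qₖ ‖T gₖ‖²`, where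
`H₀ = Q^{1/2} H` has the orthonormal basis `(√qₖ gₖ)`; the operator `T` is represented by the
sequence `k ↦ T gₖ`, and it is Hilbert–Schmidt if and only if the value is finite. -/
def hsNormSq {d : ℕ} {O : Set (E d)} (Q : Covariance O) (T : ℕ → H O) : ℝ≥0∞ :=
  ∑' k, ENNReal.ofReal (Q.eig k) * ‖T k‖ₑ ^ 2

/-- `G` is the Nemytskii operator associated with `g`, with `G x k` standing for `G(x) gₖ`:
`(G(x) gₖ)(ξ) = g(x(ξ)) gₖ(ξ)`. -/
def IsNemytskii {d : ℕ} {O : Set (E d)} (Q : Covariance O) (g : ℝ → ℝ)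
    (G : H O → ℕ → H O) : Prop :=
  ∀ (x : H O) (k : ℕ),
    G x k =ᵐ[volume.restrict O] fun ξ => g (x ξ) * Q.basis k ξ

/-- Lipschitz continuity and linear growth of `G : H → HS(H₀; H)`. -/
structure DiffusionAssumption {d : ℕ} {O : Set (E d)} (Q : Covariance O)
    (G : H O → ℕ → H O) (L₆ L₇ L₈ : ℝ) : Prop where
  L₆_nonneg : 0 ≤ L₆
  L₇_nonneg : 0 ≤ L₇
  L₈_nonneg : 0 ≤ L₈
  lipschitz : ∀ x y : H O,
    hsNormSq Q (fun k => G x k - G y k) ≤ ENNReal.ofReal (L₆ * ‖x - y‖ ^ 2)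
  growth : ∀ x : H O, hsNormSq Q (G x) ≤ ENNReal.ofReal (L₇ * ‖x‖ ^ 2 + L₈)

/-! ### The noise and the scheme -/

/-- `W` is an `H`-valued `Q`-Wiener process on the filtered probability space `(Ω, 𝓕, P)`, with the
expansion `W(t) = ∑ₖ √qₖ βₖ(t) gₖ` in mutually independent Brownian motions `βₖ`. -/
structure IsQWiener {d : ℕ} {O : Set (E d)} (Q : Covariance O) {Ω : Type*}
    {mΩ : MeasurableSpace Ω} (𝓕 : Filtration ℝ≥0 mΩ) (P : Measure Ω)
    (W : ℝ≥0 → Ω → H O) : Prop where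
  adapted : ∀ t, StronglyMeasurable[𝓕 t] (W t)
  indep_increment : ∀ s t, s ≤ t →
    Indep (MeasurableSpace.comap (fun ω => W t ω - W s ω) inferInstance) (𝓕 s) P
  continuous_paths : ∀ᵐ ω ∂P, Continuous fun t => W t ω
  expansion : ∃ β : ℕ → ℝ≥0 → Ω → ℝ,
    (∀ k, IsBrownianReal (β k) P) ∧
    iIndepFun (fun (k : ℕ) (ω : Ω) (t : ℝ≥0) => β k t ω) P ∧
    ∀ t, ∀ᵐ ω ∂P, HasSum (fun k => (√(Q.eig k) * β k t ω) • Q.basis k) (W t ω)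

/-- `Z` is the random variable `G(X) δ`, for random `X, δ : Ω → H`: the limit in probability of
`∑_{k < n} ⟨gₖ, δ⟩ G(X) gₖ`. -/
def IsNoiseTerm {d : ℕ} {O : Set (E d)} (Q : Covariance O) (G : H O → ℕ → H O) {Ω : Type*}
    {mΩ : MeasurableSpace Ω} (P : Measure Ω) (X δ Z : Ω → H O) : Prop :=
  TendstoInMeasure P
    (fun (n : ℕ) ω => ∑ k ∈ Finset.range n, ⟪Q.basis k, δ ω⟫ • G (X ω) k) atTop Z

/-- One step of the drift-implicit Euler scheme: `y ∈ Ḣ¹` and `y = x + τ A y + τ F(y) + z` in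
`Ḣ⁻¹ = (Ḣ¹)*`, where `F` is the Nemytskii operator of `f`. -/
def IsStep {d : ℕ} (O : Set (E d)) (f : ℝ → ℝ) (τ : ℝ) (x z y : H O) : Prop :=
  ∃ p : HVec O, IsH1Zero O y p ∧
    ∀ (v : H O) (r : HVec O), IsH1Zero O v r →
      Integrable (fun ξ => f (y ξ) * v ξ) (volume.restrict O) ∧
      ⟪y, v⟫ = ⟪x, v⟫ - τ * ⟪p, r⟫ + τ * (∫ ξ in O, f (y ξ) * v ξ) + ⟪z, v⟫

/-- `X = (X_m)` is an adapted solution of the drift-implicit Euler scheme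
`X_{m+1} = X_m + τ A X_{m+1} + τ F(X_{m+1}) + G(X_m) (W(t_{m+1}) - W(t_m))`, `t_m = m τ`,
starting from `X_0 = x`. -/
structure IsSolution {d : ℕ} {O : Set (E d)} (Q : Covariance O) (f : ℝ → ℝ)
    (G : H O → ℕ → H O) (τ : ℝ≥0) {Ω : Type*} {mΩ : MeasurableSpace Ω}
    (𝓕 : Filtration ℝ≥0 mΩ) (P : Measure Ω) (W : ℝ≥0 → Ω → H O)
    (x : H O) (X : ℕ → Ω → H O) : Prop where
  initial : ∀ᵐ ω ∂P, X 0 ω = x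
  adapted : ∀ m : ℕ, StronglyMeasurable[𝓕 (m * τ)] (X m)
  step : ∀ m : ℕ, ∃ Z : Ω → H O,
    IsNoiseTerm Q G P (X m) (fun ω => W ((m + 1 : ℕ) * τ) ω - W (m * τ) ω) Z ∧
    ∀ᵐ ω ∂P, IsStep O f τ (X m ω) (Z ω) (X (m + 1) ω)

/-! ### Semigroup, invariant measures, mixing -/

/-- `P_m φ (x) = 𝔼 φ(X_m^x)` for a family `X x = (X_m^x)_m` of processes indexed by `x ∈ H`. -/
def semigroup {d : ℕ} {O : Set (E d)} {Ω : Type*} {mΩ : MeasurableSpace Ω} (P : Measure Ω)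
    (X : H O → ℕ → Ω → H O) (m : ℕ) (φ : H O → ℝ) (x : H O) : ℝ :=
  ∫ ω, φ (X x m ω) ∂P

/-- A probability measure `μ` on `H` is invariant: `∫ P_m φ dμ = ∫ φ dμ` for all `m` and all bounded
continuous `φ`. -/
def IsInvariantMeasure {d : ℕ} {O : Set (E d)} {Ω : Type*} {mΩ : MeasurableSpace Ω}
    (P : Measure Ω) (X : H O → ℕ → Ω → H O) (μ : Measure (H O)) : Prop :=
  IsProbabilityMeasure μ ∧
    ∀ (m : ℕ) (φ : H O →ᵇ ℝ), ∫ x, semigroup P X m φ x ∂μ = ∫ x, φ x ∂μ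

/-- The class `Lip_b(H)` of bounded Lipschitz functions. -/
def IsLipB {d : ℕ} {O : Set (E d)} (φ : H O → ℝ) : Prop :=
  (∃ K : ℝ≥0, LipschitzWith K φ) ∧ ∃ C : ℝ, ∀ x, |φ x| ≤ C

/-- `|φ|_Lip = sup_{x ≠ y} |φ(x) - φ(y)| / ‖x - y‖`. -/
def lipSeminorm {d : ℕ} {O : Set (E d)} (φ : H O → ℝ) : ℝ :=
  sSup {r | ∃ x y : H O, x ≠ y ∧ r = |φ x - φ y| / ‖x - y‖}

/-- The rate `γ₆ = (2 (λ₁ - L₁) - L₆) / (2 (λ₁ - L₁) + 1)`. -/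
def gamma6 (lam L₁ L₆ : ℝ) : ℝ := (2 * (lam - L₁) - L₆) / (2 * (lam - L₁) + 1)

end DIE

end

open DIE

/-! One step of the scheme solves y = w + τAy + τF(y) with w = X_m + G(X_m)ΔW. Write f(ξ) = L₁ξ +
f(0) - h(ξ) with h nondecreasing. The step is then the Euler-Lagrange equation of a coercive convex
energy on H¹₀, so it has a solution y = S(w) (`exists_minimizer`, `exists_eulerLagrange`). Testing
the equation and using Poincaré's inequality with λ₁ gives (1 + τ(λ₁ - L₁))‖S(w) - S(w')‖ ≤ ‖w - w'‖
(`IsStep.norm_sub_le`) and (1 + 2τ(λ₁ - L₂))‖S(w)‖² ≤ ‖w‖² + const (`IsStep.norm_sq_le`).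

The increment ΔW is independent of the past. By the Itô isometry, adding the noise multiplies mean
squared distances by at most 1 + τL₆ and second moments by at most 1 + τL₇, up to a constant. Hence
one step contracts mean squared distances by (1 + τL₆)/(1 + τ(λ₁ - L₁))² ≤ exp(-γ₆τ)
(`stepLip_sq_mul_le`). Second moments stay bounded in time because (1 + τL₇)/(1 + 2τ(λ₁ - L₂)) < 1.

For existence of the invariant measure, S maps balls into compact sets by the energy bound and
Rellich's theorem, so the laws of X_m are tight and have a weak limit point π
(`IsFlow.isTightMeasureSet_law`). The contraction makes the laws at consecutive times merge, so π is
invariant without averaging in time (`IsFlow.exists_invariant`). The contraction also turns a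
K-Lipschitz φ into P_mφ with Lipschitz constant K·exp(-γ₆t_m/2). Integrating P_mφ(x) - P_mφ(y) over
π(dy) gives mixing, and mixing gives uniqueness.

The analytic inputs hold without regularity of the boundary, since elements of H¹₀ are limits of
test functions extended by zero. Rellich's theorem comes from piecewise constant approximation on a
cubic grid. Poincaré's inequality comes from the attained infimum of the Rayleigh quotient, which is
an eigenvalue. The Sobolev embedding into L^{q+1} makes f(y)v integrable. -/

namespace DIE

/-! ### Translations in L² are controlled by the gradient -/

section Translation

variable {V : Type*} [NormedAddCommGroup V] [NormedSpace ℝ V]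

/-- Jensen's inequality for the square on the unit interval. -/
theorem sq_lintegral_Ioc_le {g : ℝ → ℝ≥0∞} (hg : Measurable g) :
    (∫⁻ t in Set.Ioc (0 : ℝ) 1, g t) ^ 2 ≤ ∫⁻ t in Set.Ioc (0 : ℝ) 1, g t ^ 2 := by
  have h := ENNReal.lintegral_mul_le_Lp_mul_Lq (volume.restrict (Set.Ioc (0 : ℝ) 1))
    Real.HolderConjugate.two_two hg.aemeasurable (aemeasurable_const (b := (1 : ℝ≥0∞)))
  simp only [Pi.mul_apply, mul_one, ENNReal.one_rpow, lintegral_const, Measure.restrict_apply,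
    MeasurableSet.univ, Set.univ_inter, Real.volume_Ioc, sub_zero, ENNReal.ofReal_one,
    ENNReal.rpow_two, one_pow] at h
  calc _ ≤ ((∫⁻ t in Set.Ioc (0 : ℝ) 1, g t ^ 2) ^ (1 / 2 : ℝ)) ^ 2 := by gcongr
    _ = _ := by
      rw [← ENNReal.rpow_natCast, ← ENNReal.rpow_mul]; norm_num

/-- The fundamental theorem of calculus on the segment from x to x + k, then the operator norm bound
and Jensen's inequality. -/
theorem enorm_sub_sq_le_lintegral_fderiv {φ : V → ℝ} (hφ : ContDiff ℝ 1 φ) (x k : V) :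
    ‖φ (x + k) - φ x‖ₑ ^ 2 ≤
      ‖k‖ₑ ^ 2 * ∫⁻ t in Set.Ioc (0 : ℝ) 1, ‖fderiv ℝ φ (x + t • k)‖ₑ ^ 2 := by
  have hc : Continuous (fderiv ℝ φ) := hφ.continuous_fderiv one_ne_zero
  have hder : ∀ t : ℝ, HasDerivAt (fun s : ℝ => φ (x + s • k)) (fderiv ℝ φ (x + t • k) k) t := by
    intro t
    have h1 : HasDerivAt (fun s : ℝ => x + s • k) k t := by
      simpa using ((hasDerivAt_id t).smul_const k).const_add x
    exact ((hφ.differentiable one_ne_zero _).hasFDerivAt).comp_hasDerivAt t h1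
  have hcont : Continuous fun t : ℝ => fderiv ℝ φ (x + t • k) k := by fun_prop
  have hft := intervalIntegral.integral_eq_sub_of_hasDerivAt (a := 0) (b := 1)
    (fun t _ => hder t) (hcont.intervalIntegrable 0 1)
  simp only [one_smul, zero_smul, add_zero] at hft
  rw [← hft, intervalIntegral.integral_of_le zero_le_one]
  have hmeas : Measurable fun t : ℝ => ‖fderiv ℝ φ (x + t • k)‖ₑ := by
    have : Continuous fun t : ℝ => fderiv ℝ φ (x + t • k) := by fun_prop
    exact this.enorm.measurable
  calc ‖∫ t in Set.Ioc (0 : ℝ) 1, fderiv ℝ φ (x + t • k) k‖ₑ ^ 2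
      ≤ (∫⁻ t in Set.Ioc (0 : ℝ) 1, ‖fderiv ℝ φ (x + t • k) k‖ₑ) ^ 2 := by
        gcongr; exact enorm_integral_le_lintegral_enorm _
    _ ≤ (∫⁻ t in Set.Ioc (0 : ℝ) 1, ‖fderiv ℝ φ (x + t • k)‖ₑ * ‖k‖ₑ) ^ 2 := by
        gcongr with t; exact ContinuousLinearMap.le_opENorm _ _
    _ = ((∫⁻ t in Set.Ioc (0 : ℝ) 1, ‖fderiv ℝ φ (x + t • k)‖ₑ) * ‖k‖ₑ) ^ 2 := by
        rw [lintegral_mul_const _ hmeas]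
    _ ≤ _ := by
        rw [mul_pow, mul_comm]
        gcongr
        exact sq_lintegral_Ioc_le hmeas

/-- After integrating the pointwise bound in x and exchanging the integrals, translation invariance
makes the inner integral independent of the position t on the segment. -/
theorem lintegral_translate_sub_sq_le [MeasurableSpace V] [BorelSpace V] 
    [SecondCountableTopology V] {μ : Measure V} [SFinite μ] [μ.IsAddRightInvariant]
    {φ : V → ℝ} (hφ : ContDiff ℝ 1 φ) (k : V) :
    ∫⁻ x, ‖φ (x + k) - φ x‖ₑ ^ 2 ∂μ ≤ ‖k‖ₑ ^ 2 * ∫⁻ x, ‖fderiv ℝ φ x‖ₑ ^ 2 ∂μ := by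
  have hc : Continuous (fderiv ℝ φ) := hφ.continuous_fderiv one_ne_zero
  have hm : Measurable fun z : V × ℝ => ‖fderiv ℝ φ (z.1 + z.2 • k)‖ₑ ^ 2 := by
    have : Continuous fun z : V × ℝ => fderiv ℝ φ (z.1 + z.2 • k) := by fun_prop
    exact this.enorm.measurable.pow_const 2
  calc _ ≤ ∫⁻ x, (‖k‖ₑ ^ 2 * ∫⁻ t in Set.Ioc (0 : ℝ) 1, ‖fderiv ℝ φ (x + t • k)‖ₑ ^ 2) ∂μ :=
        lintegral_mono fun x => enorm_sub_sq_le_lintegral_fderiv hφ x k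
    _ = ‖k‖ₑ ^ 2 * ∫⁻ t in Set.Ioc (0 : ℝ) 1, (∫⁻ x, ‖fderiv ℝ φ (x + t • k)‖ₑ ^ 2 ∂μ) := by
        rw [lintegral_const_mul' _ _ (by simp), lintegral_lintegral_swap hm.aemeasurable]
    _ = _ := by
        congr 1
        have (t : ℝ) : ∫⁻ x, ‖fderiv ℝ φ (x + t • k)‖ₑ ^ 2 ∂μ = ∫⁻ x, ‖fderiv ℝ φ x‖ₑ ^ 2 ∂μ :=
          lintegral_add_right_eq_self (fun x => ‖fderiv ℝ φ x‖ₑ ^ 2) _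
        simp [this]

end Translation

/-! ### Averages over the cells of a cubic grid -/

section Cells

variable {d : ℕ}

/-- The cell with index `k` of the grid of mesh `h`. -/
def cell (h : ℝ) (k : Fin d → ℤ) : Set (E d) :=
  {x | ∀ i, h * k i ≤ x i ∧ x i < h * (k i + 1)}

/-- The index of the cell of `x`. -/
noncomputable def cellIndex (h : ℝ) (x : E d) : Fin d → ℤ := fun i => ⌊x i / h⌋

theorem mem_cell_iff {h : ℝ} (hh : 0 < h) {x : E d} {k : Fin d → ℤ} :
    x ∈ cell h k ↔ cellIndex h x = k := by
  simp only [cell, cellIndex, Set.mem_ofPred_eq, funext_iff, Int.floor_eq_iff, le_div_iff₀ hh,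
    div_lt_iff₀ hh]
  simp only [mul_comm h]

/-- The open box with half side `h`. -/
def box (d : ℕ) (h : ℝ) : Set (E d) := {z | ∀ i, |z i| < h}

theorem volume_cell {h : ℝ} (k : Fin d → ℤ) : volume (cell h k) = ENNReal.ofReal h ^ d := by
  have h1 := (EuclideanSpace.volume_preserving_symm_measurableEquiv_toLp (Fin d)).symm
    |>.measure_preimage_equiv (cell h k)
  rw [← h1]
  have : ((MeasurableEquiv.toLp 2 (Fin d → ℝ)).symm.symm ⁻¹' cell h k) =
      Set.pi Set.univ fun i => Set.Ico (h * k i) (h * (k i + 1)) := by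
    ext x; simp [cell]
  rw [this, Real.volume_pi_Ico]
  simp [mul_add]

theorem volume_box {h : ℝ} : volume (box d h) = ENNReal.ofReal (2 * h) ^ d := by
  have h1 := (EuclideanSpace.volume_preserving_symm_measurableEquiv_toLp (Fin d)).symm
    |>.measure_preimage_equiv (box d h)
  rw [← h1]
  have : ((MeasurableEquiv.toLp 2 (Fin d → ℝ)).symm.symm ⁻¹' box d h) =
      Set.pi Set.univ fun i => Set.Ioo (-h) h := by
    ext x; simp [box, abs_lt]
  rw [this, Real.volume_pi_Ioo]
  simp [two_mul]

theorem measurableSet_cell {h : ℝ} (k : Fin d → ℤ) : MeasurableSet (cell h k) := by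
  simp only [cell, Set.ofPred_forall]
  refine MeasurableSet.iInter fun i => ?_
  have hi : Measurable fun x : E d => x i := by fun_prop
  exact (measurableSet_le measurable_const hi).inter (measurableSet_lt hi measurable_const)

theorem measurableSet_box {h : ℝ} : MeasurableSet (box d h) := by
  simp only [box, Set.ofPred_forall]
  refine MeasurableSet.iInter fun i => ?_
  exact measurableSet_lt (by fun_prop) measurable_const

theorem enorm_sq_le_of_mem_box {h : ℝ} {z : E d} (hz : z ∈ box d h) :
    ‖z‖ₑ ^ 2 ≤ ENNReal.ofReal (d * h ^ 2) := by
  rw [← ofReal_norm, ← ENNReal.ofReal_pow (norm_nonneg _), EuclideanSpace.norm_sq_eq]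
  refine ENNReal.ofReal_le_ofReal ?_
  calc ∑ i, ‖z i‖ ^ 2 ≤ ∑ _i : Fin d, h ^ 2 := by
        refine Finset.sum_le_sum fun i _ => ?_
        exact pow_le_pow_left₀ (norm_nonneg _) (hz i).le 2
    _ = _ := by simp

/-- The average of `φ` over the cell with index `k`. -/
noncomputable def cellAverage (h : ℝ) (φ : E d → ℝ) (k : Fin d → ℤ) : ℝ := ⨍ y in cell h k, φ y

/-- Jensen's inequality for the square under the normalised restriction of μ to s. -/
theorem enorm_sub_average_sq_le {α : Type*} [MeasurableSpace α] {μ : Measure α}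
    {s : Set α} (hs0 : μ s ≠ 0) (hs : μ s ≠ ∞) {φ : α → ℝ} (hφ : IntegrableOn φ s μ)
    (hφ2 : IntegrableOn (fun y => φ y ^ 2) s μ) (c : ℝ) :
    ‖c - ⨍ y in s, φ y ∂μ‖ₑ ^ 2 ≤ (μ s)⁻¹ * ∫⁻ y in s, ‖φ y - c‖ₑ ^ 2 ∂μ := by
  have : IsFiniteMeasure (μ.restrict s) := ⟨by simpa using hs.lt_top⟩
  have hne : NeZero (μ.restrict s) := ⟨by simpa using hs0⟩
  have h1 : (⨍ y in s, (φ y - c) ∂μ) = (⨍ y in s, φ y ∂μ) - c := by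
    rw [average_eq, average_eq, integral_sub hφ (integrable_const c)]
    simp only [integral_const, smul_eq_mul]
    have : (μ.restrict s).real Set.univ ≠ 0 := by
      simp [Measure.real, ENNReal.toReal_eq_zero_iff, hs0, hs]
    field_simp
  have hI : IntegrableOn (fun y => (φ y - c) ^ 2) s μ := by
    have : (fun y => (φ y - c) ^ 2) = fun y => φ y ^ 2 - (2 * c) * φ y + c ^ 2 := by
      ext; ring
    rw [this]
    exact (hφ2.sub (hφ.const_mul _)).add (integrable_const _)
  have hJ : (⨍ y in s, (φ y - c) ∂μ) ^ 2 ≤ ⨍ y in s, (φ y - c) ^ 2 ∂μ :=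
    (even_two.convexOn_pow (𝕜 := ℝ)).map_average_le (continuous_pow 2).continuousOn isClosed_univ
      (by simp) (hφ.sub (integrable_const c)) hI
  rw [h1] at hJ
  calc ‖c - ⨍ y in s, φ y ∂μ‖ₑ ^ 2 = ENNReal.ofReal (((⨍ y in s, φ y ∂μ) - c) ^ 2) := by
        rw [← sq_abs, ENNReal.ofReal_pow (abs_nonneg _), ← Real.enorm_eq_ofReal_abs, enorm_sub_rev]
    _ ≤ ENNReal.ofReal (⨍ y in s, (φ y - c) ^ 2 ∂μ) := ENNReal.ofReal_le_ofReal hJ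
    _ = _ := by
        rw [setAverage_eq, smul_eq_mul, ENNReal.ofReal_mul (by positivity),
          ofReal_integral_eq_lintegral_ofReal hI (ae_of_all _ fun y => sq_nonneg _)]
        congr 1
        · rw [ENNReal.ofReal_inv_of_pos, Measure.real, ENNReal.ofReal_toReal hs]
          exact ENNReal.toReal_pos hs0 hs
        · refine lintegral_congr fun y => ?_
          rw [← sq_abs, ENNReal.ofReal_pow (abs_nonneg _), ← Real.enorm_eq_ofReal_abs]

/-- Any y in the cell of x is x + z with z in the box of half side h, so the mean square over the
cell is at most a multiple of an integral over translations z. The factor 2^d is the volume of the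
box over that of the cell, and d·h² bounds ‖z‖². -/
theorem lintegral_sub_cellAverage_sq_le {h : ℝ} (hh : 0 < h) {φ : E d → ℝ} (hφ : ContDiff ℝ 1 φ)
    (hc : HasCompactSupport φ) :
    ∫⁻ x, ‖φ x - cellAverage h φ (cellIndex h x)‖ₑ ^ 2 ≤
      ENNReal.ofReal (2 ^ d * d * h ^ 2) * ∫⁻ x, ‖fderiv ℝ φ x‖ₑ ^ 2 := by
  have hv0 : ENNReal.ofReal h ^ d ≠ 0 := pow_ne_zero _ (by simpa using hh)
  have hvt : ENNReal.ofReal h ^ d ≠ ∞ := ENNReal.pow_ne_top ENNReal.ofReal_ne_top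
  have hpt : ∀ x, ‖φ x - cellAverage h φ (cellIndex h x)‖ₑ ^ 2 ≤
      (ENNReal.ofReal h ^ d)⁻¹ * ∫⁻ z in box d h, ‖φ (x + z) - φ x‖ₑ ^ 2 := by
    intro x
    have hint : Integrable φ := hφ.continuous.integrable_of_hasCompactSupport hc
    have hint2 : Integrable fun y => φ y ^ 2 := by
      have hsq : HasCompactSupport fun y => φ y ^ 2 := by
        simp only [sq]
        exact hc.mul_right
      exact Continuous.integrable_of_hasCompactSupport (hφ.continuous.pow 2) hsq
    have h1 := enorm_sub_average_sq_le (μ := volume) (s := cell h (cellIndex h x))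
      (by rwa [volume_cell]) (by rwa [volume_cell]) hint.integrableOn hint2.integrableOn (φ x)
    rw [volume_cell] at h1
    refine h1.trans (mul_le_mul_right ?_ _)
    rw [← lintegral_indicator (measurableSet_cell _), ← lintegral_indicator measurableSet_box]
    have hsh := lintegral_add_left_eq_self (μ := (volume : Measure (E d)))
      ((cell h (cellIndex h x)).indicator fun y => ‖φ y - φ x‖ₑ ^ 2) x
    rw [← hsh]
    refine lintegral_mono fun z => ?_
    by_cases hz : x + z ∈ cell h (cellIndex h x)
    · have hx : x ∈ cell h (cellIndex h x) := (mem_cell_iff hh).2 rfl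
      have hzb : z ∈ box d h := by
        intro i
        have h2 := hz i
        have h3 := hx i
        simp only [PiLp.add_apply] at h2
        rw [abs_lt]
        constructor <;> linarith [h2.1, h2.2, h3.1, h3.2]
      rw [Set.indicator_of_mem hz, Set.indicator_of_mem hzb]
    · rw [Set.indicator_of_notMem hz]
      exact zero_le
  calc _ ≤ ∫⁻ x, (ENNReal.ofReal h ^ d)⁻¹ * ∫⁻ z in box d h, ‖φ (x + z) - φ x‖ₑ ^ 2 :=
        lintegral_mono hpt
    _ = (ENNReal.ofReal h ^ d)⁻¹ * ∫⁻ z in box d h, ∫⁻ x, ‖φ (x + z) - φ x‖ₑ ^ 2 := by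
        rw [lintegral_const_mul' _ _ (by simpa using hv0), lintegral_lintegral_swap]
        have : Continuous fun z : E d × E d => φ (z.1 + z.2) - φ z.1 := by
          have := hφ.continuous; fun_prop
        exact (this.enorm.measurable.pow_const 2).aemeasurable
    _ ≤ (ENNReal.ofReal h ^ d)⁻¹ * ∫⁻ z in box d h,
          ENNReal.ofReal (d * h ^ 2) * ∫⁻ x, ‖fderiv ℝ φ x‖ₑ ^ 2 := by
        refine mul_le_mul_right ?_ _
        refine setLIntegral_mono measurable_const fun z hz => ?_
        refine (lintegral_translate_sub_sq_le hφ z).trans ?_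
        gcongr
        exact enorm_sq_le_of_mem_box hz
    _ = _ := by
        rw [setLIntegral_const, volume_box, ENNReal.ofReal_mul zero_le_two, mul_pow,
          mul_assoc (2 ^ d : ℝ), ENNReal.ofReal_mul (by positivity : (0 : ℝ) ≤ 2 ^ d),
          ENNReal.ofReal_pow zero_le_two]
        generalize (∫⁻ x, ‖fderiv ℝ φ x‖ₑ ^ 2) = I
        calc _ = ((ENNReal.ofReal h ^ d)⁻¹ * ENNReal.ofReal h ^ d) *
              (ENNReal.ofReal 2 ^ d * ENNReal.ofReal (d * h ^ 2) * I) := by ring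
          _ = _ := by rw [ENNReal.inv_mul_cancel hv0 hvt, one_mul]

end Cells
end DIE

namespace DIE

variable {d : ℕ} {O : Set (E d)}

/-! ### H¹₀ as a closed subspace of pairs (u, ∇u) -/

section Space

/-- The space `H¹₀(O)`, as a set of pairs `(u, ∇u)`. -/
noncomputable def h1Zero (O : Set (E d)) : Submodule ℝ (H O × HVec O) :=
  Submodule.topologicalClosure
    { carrier := testPairs O
      zero_mem' := by
        refine ⟨0, contDiff_const, HasCompactSupport.zero, ?_, ?_, ?_⟩
        · simp
        · exact Lp.coeFn_zero _ _ _
        · have : gradient (0 : E d → ℝ) = 0 := by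
            ext1 x; simp [gradient]
          rw [this]
          exact Lp.coeFn_zero _ _ _
      add_mem' := by
        rintro a b ⟨φ, hφ, hφc, hφs, ha1, ha2⟩ ⟨ψ, hψ, hψc, hψs, hb1, hb2⟩
        refine ⟨φ + ψ, hφ.add hψ, hφc.add hψc, ?_, ?_, ?_⟩
        · exact (tsupport_add φ ψ).trans (Set.union_subset hφs hψs)
        · exact (Lp.coeFn_add _ _).trans (ha1.add hb1)
        · have : gradient (φ + ψ) = gradient φ + gradient ψ := by
            ext1 x
            simp only [gradient, Pi.add_apply]
            rw [fderiv_add (hφ.differentiable (by simp) x) (hψ.differentiable (by simp) x), map_add]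
          rw [this]
          exact (Lp.coeFn_add _ _).trans (ha2.add hb2)
      smul_mem' := by
        rintro c a ⟨φ, hφ, hφc, hφs, ha1, ha2⟩
        refine ⟨c • φ, contDiff_const.smul hφ, hφc.smul_left (f := fun _ => c), ?_, ?_, ?_⟩
        · exact (tsupport_smul_subset_right (fun _ => c) φ).trans hφs
        · exact (Lp.coeFn_smul _ _).trans (ha1.const_smul c)
        · have : gradient (c • φ) = c • gradient φ := by
            ext1 x
            simp only [gradient, Pi.smul_apply]
            rw [fderiv_const_smul (hφ.differentiable (by simp) x), map_smulₛₗ]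
            simp
          rw [this]
          exact (Lp.coeFn_smul _ _).trans (ha2.const_smul c) }

theorem mem_h1Zero {u : H O} {p : HVec O} : (u, p) ∈ h1Zero O ↔ IsH1Zero O u p := Iff.rfl

theorem isClosed_h1Zero : IsClosed (h1Zero O : Set (H O × HVec O)) :=
  Submodule.isClosed_topologicalClosure _

/-- Closed conditions on (u, ∇u) need only be checked on test functions. Both the grid approximation
and the Sobolev bound reach H¹₀ in this way. -/
theorem h1Zero_induction {C : Set (H O × HVec O)} (hC : IsClosed C) (h : testPairs O ⊆ C)
    {u : H O} {p : HVec O} (hup : IsH1Zero O u p) : (u, p) ∈ C :=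
  closure_minimal h hC hup

theorem norm_gradient (φ : E d → ℝ) (x : E d) : ‖gradient φ x‖ = ‖fderiv ℝ φ x‖ := by
  simp [gradient]

theorem enorm_gradient (φ : E d → ℝ) (x : E d) : ‖gradient φ x‖ₑ = ‖fderiv ℝ φ x‖ₑ := by
  rw [← ofReal_norm, ← ofReal_norm, norm_gradient]

theorem enorm_sq_eq_lintegral {F : Type*} [NormedAddCommGroup F] {α : Type*} {mα : MeasurableSpace α}
    {μ : Measure α} (u : Lp F 2 μ) : ‖u‖ₑ ^ 2 = ∫⁻ x, ‖u x‖ₑ ^ 2 ∂μ := by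
  rw [Lp.enorm_def, eLpNorm_eq_lintegral_rpow_enorm_toReal two_ne_zero ENNReal.ofNat_ne_top,
    ← ENNReal.rpow_natCast, ← ENNReal.rpow_mul]
  simp

/-- The derivative vanishes outside `O`, so estimates over the whole space, where translations act,
apply to the L² norm of the gradient on `O`. -/
theorem lintegral_fderiv_sq_eq {φ : E d → ℝ} (hs : tsupport φ ⊆ O) 
    {p : HVec O} (hp : p =ᵐ[volume.restrict O] gradient φ) :
    ∫⁻ x, ‖fderiv ℝ φ x‖ₑ ^ 2 = ‖p‖ₑ ^ 2 := by
  rw [enorm_sq_eq_lintegral]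
  have h1 : ∫⁻ x in O, ‖p x‖ₑ ^ 2 = ∫⁻ x in O, ‖fderiv ℝ φ x‖ₑ ^ 2 := by
    refine lintegral_congr_ae ?_
    filter_upwards [hp] with x hx
    rw [hx, enorm_gradient]
  rw [h1, setLIntegral_eq_of_support_subset]
  intro x hx
  refine hs (support_fderiv_subset ℝ (f := φ) ?_)
  intro h0
  refine hx ?_
  have h2 : ‖fderiv ℝ φ x‖ₑ = 0 := by
    rw [← enorm_gradient, gradient, h0, map_zero, enorm_zero]
  change ‖fderiv ℝ φ x‖ₑ ^ 2 = 0
  rw [h2, zero_pow two_ne_zero]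

end Space

/-! ### Rellich compactness on a bounded set -/

section Rellich

/-- The span of the indicators of the cells with indices in `[-N, N]ᵈ`. -/
noncomputable def cellSpan (O : Set (E d)) [IsFiniteMeasure (volume.restrict O)] (h : ℝ) (N : ℤ) :
    Submodule ℝ (H O) :=
  Submodule.span ℝ (Set.range fun k : Fintype.piFinset fun _ : Fin d => Finset.Icc (-N) N =>
    indicatorConstLp (μ := volume.restrict O) 2 (measurableSet_cell (h := h) k.1)
      (measure_ne_top _ _) (1 : ℝ))

theorem isFiniteMeasure_restrict (hOb : Bornology.IsBounded O) :
    IsFiniteMeasure (volume.restrict O) :=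
  ⟨by simpa using hOb.measure_lt_top⟩

theorem exists_bound_cellIndex (hOb : Bornology.IsBounded O) {h : ℝ} (hh : 0 < h) :
    ∃ N : ℤ, ∀ x ∈ O, cellIndex h x ∈ Fintype.piFinset fun _ : Fin d => Finset.Icc (-N) N := by
  obtain ⟨R, hR⟩ := hOb.exists_norm_le
  refine ⟨⌈R / h⌉, fun x hx => ?_⟩
  rw [Fintype.mem_piFinset]
  intro i
  have h1 : |x i| ≤ R := (PiLp.norm_apply_le x i).trans (hR x hx)
  rw [abs_le] at h1
  rw [Finset.mem_Icc]
  have h2 : x i / h ≤ R / h := by gcongr; exact h1.2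
  have h3 : -(R / h) ≤ x i / h := by rw [← neg_div]; gcongr; exact h1.1
  constructor
  · rw [cellIndex, Int.le_floor]
    push_cast
    linarith [Int.le_ceil (R / h)]
  · rw [cellIndex]
    exact (Int.floor_le_ceil _).trans (Int.ceil_mono h2)

/-- The approximant takes on each cell the average of the test function. On `O` only the finitely
many cells indexed by [-N, N]^d occur. -/
theorem exists_mem_cellSpan_norm_sub_le (hO : MeasurableSet O) [IsFiniteMeasure (volume.restrict O)]
    {h : ℝ} (hh : 0 < h) {N : ℤ}
    (hN : ∀ x ∈ O, cellIndex h x ∈ Fintype.piFinset fun _ : Fin d => Finset.Icc (-N) N)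
    {u : H O} {p : HVec O} (hup : (u, p) ∈ testPairs O) :
    ∃ w ∈ cellSpan O h N, ‖u - w‖ ≤ √(2 ^ d * d) * h * ‖p‖ := by
  obtain ⟨φ, hφ, hφc, hφs, hu, hp⟩ := hup
  simp only at hu hp
  let w : H O := ∑ k : Fintype.piFinset fun _ : Fin d => Finset.Icc (-N) N,
    cellAverage h φ k.1 • indicatorConstLp (μ := volume.restrict O) 2
      (measurableSet_cell (h := h) k.1) (measure_ne_top _ _) (1 : ℝ)
  refine ⟨w, Submodule.sum_mem _ fun k _ => Submodule.smul_mem _ _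
    (Submodule.subset_span ⟨k, rfl⟩), ?_⟩
  have hw : w =ᵐ[volume.restrict O] fun x => cellAverage h φ (cellIndex h x) := by
    have h1 : w =ᵐ[volume.restrict O] fun x => 
        ∑ k : Fintype.piFinset fun _ : Fin d => Finset.Icc (-N) N,
          cellAverage h φ k.1 * (cell h k.1).indicator (fun _ => (1 : ℝ)) x := by
      refine (Lp.coeFn_finsetSum _ _).trans ?_
      have h2 : ∀ k : Fintype.piFinset fun _ : Fin d => Finset.Icc (-N) N,
          ∀ᵐ x ∂(volume.restrict O), (cellAverage h φ k.1 • indicatorConstLp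
            (μ := volume.restrict O) 2 (measurableSet_cell (h := h) k.1)
            (measure_ne_top _ _) (1 : ℝ) : H O) x =
            cellAverage h φ k.1 * (cell h k.1).indicator (fun _ => (1 : ℝ)) x := by
        intro k
        filter_upwards [Lp.coeFn_smul (cellAverage h φ k.1) (indicatorConstLp
            (μ := volume.restrict O) 2 (measurableSet_cell (h := h) k.1)
            (measure_ne_top _ _) (1 : ℝ)), indicatorConstLp_coeFn (μ := volume.restrict O) 
            (p := 2) (hs := measurableSet_cell (h := h) k.1) 
            (hμs := measure_ne_top (volume.restrict O) (cell h k.1)) (c := (1 : ℝ))] with x hx hx2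
        rw [hx, Pi.smul_apply, hx2, smul_eq_mul]
      filter_upwards [ae_all_iff.2 h2] with x hx
      rw [Finset.sum_apply]
      exact Finset.sum_congr rfl fun k _ => hx k
    filter_upwards [h1, ae_restrict_mem hO] with x hx hxO
    rw [hx, Finset.sum_eq_single ⟨cellIndex h x, hN x hxO⟩]
    · simp [(mem_cell_iff hh).2 (rfl : cellIndex h x = _)]
    · intro k _ hk
      rw [Set.indicator_of_notMem, mul_zero]
      intro hxk
      exact hk (Subtype.ext ((mem_cell_iff hh).1 hxk).symm)
    · simp
  have key : ‖u - w‖ₑ ^ 2 ≤ ENNReal.ofReal (2 ^ d * d * h ^ 2) * ‖p‖ₑ ^ 2 := by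
    rw [← lintegral_fderiv_sq_eq hφs hp, enorm_sq_eq_lintegral]
    refine le_trans ?_ (lintegral_sub_cellAverage_sq_le hh (hφ.of_le (by simp)) hφc)
    refine le_trans (le_of_eq ?_) (setLIntegral_le_lintegral O _)
    refine lintegral_congr_ae ?_
    filter_upwards [hu, hw, Lp.coeFn_sub u w] with x h1 h2 h3
    rw [h3, Pi.sub_apply, h1, h2]
  rw [← ofReal_norm, ← ofReal_norm, ← ENNReal.ofReal_pow (norm_nonneg _),
    ← ENNReal.ofReal_pow (norm_nonneg _), ← ENNReal.ofReal_mul (by positivity),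
    ENNReal.ofReal_le_ofReal_iff (by positivity)] at key
  refine abs_le_of_sq_le_sq' ?_ (by positivity) |>.2
  rw [mul_pow, mul_pow, Real.sq_sqrt (by positivity)]
  exact key

/-- Elements of `H¹₀(O)` are approximated by a fixed finite-dimensional space, uniformly on
bounded sets of gradients. -/
theorem exists_finiteDimensional_approx (hO : MeasurableSet O) (hOb : Bornology.IsBounded O)
    {ε : ℝ} (hε : 0 < ε) :
    ∃ F : Submodule ℝ (H O), FiniteDimensional ℝ F ∧ ∀ u p, IsH1Zero O u p →
      ∃ w ∈ F, ‖w‖ ≤ ‖u‖ ∧ ‖u - w‖ ≤ ε * ‖p‖ := by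
  have := isFiniteMeasure_restrict hOb
  have hpos : 0 < √(2 ^ d * d) + 1 := by positivity
  set h := ε / (√(2 ^ d * d) + 1) with hdef
  have hh : 0 < h := by positivity
  obtain ⟨N, hN⟩ := exists_bound_cellIndex hOb hh
  have hfin : FiniteDimensional ℝ (cellSpan O h N) :=
    FiniteDimensional.span_of_finite ℝ (Set.finite_range _)
  refine ⟨cellSpan O h N, hfin, fun u p hup => ?_⟩
  -- The orthogonal projection is at least as good as any approximant in the span. It also depends
  -- continuously on u, so the estimate is a closed condition and passes from test pairs to H¹₀; and
  -- it does not increase the norm.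
  let K := (cellSpan O h N).starProjection
  refine ⟨K u, Submodule.starProjection_apply_mem _ _, Submodule.norm_starProjection_apply_le _ _, ?_⟩
  have hclosed : IsClosed {z : H O × HVec O | ‖z.1 - K z.1‖ ≤ ε * ‖z.2‖} :=
    isClosed_le (by fun_prop) (by fun_prop)
  refine h1Zero_induction hclosed ?_ hup
  rintro ⟨v, r⟩ hvr
  obtain ⟨w, hw, hvw⟩ := exists_mem_cellSpan_norm_sub_le hO hh hN hvr
  have h1 : ‖v - K v‖ ≤ ‖v - w‖ := by
    rw [Submodule.starProjection_minimal]
    exact ciInf_le ⟨0, by rintro _ ⟨x, rfl⟩; positivity⟩ (⟨w, hw⟩ : cellSpan O h N)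
  refine h1.trans (hvw.trans ?_)
  gcongr
  rw [hdef, ← mul_div_assoc, div_le_iff₀ hpos, mul_comm]
  gcongr
  linarith

/-- **Rellich's theorem**: bounded sets of `H¹₀(O)` are relatively compact in `L²(O)`. -/
theorem totallyBounded_h1Zero_ball (hO : MeasurableSet O) (hOb : Bornology.IsBounded O) (R : ℝ) :
    TotallyBounded {u : H O | ∃ p, IsH1Zero O u p ∧ ‖u‖ ≤ R ∧ ‖p‖ ≤ R} := by
  rw [Metric.totallyBounded_iff]
  intro ε hε
  rcases lt_or_ge R 0 with hR | hR
  · refine ⟨∅, Set.finite_empty, ?_⟩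
    rintro u ⟨p, -, h, -⟩
    linarith [norm_nonneg u]
  obtain ⟨F, hF, happ⟩ := exists_finiteDimensional_approx hO hOb (ε := ε / (2 * (R + 1)))
    (by positivity)
  have hcomp : IsCompact ((↑) '' Metric.closedBall (0 : F) R : Set (H O)) :=
    (isCompact_closedBall _ _).image continuous_subtype_val
  obtain ⟨t, ht, hcov⟩ := Metric.totallyBounded_iff.1 hcomp.totallyBounded (ε / 2) (by positivity)
  refine ⟨t, ht, ?_⟩
  rintro u ⟨p, hup, hu, hp⟩
  obtain ⟨w, hw, hwu, hd⟩ := happ u p hup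
  have hwm : w ∈ ((↑) '' Metric.closedBall (0 : F) R : Set (H O)) :=
    ⟨⟨w, hw⟩, by simpa using hwu.trans hu, rfl⟩
  obtain ⟨y, hy, hwy⟩ := Set.mem_iUnion₂.1 (hcov hwm)
  refine Set.mem_iUnion₂.2 ⟨y, hy, ?_⟩
  rw [Metric.mem_ball] at hwy ⊢
  have h2 : ε / (2 * (R + 1)) * ‖p‖ ≤ ε / 2 := by
    calc ε / (2 * (R + 1)) * ‖p‖ ≤ ε / (2 * (R + 1)) * (R + 1) := by gcongr; linarith
      _ = ε / 2 := by field_simp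
  calc dist u y ≤ dist u w + dist w y := dist_triangle _ _ _
    _ < ε / 2 + ε / 2 := by rw [dist_eq_norm u w]; linarith
    _ = ε := by ring

end Rellich

end DIE

namespace DIE

/-! ### Two elementary tools for minimisation -/

section Auxiliary

/-- Packages the parallelogram argument for minimising sequences: `a` is a multiple of the excess
over the infimum, and `u` is a component already known to converge. -/
theorem cauchySeq_of_norm_sub_sq_le {X Y : Type*} [SeminormedAddCommGroup X]
    [SeminormedAddCommGroup Y] {p : ℕ → X} {u : ℕ → Y} {a : ℕ → ℝ} (ha : Tendsto a atTop (𝓝 0))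
    (hu : CauchySeq u) {C : ℝ} (hC : 0 ≤ C)
    (h : ∀ n m, ‖p n - p m‖ ^ 2 ≤ a n + a m + C * ‖u n - u m‖ ^ 2) : CauchySeq p := by
  rw [Metric.cauchySeq_iff] at hu ⊢
  intro ε hε
  obtain ⟨N₁, hN₁⟩ := hu (ε / (2 * (C + 1))) (by positivity)
  obtain ⟨N₂, hN₂⟩ := (ha.eventually_lt_const (show (0 : ℝ) < ε ^ 2 / 4 by positivity)).exists_forall_of_atTop
  refine ⟨max N₁ N₂, fun m hm n hn => ?_⟩
  have h1 := hN₁ m (le_of_max_le_left hm) n (le_of_max_le_left hn)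
  have h2 := hN₂ m (le_of_max_le_right hm)
  have h3 := hN₂ n (le_of_max_le_right hn)
  rw [dist_eq_norm] at h1 ⊢
  have h4 : ‖u m - u n‖ ^ 2 ≤ (ε / (2 * (C + 1))) ^ 2 := by gcongr
  have h5 : C * ‖u m - u n‖ ^ 2 ≤ ε ^ 2 / 4 := by
    calc C * ‖u m - u n‖ ^ 2 ≤ (C + 1) ^ 2 * (ε / (2 * (C + 1))) ^ 2 := by
          gcongr; nlinarith
      _ = ε ^ 2 / 4 := by field_simp; ring
  refine abs_lt_of_sq_lt_sq' ?_ hε.le |>.2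
  nlinarith [h m n]

theorem eq_zero_of_forall_nonneg_quadratic {b c : ℝ} (h : ∀ t : ℝ, 0 ≤ 2 * b * t + c * t ^ 2) :
    b = 0 := by
  by_contra hb
  have hk : 0 < |c| + 1 := by positivity
  have h1 := h (-b / (|c| + 1))
  -- At t = -b/(|c| + 1) the linear term outweighs the quadratic one, whatever the sign of c.
  have h2 : 2 * b * (-b / (|c| + 1)) + c * (-b / (|c| + 1)) ^ 2 =
      b ^ 2 / (|c| + 1) ^ 2 * (c - 2 * (|c| + 1)) := by field_simp; ring
  rw [h2] at h1
  have h3 : 0 < b ^ 2 / (|c| + 1) ^ 2 := by positivity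
  nlinarith [le_abs_self c, abs_nonneg c]

end Auxiliary

/-! ### The Rayleigh quotient and Poincaré's inequality -/

section Poincare

variable {d : ℕ} {O : Set (E d)}

theorem IsH1Zero.add {u v : H O} {p r : HVec O} (h : IsH1Zero O u p) (h' : IsH1Zero O v r) :
    IsH1Zero O (u + v) (p + r) := (h1Zero O).add_mem (x := (u, p)) (y := (v, r)) h h'

theorem IsH1Zero.sub {u v : H O} {p r : HVec O} (h : IsH1Zero O u p) (h' : IsH1Zero O v r) :
    IsH1Zero O (u - v) (p - r) := (h1Zero O).sub_mem (x := (u, p)) (y := (v, r)) h h'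

theorem IsH1Zero.smul {u : H O} {p : HVec O} (c : ℝ) (h : IsH1Zero O u p) :
    IsH1Zero O (c • u) (c • p) := (h1Zero O).smul_mem (x := (u, p)) c h

theorem IsH1Zero.of_tendsto {u : ℕ → H O} {p : ℕ → HVec O} {v : H O} {r : HVec O}
    (h : ∀ n, IsH1Zero O (u n) (p n)) (hu : Tendsto u atTop (𝓝 v)) (hp : Tendsto p atTop (𝓝 r)) :
    IsH1Zero O v r :=
  isClosed_h1Zero.mem_of_tendsto (hu.prodMk_nhds hp) (Eventually.of_forall h)

/-- The infimum of the Rayleigh quotient over `H¹₀(O)`. -/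
noncomputable def rayleighInf (O : Set (E d)) : ℝ :=
  sInf {r | ∃ (u : H O) (p : HVec O), IsH1Zero O u p ∧ ‖u‖ = 1 ∧ r = ‖p‖ ^ 2}

theorem bddBelow_rayleigh :
    BddBelow {r | ∃ (u : H O) (p : HVec O), IsH1Zero O u p ∧ ‖u‖ = 1 ∧ r = ‖p‖ ^ 2} := by
  refine ⟨0, ?_⟩
  rintro r ⟨u, p, -, -, rfl⟩
  positivity

theorem rayleighInf_mul_norm_sq_le {u : H O} {p : HVec O} (h : IsH1Zero O u p) :
    rayleighInf O * ‖u‖ ^ 2 ≤ ‖p‖ ^ 2 := by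
  rcases eq_or_ne u 0 with rfl | hu
  · simp
  have hu0 : 0 < ‖u‖ := norm_pos_iff.2 hu
  have h1 : rayleighInf O ≤ ‖‖u‖⁻¹ • p‖ ^ 2 :=
    csInf_le bddBelow_rayleigh ⟨_, _, h.smul ‖u‖⁻¹, by
      rw [norm_smul, norm_inv, norm_norm, inv_mul_cancel₀ hu0.ne'], rfl⟩
  rw [norm_smul, norm_inv, norm_norm, mul_pow, inv_pow] at h1
  calc rayleighInf O * ‖u‖ ^ 2 ≤ (‖u‖ ^ 2)⁻¹ * ‖p‖ ^ 2 * ‖u‖ ^ 2 := by gcongr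
    _ = ‖p‖ ^ 2 := by field_simp

theorem rayleighInf_nonneg : 0 ≤ rayleighInf O :=
  Real.sInf_nonneg (by rintro r ⟨u, p, -, -, rfl⟩; positivity)

/-- A minimising sequence of unit vectors has bounded gradients, so Rellich's theorem gives a
subsequence converging in L². Its gradients are then Cauchy by the parallelogram law, and closedness
of H¹₀ keeps the limit admissible. -/
theorem exists_rayleigh_minimizer (hO : MeasurableSet O) (hOb : Bornology.IsBounded O)
    (hne : ∃ (u : H O) (p : HVec O), IsH1Zero O u p ∧ u ≠ 0) :
    ∃ (u : H O) (p : HVec O), IsH1Zero O u p ∧ ‖u‖ = 1 ∧ ‖p‖ ^ 2 = rayleighInf O := by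
  have hne' : {r | ∃ (u : H O) (p : HVec O),
      IsH1Zero O u p ∧ ‖u‖ = 1 ∧ r = ‖p‖ ^ 2}.Nonempty := by
    obtain ⟨u, p, h, hu⟩ := hne
    have hu0 : 0 < ‖u‖ := norm_pos_iff.2 hu
    exact ⟨_, _, _, h.smul ‖u‖⁻¹, by
      rw [norm_smul, norm_inv, norm_norm, inv_mul_cancel₀ hu0.ne'], rfl⟩
  obtain ⟨s, -, hs, hmem⟩ := exists_seq_tendsto_sInf hne' bddBelow_rayleigh
  choose u p hup hu hp using hmem
  obtain ⟨R, hR⟩ := hs.bddAbove_range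
  have hRs : ∀ n, s n ≤ R := fun n => hR ⟨n, rfl⟩
  have hK := totallyBounded_h1Zero_ball hO hOb (max 1 √R)
  have hcomp : IsCompact (closure {v : H O | ∃ r, IsH1Zero O v r ∧ ‖v‖ ≤ max 1 √R ∧
      ‖r‖ ≤ max 1 √R}) := isCompact_iff_totallyBounded_isComplete.2
        ⟨hK.closure, isClosed_closure.isComplete⟩
  obtain ⟨v, -, φ, hφ, hv⟩ := hcomp.tendsto_subseq (x := u) fun n =>
    subset_closure ⟨p n, hup n, by simp [hu n],
      le_max_of_le_right (Real.le_sqrt_of_sq_le ((hp n).symm.le.trans (hRs n)))⟩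
  have hs' : Tendsto (fun n => s (φ n)) atTop (𝓝 (rayleighInf O)) := hs.comp hφ.tendsto_atTop
  have hcau : CauchySeq fun n => p (φ n) := by
    refine cauchySeq_of_norm_sub_sq_le (a := fun n => 2 * (s (φ n) - rayleighInf O)) ?_
      hv.cauchySeq (rayleighInf_nonneg (O := O)) fun n m => ?_
    · simpa using (hs'.sub_const (rayleighInf O)).const_mul 2
    -- With λ the infimum, ‖p_n + p_m‖² ≥ λ‖u_n + u_m‖² = λ(4 - ‖u_n - u_m‖²). The parallelogram law
    -- for the gradients then bounds ‖p_n - p_m‖².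
    · have h1 := rayleighInf_mul_norm_sq_le ((hup (φ n)).add (hup (φ m)))
      have h2 := parallelogram_law_with_norm ℝ (p (φ n)) (p (φ m))
      have h3 := parallelogram_law_with_norm ℝ (u (φ n)) (u (φ m))
      rw [hu, hu] at h3
      have h4 : ‖u (φ n) + u (φ m)‖ ^ 2 = 4 - ‖u (φ n) - u (φ m)‖ ^ 2 := by nlinarith
      rw [h4] at h1
      rw [hp (φ n), hp (φ m)]
      simp only [Function.comp_apply]
      nlinarith
  obtain ⟨r, hr⟩ := cauchySeq_tendsto_of_complete hcau
  refine ⟨v, r, IsH1Zero.of_tendsto (fun n => hup (φ n)) hv hr, ?_, ?_⟩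
  · refine tendsto_nhds_unique hv.norm ?_
    simp [hu]
  · refine tendsto_nhds_unique (hr.norm.pow 2) ?_
    simpa only [hp] using hs'

/-- First variation: t ↦ ‖p + tr‖² - λ‖u + tv‖² is nonnegative and vanishes at t = 0, so its linear
coefficient is zero. -/
theorem isDirichletEigenvalue_rayleighInf (hO : MeasurableSet O) (hOb : Bornology.IsBounded O)
    (hne : ∃ (u : H O) (p : HVec O), IsH1Zero O u p ∧ u ≠ 0) :
    IsDirichletEigenvalue O (rayleighInf O) := by
  obtain ⟨u, p, hup, hu, hp⟩ := exists_rayleigh_minimizer hO hOb hne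
  refine ⟨u, p, hup, by rintro rfl; simp at hu, fun v r hvr => ?_⟩
  rw [← sub_eq_zero]
  refine eq_zero_of_forall_nonneg_quadratic (c := ‖r‖ ^ 2 - rayleighInf O * ‖v‖ ^ 2) fun t => ?_
  have h1 := rayleighInf_mul_norm_sq_le (hup.add (hvr.smul t))
  rw [norm_add_sq_real, norm_add_sq_real, norm_smul, norm_smul, mul_pow, mul_pow,
    inner_smul_right, inner_smul_right, hu, hp, Real.norm_eq_abs, sq_abs] at h1
  nlinarith

/-- **Poincaré's inequality** with the first Dirichlet eigenvalue. -/
theorem lambda1_mul_norm_sq_le (hO : MeasurableSet O) (hOb : Bornology.IsBounded O)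
    {u : H O} {p : HVec O} (h : IsH1Zero O u p) : lambda1 O * ‖u‖ ^ 2 ≤ ‖p‖ ^ 2 := by
  rcases eq_or_ne u 0 with rfl | hu
  · simp
  have h1 : lambda1 O ≤ rayleighInf O := by
    -- The infimum is only meaningful once the eigenvalues are bounded below; testing an eigenvector
    -- with itself shows that they are nonnegative.
    refine csInf_le ⟨0, ?_⟩ (isDirichletEigenvalue_rayleighInf hO hOb ⟨u, p, h, hu⟩)
    rintro lam ⟨v, r, hvr, hv, heq⟩
    have h2 := heq v r hvr
    rw [real_inner_self_eq_norm_sq, real_inner_self_eq_norm_sq] at h2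
    have h3 : 0 < ‖v‖ ^ 2 := by have := norm_pos_iff.2 hv; positivity
    by_contra hneg
    nlinarith [sq_nonneg ‖r‖]
  calc lambda1 O * ‖u‖ ^ 2 ≤ rayleighInf O * ‖u‖ ^ 2 := by gcongr
    _ ≤ _ := rayleighInf_mul_norm_sq_le h

end Poincare

end DIE

namespace DIE

/-! ### Sobolev embedding of H¹₀ in dimensions one to three -/

section Sobolev

/-- `E 1` is isometric to ℝ, where a compactly supported function is bounded by the integral of its
derivative over a half-line. -/
theorem enorm_le_lintegral_fderiv_of_dim_one {φ : E 1 → ℝ} (hφ : ContDiff ℝ 1 φ)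
    (hc : HasCompactSupport φ) (x : E 1) : ‖φ x‖ₑ ≤ ∫⁻ y, ‖fderiv ℝ φ y‖ₑ := by
  let b := OrthonormalBasis.singleton (Fin 1) ℝ
  have hcomp : HasCompactSupport (φ ∘ b.repr) :=
    hc.comp_homeomorph b.repr.toHomeomorph
  have hdiff : ContDiff ℝ 1 (φ ∘ b.repr) := hφ.comp b.repr.contDiff
  have h1 := HasCompactSupport.enorm_le_lintegral_Ici_deriv hdiff hcomp (b.repr.symm x)
  simp only [Function.comp_apply, LinearIsometryEquiv.apply_symm_apply] at h1
  refine h1.trans ((setLIntegral_le_lintegral _ _).trans ?_)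
  have hmeas : Measurable fun y => ‖fderiv ℝ φ y‖ₑ :=
    (hφ.continuous_fderiv one_ne_zero).enorm.measurable
  refine le_trans (lintegral_mono fun t => ?_)
    (b.measurePreserving_repr.lintegral_comp hmeas).le
  have h2 : deriv (φ ∘ b.repr) t = fderiv ℝ φ (b.repr t) (b.repr 1) := by
    have h3 : HasDerivAt (b.repr : ℝ → E 1) (b.repr 1) t := by
      simpa using (b.repr.toContinuousLinearEquiv.toContinuousLinearMap.hasDerivAt (x := t))
    exact ((hφ.differentiable one_ne_zero _).hasFDerivAt.comp_hasDerivAt t h3).deriv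
  rw [h2]
  refine (ContinuousLinearMap.le_opENorm _ _).trans ?_
  have h4 : ‖b.repr (1 : ℝ)‖ₑ = 1 := by
    have h5 : ‖b.repr (1 : ℝ)‖ = 1 := (b.repr.norm_map 1).trans norm_one
    rw [← ofReal_norm, h5, ENNReal.ofReal_one]
  rw [h4, mul_one]

variable {d : ℕ} {O : Set (E d)}

/-- The Gagliardo–Nirenberg–Sobolev inequality for test functions in dimensions one to three. -/
theorem exists_eLpNorm_le_fderiv (hd : 1 ≤ d) (hd3 : d ≤ 3) (hOb : Bornology.IsBounded O)
    {r : ℝ≥0} (hr : 2 ≤ r) (hr6 : d = 3 → r ≤ 6) :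
    ∃ (C p : ℝ≥0), 1 ≤ p ∧ p ≤ 2 ∧ ∀ φ : E d → ℝ, ContDiff ℝ 1 φ → HasCompactSupport φ →
      tsupport φ ⊆ O →
      eLpNorm φ r (volume.restrict O) ≤ C * eLpNorm (fderiv ℝ φ) p volume := by
  have hfin := isFiniteMeasure_restrict hOb
  have hr0 : 0 < r := lt_of_lt_of_le (by norm_num) hr
  have hr2 : (2 : ℝ) ≤ r := by exact_mod_cast hr
  interval_cases d
  · refine ⟨((volume.restrict O) Set.univ ^ (1 / (r : ℝ))).toNNReal, 1, le_rfl, one_le_two,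
      fun φ hφ hc hs => ?_⟩
    rw [ENNReal.coe_toNNReal (ENNReal.rpow_ne_top_of_nonneg (by positivity) (measure_ne_top _ _)),
      mul_comm, ENNReal.coe_one, eLpNorm_one_eq_lintegral_enorm]
    have h1 := eLpNorm_le_eLpNorm_mul_rpow_measure_univ (μ := volume.restrict O) (p := r)
      (q := ∞) le_top hφ.continuous.aestronglyMeasurable
    simp only [ENNReal.coe_toReal, ENNReal.toReal_top, div_zero, sub_zero] at h1
    refine h1.trans (mul_le_mul_left ?_ _)
    rw [eLpNorm_exponent_top]
    exact eLpNormEssSup_le_of_ae_enorm_bound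
      (ae_of_all _ fun x => enorm_le_lintegral_fderiv_of_dim_one hφ hc x)
  -- For d = 2 the exponent p = 2r/(r + 2) satisfies 1/p - 1/2 = 1/r, so r is exactly its Sobolev
  -- conjugate, and p < 2.
  · have hp : (1 : ℝ) ≤ 2 * r / (r + 2) := by rw [le_div_iff₀ (by positivity)]; linarith
    have hp2 : 2 * (r : ℝ) / (r + 2) < 2 := by rw [div_lt_iff₀ (by positivity)]; linarith
    refine ⟨eLpNormLESNormFDerivOfLeConst ℝ volume O (2 * r / (r + 2)) r, 2 * r / (r + 2),
      by exact_mod_cast hp, by exact_mod_cast hp2.le, fun φ hφ hc hs => ?_⟩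
    refine (eLpNorm_restrict_le _ _ _ _).trans ?_
    refine eLpNorm_le_eLpNorm_fderiv_of_le volume hφ ((subset_tsupport φ).trans hs)
      (by exact_mod_cast hp) ?_ ?_ hOb
    · rw [finrank_euclideanSpace_fin]; exact_mod_cast hp2
    · rw [finrank_euclideanSpace_fin]
      push_cast
      have : (0 : ℝ) < r := by linarith
      rw [inv_div, div_sub' (by simpa using hr0.ne'), div_le_iff₀ (by positivity)]
      field_simp
      linarith
  -- For d = 3 the exponent p = 2 has Sobolev conjugate 6; smaller r are reached because `O` is
  -- bounded.
  · have h6 := hr6 rfl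
    have h6' : (r : ℝ) ≤ 6 := by exact_mod_cast h6
    refine ⟨eLpNormLESNormFDerivOfLeConst ℝ volume O 2 r, 2, one_le_two, le_rfl,
      fun φ hφ hc hs => ?_⟩
    refine (eLpNorm_restrict_le _ _ _ _).trans ?_
    refine eLpNorm_le_eLpNorm_fderiv_of_le volume hφ ((subset_tsupport φ).trans hs)
      one_le_two ?_ ?_ hOb
    · rw [finrank_euclideanSpace_fin]; norm_num
    · rw [finrank_euclideanSpace_fin]
      push_cast
      rw [le_inv_comm₀ (by norm_num) (by linarith)]
      norm_num
      exact h6'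

/-- L² convergence implies convergence in measure, under which the Lʳ norm is lower semicontinuous,
while the gradient norms converge. So the Sobolev bound survives limits. -/
theorem isClosed_eLpNorm_fst_le (r : ℝ≥0∞) (C : ℝ≥0) :
    IsClosed {z : H O × HVec O | eLpNorm z.1 r (volume.restrict O) ≤ C * ‖z.2‖ₑ} := by
  rw [← isSeqClosed_iff_isClosed]
  intro z w hz hzw
  have h1 : Tendsto (fun n => (z n).1) atTop (𝓝 w.1) := (continuous_fst.tendsto _).comp hzw
  have h2 : Tendsto (fun n => ‖(z n).2‖ₑ) atTop (𝓝 ‖w.2‖ₑ) :=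
    ((continuous_enorm.comp continuous_snd).tendsto _).comp hzw
  have h3 : Tendsto (fun n => (C : ℝ≥0∞) * ‖(z n).2‖ₑ) atTop (𝓝 ((C : ℝ≥0∞) * ‖w.2‖ₑ)) :=
    ENNReal.Tendsto.const_mul h2 (Or.inr ENNReal.coe_ne_top)
  change eLpNorm w.1 r (volume.restrict O) ≤ C * ‖w.2‖ₑ
  refine le_of_forall_gt_imp_ge_of_dense fun c hc => ?_
  refine eLpNorm_le_of_tendstoInMeasure ?_ (tendstoInMeasure_of_tendsto_Lp h1)
    fun n => Lp.aestronglyMeasurable _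
  filter_upwards [h3.eventually_lt_const hc] with n hn
  exact (hz n).trans hn.le

/-- The gradient lives on `O`, which has finite measure, so Hölder's inequality replaces Lˢ by L².
-/
theorem eLpNorm_fderiv_le_norm_gradient [IsFiniteMeasure (volume.restrict O)] {s : ℝ≥0}
    (hs2 : s ≤ 2) {φ : E d → ℝ} (hφ : ContDiff ℝ 1 φ) (hφs : tsupport φ ⊆ O) {q : HVec O}
    (hq : q =ᵐ[volume.restrict O] gradient φ) :
    eLpNorm (fderiv ℝ φ) s volume ≤
      (volume.restrict O) Set.univ ^ (1 / (s : ℝ) - 1 / 2) * ‖q‖ₑ := by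
  have hcont : Continuous (gradient φ) :=
    (InnerProductSpace.toDual ℝ (E d)).symm.continuous.comp (hφ.continuous_fderiv one_ne_zero)
  have hsupp : Function.support (gradient φ) ⊆ O := by
    intro x hx
    refine hφs (support_fderiv_subset ℝ fun h0 => hx ?_)
    rw [gradient, h0, map_zero]
  have h0 : eLpNorm (gradient φ) s (volume.restrict O) = eLpNorm (fderiv ℝ φ) s volume := by
    rw [eLpNorm_restrict_eq_of_support_subset hsupp]
    exact eLpNorm_congr_norm_ae (ae_of_all _ fun x => norm_gradient φ x)
  have h1 := eLpNorm_le_eLpNorm_mul_rpow_measure_univ (μ := volume.restrict O) (p := s)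
      (q := 2) (by exact_mod_cast hs2) (hcont.aestronglyMeasurable (μ := volume.restrict O))
  simp only [ENNReal.coe_toReal, ENNReal.toReal_ofNat] at h1
  rw [← h0, mul_comm, Lp.enorm_def, eLpNorm_congr_ae hq]
  exact h1

/-- The embedding of `H¹₀(O)` into `Lʳ(O)` in dimensions one to three. -/
theorem exists_eLpNorm_le_of_isH1Zero (hd : 1 ≤ d) (hd3 : d ≤ 3) (hOb : Bornology.IsBounded O)
    {r : ℝ≥0} (hr : 2 ≤ r) (hr6 : d = 3 → r ≤ 6) :
    ∃ C : ℝ≥0, ∀ u p, IsH1Zero O u p → eLpNorm u r (volume.restrict O) ≤ C * ‖p‖ₑ := by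
  have hfin := isFiniteMeasure_restrict hOb
  obtain ⟨C, s, hs1, hs2, hC⟩ := exists_eLpNorm_le_fderiv hd hd3 hOb hr hr6
  obtain ⟨D, hD⟩ : ∃ D : ℝ≥0, (D : ℝ≥0∞) =
      (volume.restrict O) Set.univ ^ (1 / (s : ℝ) - 1 / 2) := by
    refine ENNReal.canLift.prf _ (ENNReal.rpow_ne_top_of_nonneg ?_ (measure_ne_top _ _))
    have h1 : (1 : ℝ) ≤ s := by exact_mod_cast hs1
    have h2 : (s : ℝ) ≤ 2 := by exact_mod_cast hs2
    rw [sub_nonneg]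
    exact one_div_le_one_div_of_le (by linarith) h2
  refine ⟨C * D, fun u p hup => ?_⟩
  have htest : testPairs O ⊆
      {z : H O × HVec O | eLpNorm z.1 r (volume.restrict O) ≤ (C * D : ℝ≥0) * ‖z.2‖ₑ} := by
    rintro ⟨v, q⟩ ⟨φ, hφ, hφc, hφs, hv, hq⟩
    simp only at hv hq
    have hφ1 : ContDiff ℝ 1 φ := hφ.of_le (by simp)
    have h1 := hC φ hφ1 hφc hφs
    have h2 := eLpNorm_fderiv_le_norm_gradient hs2 hφ1 hφs hq
    have h3 : eLpNorm v r (volume.restrict O) = eLpNorm φ r (volume.restrict O) :=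
      eLpNorm_congr_ae hv
    change eLpNorm v r (volume.restrict O) ≤ (C * D : ℝ≥0) * ‖q‖ₑ
    rw [h3, ENNReal.coe_mul, mul_assoc, hD]
    exact h1.trans (mul_le_mul_right h2 _)
  exact h1Zero_induction (isClosed_eLpNorm_fst_le r (C * D)) htest hup

end Sobolev
end DIE

namespace DIE

/-! ### Direct method for convex coercive functionals -/

section Minimization

variable {X Y : Type*} [NormedAddCommGroup X] [InnerProductSpace ℝ X] [CompleteSpace X]
  [NormedAddCommGroup Y] [InnerProductSpace ℝ Y] [CompleteSpace Y]

/-- Existence of a minimizer of a coercive quadratic functional perturbed by a nonnegative,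
lower semicontinuous and (midpoint) convex functional. -/
theorem exists_minimizer {V : Submodule ℝ (X × Y)} (hV : IsClosed (V : Set (X × Y)))
    {α τ c : ℝ} (hc : 0 < c)
    (hcoer : ∀ z ∈ V, c * (‖z.1‖ ^ 2 + ‖z.2‖ ^ 2) ≤ α * ‖z.1‖ ^ 2 + τ * ‖z.2‖ ^ 2)
    {Φ : X → ℝ} (hΦ0 : ∀ u, 0 ≤ Φ u)
    (hconv : ∀ z ∈ V, ∀ z' ∈ V, Φ ((1 / 2 : ℝ) • (z.1 + z'.1)) ≤ (Φ z.1 + Φ z'.1) / 2)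
    (hlsc : ∀ z : ℕ → X × Y, (∀ n, z n ∈ V) → ∀ u ∈ V, Tendsto z atTop (𝓝 u) →
      ∀ b : ℝ, (∀ᶠ n in atTop, Φ (z n).1 ≤ b) → Φ u.1 ≤ b) (w : X) :
    ∃ z ∈ V, ∀ z' ∈ V, (α * ‖z.1‖ ^ 2 + τ * ‖z.2‖ ^ 2) / 2 + Φ z.1 - ⟪w, z.1⟫ ≤
      (α * ‖z'.1‖ ^ 2 + τ * ‖z'.2‖ ^ 2) / 2 + Φ z'.1 - ⟪w, z'.1⟫ := by
  set J : X × Y → ℝ := fun z => (α * ‖z.1‖ ^ 2 + τ * ‖z.2‖ ^ 2) / 2 + Φ z.1 - ⟪w, z.1⟫ with hJ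
  -- Coercivity absorbs ⟨w, u⟩ through Young's inequality, which produces the lower bound
  -- -‖w‖²/(2c).
  have hbdd : BddBelow (J '' V) := by
    refine ⟨-(‖w‖ ^ 2 / (2 * c)), ?_⟩
    rintro _ ⟨z, hz, rfl⟩
    have h1 := hcoer z hz
    have h2 := real_inner_le_norm w z.1
    have h3 : ‖w‖ * ‖z.1‖ ≤ ‖w‖ ^ 2 / (2 * c) + c * ‖z.1‖ ^ 2 / 2 := by
      have h4 : 0 ≤ (‖w‖ - c * ‖z.1‖) ^ 2 / (2 * c) := by positivity
      have h5 : (‖w‖ - c * ‖z.1‖) ^ 2 / (2 * c) =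
          ‖w‖ ^ 2 / (2 * c) - ‖w‖ * ‖z.1‖ + c * ‖z.1‖ ^ 2 / 2 := by field_simp; ring
      linarith
    have h6 : 0 ≤ c * ‖z.2‖ ^ 2 := by positivity
    simp only [hJ]
    linarith [hΦ0 z.1]
  have hne : (J '' V).Nonempty := ⟨_, 0, V.zero_mem, rfl⟩
  obtain ⟨s, -, hs, hmem⟩ := exists_seq_tendsto_sInf hne hbdd
  choose z hzV hzs using hmem
  have hinf : ∀ z' ∈ V, sInf (J '' V) ≤ J z' := fun z' hz' => csInf_le hbdd ⟨z', hz', rfl⟩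
  -- The midpoint of z_n and z_m has energy at least the infimum. Midpoint convexity of Φ and the
  -- parallelogram law turn this into a bound on the quadratic form at z_n - z_m, so minimising
  -- sequences converge strongly.
  have hpar : ∀ n m, c * (‖(z n).1 - (z m).1‖ ^ 2 + ‖(z n).2 - (z m).2‖ ^ 2) ≤
      4 * (s n - sInf (J '' V)) + 4 * (s m - sInf (J '' V)) := by
    intro n m
    have h1 := hcoer _ (V.sub_mem (hzV n) (hzV m))
    have h2 := hinf _ (V.smul_mem (1 / 2 : ℝ) (V.add_mem (hzV n) (hzV m)))
    have h3 := hconv _ (hzV n) _ (hzV m)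
    have h4 := parallelogram_law_with_norm ℝ (z n).1 (z m).1
    have h5 := parallelogram_law_with_norm ℝ (z n).2 (z m).2
    rw [← hzs n, ← hzs m]
    simp only [hJ, Prod.smul_fst, Prod.smul_snd, Prod.fst_add, Prod.snd_add, Prod.fst_sub,
      Prod.snd_sub, norm_smul, mul_pow, inner_smul_right, inner_add_right] at h1 h2 h3 ⊢
    norm_num at h2
    rw [smul_add] at h3
    linear_combination h1 + 8 * h2 + 8 * h3 + α * h4 + τ * h5
  have hs0 : Tendsto (fun n => 4 / c * (s n - sInf (J '' V))) atTop (𝓝 0) := by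
    simpa using (hs.sub_const (sInf (J '' V))).const_mul (4 / c)
  have hpar' : ∀ n m, ‖(z n).1 - (z m).1‖ ^ 2 + ‖(z n).2 - (z m).2‖ ^ 2 ≤
      4 / c * (s n - sInf (J '' V)) + 4 / c * (s m - sInf (J '' V)) := by
    intro n m
    have := hpar n m
    rw [← mul_le_mul_iff_right₀ hc]
    refine this.trans (le_of_eq ?_)
    field_simp
  have hc1 : CauchySeq fun n => (z n).1 := by
    refine cauchySeq_of_norm_sub_sq_le hs0 (cauchySeq_const (0 : ℝ)) le_rfl fun n m => ?_
    have := hpar' n m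
    nlinarith [sq_nonneg ‖(z n).2 - (z m).2‖]
  have hc2 : CauchySeq fun n => (z n).2 := by
    refine cauchySeq_of_norm_sub_sq_le hs0 (cauchySeq_const (0 : ℝ)) le_rfl fun n m => ?_
    have := hpar' n m
    nlinarith [sq_nonneg ‖(z n).1 - (z m).1‖]
  obtain ⟨u, hu⟩ := cauchySeq_tendsto_of_complete hc1
  obtain ⟨p, hp⟩ := cauchySeq_tendsto_of_complete hc2
  have hz : Tendsto z atTop (𝓝 (u, p)) := hu.prodMk_nhds hp
  have hupV : (u, p) ∈ V := hV.mem_of_tendsto hz (Eventually.of_forall hzV)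
  refine ⟨(u, p), hupV, fun z' hz' => le_trans ?_ (hinf z' hz')⟩
  -- The quadratic and linear parts converge along the sequence, so the values of Φ converge too,
  -- and lower semicontinuity of Φ is all that remains to be used.
  have hquad : Tendsto (fun n => s n - (α * ‖(z n).1‖ ^ 2 + τ * ‖(z n).2‖ ^ 2) / 2 + ⟪w, (z n).1⟫)
      atTop (𝓝 (sInf (J '' V) - (α * ‖u‖ ^ 2 + τ * ‖p‖ ^ 2) / 2 + ⟪w, u⟫)) := by
    refine (hs.sub ?_).add (tendsto_const_nhds.inner hu)
    exact (((hu.norm.pow 2).const_mul α).add ((hp.norm.pow 2).const_mul τ)).div_const 2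
  have hΦ : Φ u ≤ sInf (J '' V) - (α * ‖u‖ ^ 2 + τ * ‖p‖ ^ 2) / 2 + ⟪w, u⟫ := by
    refine le_of_forall_gt_imp_ge_of_dense fun b hb => ?_
    refine hlsc z hzV (u, p) hupV hz b ?_
    filter_upwards [hquad.eventually_lt_const hb] with n hn
    have := hzs n
    simp only [hJ] at this
    linarith
  simp only
  linarith

end Minimization

/-! ### Convex potentials of monotone functions with polynomial growth -/

section Potential

variable {h : ℝ → ℝ}

/-- The primitive of `h` vanishing at `0`. -/
noncomputable def potential (h : ℝ → ℝ) (ξ : ℝ) : ℝ := ∫ t in (0 : ℝ)..ξ, h t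

theorem potential_zero : potential h 0 = 0 := by simp [potential]

theorem continuous_potential (hc : Continuous h) : Continuous (potential h) :=
  intervalIntegral.continuous_primitive (fun a b => hc.intervalIntegrable a b) 0

/-- The integral of `h` between a and b is compared with its value at the endpoint b. Nonnegativity,
the upper bound and midpoint convexity of the potential are all instances of this subgradient
inequality. -/
theorem potential_sub_le (hc : Continuous h) (hm : Monotone h) (a b : ℝ) :
    potential h b - potential h a ≤ h b * (b - a) := by
  have h1 : potential h b - potential h a = ∫ t in a..b, h t :=
    intervalIntegral.integral_interval_sub_left (hc.intervalIntegrable (μ := volume) 0 b)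
      (hc.intervalIntegrable 0 a)
  rw [h1]
  rcases le_total a b with hab | hab
  · have := intervalIntegral.integral_mono_on hab (hc.intervalIntegrable (μ := volume) a b)
      (intervalIntegrable_const (c := h b)) fun t ht => hm ht.2
    simpa [mul_comm] using this
  · have := intervalIntegral.integral_mono_on hab (intervalIntegrable_const (c := h b))
      (hc.intervalIntegrable (μ := volume) b a) fun t ht => hm ht.1
    rw [intervalIntegral.integral_symm]
    simp at this
    linarith

theorem potential_nonneg (hc : Continuous h) (hm : Monotone h) (h0 : h 0 = 0) (ξ : ℝ) :
    0 ≤ potential h ξ := by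
  have := potential_sub_le hc hm ξ 0
  rw [potential_zero, h0] at this
  linarith

theorem potential_le (hc : Continuous h) (hm : Monotone h) (ξ : ℝ) :
    potential h ξ ≤ h ξ * ξ := by
  simpa [potential_zero] using potential_sub_le hc hm 0 ξ

theorem potential_midpoint_le (hc : Continuous h) (hm : Monotone h) (a b : ℝ) :
    potential h (1 / 2 * (a + b)) ≤ (potential h a + potential h b) / 2 := by
  have h1 := potential_sub_le hc hm a (1 / 2 * (a + b))
  have h2 := potential_sub_le hc hm b (1 / 2 * (a + b))
  linarith

/-- The map t ↦ h(y + tv)v is nondecreasing whatever the sign of v, so its values on [0, 1] lie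
between those at the ends. This gives a majorant independent of t for dominated convergence. -/
theorem mul_comp_add_mul_mem_uIcc (hm : Monotone h) (y v : ℝ) {t : ℝ} (ht0 : 0 ≤ t) (ht1 : t ≤ 1) :
    |h (y + t * v) * v| ≤ |h y * v| + |h (y + v) * v| := by
  have h1 : h y * v ≤ h (y + t * v) * v ∧ h (y + t * v) * v ≤ h (y + v) * v := by
    rcases le_total 0 v with hv | hv
    · constructor
      · exact mul_le_mul_of_nonneg_right (hm (by nlinarith)) hv
      · exact mul_le_mul_of_nonneg_right (hm (by nlinarith)) hv
    · constructor
      · exact mul_le_mul_of_nonpos_right (hm (by nlinarith)) hv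
      · exact mul_le_mul_of_nonpos_right (hm (by nlinarith)) hv
  rw [abs_le]
  constructor
  · linarith [neg_abs_le (h y * v), abs_nonneg (h (y + v) * v)]
  · linarith [le_abs_self (h (y + v) * v), abs_nonneg (h y * v)]

variable {α : Type*} [MeasurableSpace α] {μ : Measure α}

/-- With r = q + 1 the product |a|^q |b| is at most the r-th power of the larger of |a| and |b|. -/
theorem integrable_comp_mul [IsFiniteMeasure μ] (hc : Continuous h) {C q : ℝ} {r : ℝ≥0} (hr : (r : ℝ) = q + 1)
    (hq : 1 ≤ q) (hgr : ∀ ξ, |h ξ| ≤ C * (1 + |ξ| ^ q)) {a b : α → ℝ} (ha : MemLp a r μ)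
    (hb : MemLp b r μ) : Integrable (fun x => h (a x) * b x) μ := by
  have hr0 : (r : ℝ≥0∞) ≠ 0 := by
    have : (0 : ℝ) < r := by linarith
    exact_mod_cast this.ne'
  have hC : 0 ≤ C := by
    have := hgr 0
    rw [abs_zero, Real.zero_rpow (by linarith)] at this
    linarith [abs_nonneg (h 0)]
  have h1 := ha.integrable_norm_rpow hr0 ENNReal.coe_ne_top
  have h2 := hb.integrable_norm_rpow hr0 ENNReal.coe_ne_top
  have h3 : Integrable b μ := hb.integrable (by
    have : (1 : ℝ) ≤ r := by linarith
    exact_mod_cast this)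
  simp only [ENNReal.coe_toReal, Real.norm_eq_abs] at h1 h2
  refine Integrable.mono' ((h3.abs.add (h1.add h2)).const_mul C)
    ((hc.comp_aestronglyMeasurable ha.1).mul hb.1) (ae_of_all _ fun x => ?_)
  simp only [Pi.add_apply]
  rw [Real.norm_eq_abs, abs_mul]
  have h4 : |a x| ^ q * |b x| ≤ |a x| ^ (r : ℝ) + |b x| ^ (r : ℝ) := by
    have h5 : (0 : ℝ) ≤ |a x| ^ (r : ℝ) := by positivity
    have h6 : (0 : ℝ) ≤ |b x| ^ (r : ℝ) := by positivity
    rcases le_total (|a x|) (|b x|) with hab | hab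
    · calc |a x| ^ q * |b x| ≤ |b x| ^ q * |b x| := by gcongr
        _ = |b x| ^ (r : ℝ) := by rw [hr, Real.rpow_add_one' (abs_nonneg _) (by linarith)]
        _ ≤ _ := by linarith
    · calc |a x| ^ q * |b x| ≤ |a x| ^ q * |a x| := by gcongr
        _ = |a x| ^ (r : ℝ) := by rw [hr, Real.rpow_add_one' (abs_nonneg _) (by linarith)]
        _ ≤ _ := by linarith
  calc |h (a x)| * |b x| ≤ C * (1 + |a x| ^ q) * |b x| := by gcongr; exact hgr _
    _ = C * (|b x| + |a x| ^ q * |b x|) := by ring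
    _ ≤ _ := by gcongr

theorem integrable_potential_comp [IsFiniteMeasure μ] (hc : Continuous h) (hm : Monotone h) (h0 : h 0 = 0) {C q : ℝ}
    {r : ℝ≥0} (hr : (r : ℝ) = q + 1) (hq : 1 ≤ q) (hgr : ∀ ξ, |h ξ| ≤ C * (1 + |ξ| ^ q))
    {a : α → ℝ} (ha : MemLp a r μ) : Integrable (fun x => potential h (a x)) μ := by
  refine Integrable.mono' (integrable_comp_mul hc hr hq hgr ha ha)
    ((continuous_potential hc).comp_aestronglyMeasurable ha.1) (ae_of_all _ fun x => ?_)
  rw [Real.norm_eq_abs, abs_of_nonneg (potential_nonneg hc hm h0 _)]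
  exact potential_le hc hm _

/-- Fatou's lemma along an almost everywhere convergent subsequence. L² convergence alone does not
make these integrals converge, since the potential may grow like |ξ|^{q+1}. -/
theorem integral_potential_le_of_tendsto (hc : Continuous h) (hm : Monotone h) (h0 : h 0 = 0)
    {u : ℕ → Lp ℝ 2 μ} {v : Lp ℝ 2 μ} (huv : Tendsto u atTop (𝓝 v))
    (hu : ∀ n, Integrable (fun x => potential h (u n x)) μ)
    (hv : Integrable (fun x => potential h (v x)) μ) {b : ℝ}
    (hb : ∀ᶠ n in atTop, ∫ x, potential h (u n x) ∂μ ≤ b) :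
    ∫ x, potential h (v x) ∂μ ≤ b := by
  have hnorm : ∀ w : Lp ℝ 2 μ, Integrable (fun x => potential h (w x)) μ →
      eLpNorm (fun x => potential h (w x)) 1 μ = ENNReal.ofReal (∫ x, potential h (w x) ∂μ) := by
    intro w hw
    rw [eLpNorm_one_eq_lintegral_enorm, ← ofReal_integral_norm_eq_lintegral_enorm hw]
    congr 1
    refine integral_congr_ae (ae_of_all _ fun x => ?_)
    simp only [Real.norm_eq_abs]
    rw [abs_of_nonneg (potential_nonneg hc hm h0 _)]
  have hb0 : 0 ≤ b := by
    obtain ⟨n, hn⟩ := hb.exists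
    exact (integral_nonneg fun x => potential_nonneg hc hm h0 _).trans hn
  obtain ⟨φ, hφ, hae⟩ := (tendstoInMeasure_of_tendsto_Lp huv).exists_seq_tendsto_ae
  have key : eLpNorm (fun x => potential h (v x)) 1 μ ≤ ENNReal.ofReal b := by
    refine Lp.eLpNorm_le_of_ae_tendsto (u := atTop) (f := fun n x => potential h (u (φ n) x)) ?_
      (fun n => (hu _).1) ?_
    · filter_upwards [hφ.tendsto_atTop.eventually hb] with n hn
      rw [hnorm _ (hu _)]
      exact ENNReal.ofReal_le_ofReal hn
    · filter_upwards [hae] with x hx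
      exact ((continuous_potential hc).tendsto _).comp hx
  rw [hnorm _ hv] at key
  exact (ENNReal.ofReal_le_ofReal_iff hb0).1 key

/-- The integrated difference quotients of the potential converge to the derivative. -/
theorem tendsto_integral_comp_add_mul [IsFiniteMeasure μ] (hc : Continuous h) (hm : Monotone h) {C q : ℝ}
    {r : ℝ≥0} (hr : (r : ℝ) = q + 1) (hq : 1 ≤ q) (hgr : ∀ ξ, |h ξ| ≤ C * (1 + |ξ| ^ q))
    {y v : α → ℝ} (hy : MemLp y r μ) (hv : MemLp v r μ) :
    Tendsto (fun t : ℝ => ∫ x, h (y x + t * v x) * v x ∂μ) (𝓝[>] 0)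
      (𝓝 (∫ x, h (y x) * v x ∂μ)) := by
  refine tendsto_integral_filter_of_dominated_convergence
    (fun x => |h (y x) * v x| + |h (y x + v x) * v x|) ?_ ?_ ?_ ?_
  · exact Eventually.of_forall fun t =>
      (hc.comp_aestronglyMeasurable (hy.1.add (hv.1.const_mul t))).mul hv.1
  · have : ∀ᶠ t : ℝ in 𝓝[>] 0, t ∈ Set.Ioc (0 : ℝ) 1 := Ioc_mem_nhdsGT zero_lt_one
    filter_upwards [this] with t ht
    exact ae_of_all _ fun x => mul_comp_add_mul_mem_uIcc hm _ _ ht.1.le ht.2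
  · exact (integrable_comp_mul hc hr hq hgr hy hv).abs.add
      (integrable_comp_mul hc hr hq hgr (hy.add hv) hv).abs
  · refine ae_of_all _ fun x => ?_
    have : Continuous fun t : ℝ => h (y x + t * v x) * v x := by fun_prop
    have h2 := this.tendsto 0
    simp only [zero_mul, add_zero] at h2
    exact h2.mono_left nhdsWithin_le_nhds

end Potential
end DIE

namespace DIE

/-! ### Variational solution of one implicit step -/

section Step

variable {d : ℕ} {O : Set (E d)} {f : ℝ → ℝ} {L₁ L₂ L₃ L₄ L₅ q τ : ℝ}

/-- The nondecreasing function `ξ ↦ L₁ ξ - f ξ + f 0`. -/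
def driftRemainder (f : ℝ → ℝ) (L₁ : ℝ) (ξ : ℝ) : ℝ := L₁ * ξ - f ξ + f 0

theorem driftRemainder_zero : driftRemainder f L₁ 0 = 0 := by simp [driftRemainder]

theorem DriftAssumption.continuous_driftRemainder (hf : DriftAssumption d f L₁ L₂ L₃ L₄ L₅ q) :
    Continuous (driftRemainder f L₁) := by
  have := hf.differentiable.continuous
  unfold driftRemainder
  fun_prop

theorem DriftAssumption.monotone_driftRemainder (hf : DriftAssumption d f L₁ L₂ L₃ L₄ L₅ q) :
    Monotone (driftRemainder f L₁) := by
  intro a b hab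
  rcases hab.eq_or_lt with rfl | hlt
  · rfl
  have h1 := hf.monotone b a
  have h2 : 0 < b - a := sub_pos.2 hlt
  have h3 : f b - f a ≤ L₁ * (b - a) := by
    by_contra! hcon
    nlinarith
  simp only [driftRemainder]
  linarith

/-- The mean value inequality on the ball |x| ≤ |ξ|, where |f'| is at most |L₄||ξ|^{q-1} + |L₅|. The
linear terms are absorbed by |ξ| ≤ 1 + |ξ|^q, which needs q ≥ 1. -/
theorem DriftAssumption.abs_driftRemainder_le (hf : DriftAssumption d f L₁ L₂ L₃ L₄ L₅ q) (ξ : ℝ) :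
    |driftRemainder f L₁ ξ| ≤ (|L₁| + |L₅| + |L₄|) * (1 + |ξ| ^ q) := by
  have hq := hf.one_le_q
  have h1 : ‖f ξ - f 0‖ ≤ (|L₄| * |ξ| ^ (q - 1) + |L₅|) * ‖ξ - 0‖ := by
    refine (convex_closedBall (0 : ℝ) |ξ|).norm_image_sub_le_of_norm_deriv_le
      (fun x _ => hf.differentiable x) (fun x hx => ?_) (by simp) (by simp)
    have hx' : |x| ≤ |ξ| := by simpa using hx
    refine (hf.deriv_growth x).trans ?_
    have h2 : |x| ^ (q - 1) ≤ |ξ| ^ (q - 1) :=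
      Real.rpow_le_rpow (abs_nonneg _) hx' (by linarith)
    have h3 : L₄ * |x| ^ (q - 1) ≤ |L₄| * |ξ| ^ (q - 1) :=
      mul_le_mul (le_abs_self _) h2 (by positivity) (abs_nonneg _)
    linarith [le_abs_self L₅]
  rw [sub_zero, Real.norm_eq_abs, Real.norm_eq_abs] at h1
  have h4 : |ξ| ^ (q - 1) * |ξ| = |ξ| ^ q := by
    rw [← Real.rpow_add_one' (abs_nonneg _) (by linarith), sub_add_cancel]
  have h5 : |ξ| ≤ 1 + |ξ| ^ q := by
    rcases le_total |ξ| 1 with h | h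
    · have : (0 : ℝ) ≤ |ξ| ^ q := by positivity
      linarith
    · have := Real.rpow_le_rpow_of_exponent_le h hq
      rw [Real.rpow_one] at this
      linarith
  have h6 : |driftRemainder f L₁ ξ| ≤ |L₁| * |ξ| + |f ξ - f 0| := by
    have : driftRemainder f L₁ ξ = L₁ * ξ - (f ξ - f 0) := by simp only [driftRemainder]; ring
    rw [this]
    refine (abs_sub _ _).trans ?_
    rw [abs_mul]
  have h7 : (|L₄| * |ξ| ^ (q - 1) + |L₅|) * |ξ| = |L₄| * |ξ| ^ q + |L₅| * |ξ| := by
    rw [← h4]; ring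
  have h8 : (0 : ℝ) ≤ |ξ| ^ q := by positivity
  nlinarith [abs_nonneg L₁, abs_nonneg L₄, abs_nonneg L₅]

theorem exists_coercive (hO : MeasurableSet O) (hOb : Bornology.IsBounded O) (hτ : 0 < τ)
    (hL : L₁ < lambda1 O) :
    ∃ c : ℝ, 0 < c ∧ ∀ z ∈ h1Zero O,
      c * (‖z.1‖ ^ 2 + ‖z.2‖ ^ 2) ≤ (1 - τ * L₁) * ‖z.1‖ ^ 2 + τ * ‖z.2‖ ^ 2 := by
  set lam := lambda1 O
  -- A share ε of the gradient term is kept, and Poincaré's inequality is applied to the rest. The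
  -- coefficient of ‖u‖² becomes 1 - ετλ₁ + τ(λ₁ - L₁), at least 1/2 for this ε.
  set ε : ℝ := 1 / (2 * (1 + τ * |lam|)) with hε
  have hk : 0 < 1 + τ * |lam| := by positivity
  have hε0 : 0 < ε := by positivity
  have hε1 : ε ≤ 1 := by
    rw [hε, div_le_one (by positivity)]
    nlinarith [abs_nonneg lam]
  have hε2 : ε * (τ * lam) ≤ 1 / 2 := by
    have h1 : ε * (τ * lam) ≤ ε * (1 + τ * |lam|) := by
      gcongr
      nlinarith [le_abs_self lam]
    have h2 : ε * (1 + τ * |lam|) = 1 / 2 := by rw [hε]; field_simp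
    linarith
  refine ⟨min (1 / 2) (ε * τ), by positivity, ?_⟩
  rintro ⟨u, p⟩ hup
  have hP := lambda1_mul_norm_sq_le hO hOb (mem_h1Zero.1 hup)
  have h1 : min (1 / 2) (ε * τ) * ‖u‖ ^ 2 ≤ 1 / 2 * ‖u‖ ^ 2 := by gcongr; exact min_le_left _ _
  have h2 : min (1 / 2) (ε * τ) * ‖p‖ ^ 2 ≤ ε * τ * ‖p‖ ^ 2 := by gcongr; exact min_le_right _ _
  have h3 : (1 - ε) * τ * (lam * ‖u‖ ^ 2) ≤ (1 - ε) * τ * ‖p‖ ^ 2 :=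
    mul_le_mul_of_nonneg_left hP (mul_nonneg (by linarith) hτ.le)
  have h4 : 0 ≤ (1 / 2 - ε * (τ * lam) + τ * (lam - L₁)) * ‖u‖ ^ 2 := by
    have : 0 < τ * (lam - L₁) := mul_pos hτ (sub_pos.2 hL)
    have : 0 ≤ 1 / 2 - ε * (τ * lam) + τ * (lam - L₁) := by linarith
    positivity
  simp only
  nlinarith

/-- For d = 3 the bound q ≤ 3 keeps q + 1 below the critical exponent 6. -/
theorem memLp_of_isH1Zero (hd : 1 ≤ d) (hd3 : d ≤ 3) (hOb : Bornology.IsBounded O)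
    (hf : DriftAssumption d f L₁ L₂ L₃ L₄ L₅ q) {r : ℝ≥0} (hr : (r : ℝ) = q + 1) {u : H O}
    {p : HVec O} (hup : IsH1Zero O u p) : MemLp u r (volume.restrict O) := by
  have h1 := hf.one_le_q
  have hr2 : 2 ≤ r := by
    have : (2 : ℝ) ≤ r := by linarith
    exact_mod_cast this
  have hr6 : d = 3 → r ≤ 6 := by
    intro hd
    have h2 := hf.q_le_three hd
    have : (r : ℝ) ≤ 6 := by linarith
    exact_mod_cast this
  obtain ⟨C, hC⟩ := exists_eLpNorm_le_of_isH1Zero hd hd3 hOb hr2 hr6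
  refine ⟨Lp.aestronglyMeasurable _, (hC u p hup).trans_lt ?_⟩
  exact ENNReal.mul_lt_top ENNReal.coe_lt_top enorm_lt_top

theorem inner_eq_integral (u v : H O) : ⟪u, v⟫ = ∫ x in O, u x * v x := by
  rw [L2.inner_def]
  refine integral_congr_ae (ae_of_all _ fun x => ?_)
  simp [mul_comm]

theorem integrable_mul_H (u v : H O) :
    Integrable (fun x => u x * v x) (volume.restrict O) := by
  have := L2.integrable_inner (𝕜 := ℝ) u v
  simpa [mul_comm] using this

theorem integrable_H (hOb : Bornology.IsBounded O) (u : H O) :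
    Integrable u (volume.restrict O) := by
  have := isFiniteMeasure_restrict hOb
  exact (Lp.memLp u).integrable (by norm_num)

/-- The Euler–Lagrange equation of the step energy. -/
theorem exists_eulerLagrange (hd : 1 ≤ d) (hd3 : d ≤ 3) (hO : MeasurableSet O)
    (hOb : Bornology.IsBounded O) (hf : DriftAssumption d f L₁ L₂ L₃ L₄ L₅ q) (hτ : 0 < τ)
    (hL : L₁ < lambda1 O) (w : H O) :
    ∃ (y : H O) (p : HVec O), IsH1Zero O y p ∧ ∀ v r, IsH1Zero O v r →
      Integrable (fun x => driftRemainder f L₁ (y x) * v x) (volume.restrict O) ∧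
      (1 - τ * L₁) * ⟪y, v⟫ + τ * ⟪p, r⟫ + τ * (∫ x in O, driftRemainder f L₁ (y x) * v x) =
        ⟪w, v⟫ := by
  have hfin := isFiniteMeasure_restrict hOb
  set h := driftRemainder f L₁ with hh
  have hc : Continuous h := hf.continuous_driftRemainder
  have hm : Monotone h := hf.monotone_driftRemainder
  have h0 : h 0 = 0 := driftRemainder_zero
  have hgr := hf.abs_driftRemainder_le
  have hq := hf.one_le_q
  let r : ℝ≥0 := ⟨q + 1, by linarith⟩
  have hr : (r : ℝ) = q + 1 := rfl
  have hmem : ∀ {u : H O} {p : HVec O}, IsH1Zero O u p → MemLp u r (volume.restrict O) :=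
    fun hup => memLp_of_isH1Zero hd hd3 hOb hf hr hup
  have hpot : ∀ {u : H O} {p : HVec O}, IsH1Zero O u p →
      Integrable (fun x => potential h (u x)) (volume.restrict O) :=
    fun hup => integrable_potential_comp hc hm h0 hr hq hgr (hmem hup)
  obtain ⟨c, hc0, hcoer⟩ := exists_coercive hO hOb hτ hL
  -- The L₁ part of the drift sits in the quadratic form, where Poincaré's inequality controls it
  -- whatever the size of τ. Only the monotone remainder contributes a potential, which is therefore
  -- convex.
  obtain ⟨⟨y, p⟩, hyp, hmin⟩ := exists_minimizer (isClosed_h1Zero (O := O)) hc0 hcoer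
    (Φ := fun u => τ * ∫ x in O, potential h (u x))
    (fun u => mul_nonneg hτ.le (integral_nonneg fun x => potential_nonneg hc hm h0 _))
    (by
      rintro ⟨u, p⟩ hup ⟨v, r⟩ hvr
      have h1 : ∫ x in O, potential h (((1 / 2 : ℝ) • (u + v) : H O) x) ≤
          ∫ x in O, (potential h (u x) + potential h (v x)) / 2 := by
        refine integral_mono_ae (hpot ((IsH1Zero.add hup hvr).smul (1 / 2)))
          (((hpot hup).add (hpot hvr)).div_const 2) ?_
        filter_upwards [Lp.coeFn_smul (1 / 2 : ℝ) (u + v), Lp.coeFn_add u v] with x hx1 hx2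
        simp only [hx1, Pi.smul_apply, hx2, Pi.add_apply, smul_eq_mul]
        exact potential_midpoint_le hc hm _ _
      rw [integral_div, integral_add (hpot hup) (hpot hvr)] at h1
      simp only
      nlinarith)
    (by
      intro z hz u hu hzu b hb
      have h1 : ∀ᶠ n in atTop, ∫ x in O, potential h ((z n).1 x) ≤ b / τ := by
        filter_upwards [hb] with n hn
        rw [le_div_iff₀ hτ, mul_comm]
        exact hn
      have h2 := integral_potential_le_of_tendsto hc hm h0
        ((continuous_fst.tendsto u).comp hzu) (fun n => hpot (hz n)) (hpot (u := u.1) hu) h1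
      rw [le_div_iff₀ hτ, mul_comm] at h2
      exact h2) w
  have hyp' : IsH1Zero O y p := hyp
  refine ⟨y, p, hyp', fun v s hvs => ⟨integrable_comp_mul hc hr hq hgr (hmem hyp') (hmem hvs), ?_⟩⟩
  -- One-sided variation: y is compared with y + tv for t > 0, and the increment of the potential is
  -- bounded by its slope at y + tv. Dividing by t and letting t decrease to 0 gives an inequality;
  -- replacing v by -v reverses it.
  have key : ∀ v s, IsH1Zero O v s → 0 ≤ (1 - τ * L₁) * ⟪y, v⟫ + τ * ⟪p, s⟫ +
      τ * (∫ x in O, h (y x) * v x) - ⟪w, v⟫ := by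
    intro v s hvs
    have hlim : Tendsto (fun t : ℝ => (1 - τ * L₁) * ⟪y, v⟫ + τ * ⟪p, s⟫ +
        τ * (∫ x in O, h (y x + t * v x) * v x) - ⟪w, v⟫ +
        t * (((1 - τ * L₁) * ‖v‖ ^ 2 + τ * ‖s‖ ^ 2) / 2)) (𝓝[>] 0)
        (𝓝 ((1 - τ * L₁) * ⟪y, v⟫ + τ * ⟪p, s⟫ +
        τ * (∫ x in O, h (y x) * v x) - ⟪w, v⟫ +
        0 * (((1 - τ * L₁) * ‖v‖ ^ 2 + τ * ‖s‖ ^ 2) / 2))) := by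
      refine Tendsto.add (Tendsto.sub_const (Tendsto.const_add _ (Tendsto.const_mul _ ?_)) _)
        (Tendsto.mul_const _ (tendsto_id.mono_left nhdsWithin_le_nhds))
      exact tendsto_integral_comp_add_mul hc hm hr hq hgr (hmem hyp') (hmem hvs)
    rw [zero_mul, add_zero] at hlim
    refine ge_of_tendsto hlim ?_
    filter_upwards [self_mem_nhdsWithin] with t ht
    have ht0 : 0 < t := ht
    have h1 := hmin _ (hyp'.add (hvs.smul t))
    have h2 : ∫ x in O, potential h ((y + t • v : H O) x) ≤
        (∫ x in O, potential h (y x)) + t * ∫ x in O, h (y x + t * v x) * v x := by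
      have hi : Integrable (fun x => h (y x + t * v x) * v x) (volume.restrict O) :=
        integrable_comp_mul hc hr hq hgr ((hmem hyp').add ((hmem hvs).const_mul t)) (hmem hvs)
      rw [← integral_const_mul, ← integral_add (hpot hyp') (hi.const_mul t)]
      refine integral_mono_ae (hpot (hyp'.add (hvs.smul t)))
        ((hpot hyp').add (hi.const_mul t)) ?_
      filter_upwards [Lp.coeFn_add y (t • v), Lp.coeFn_smul t v] with x hx1 hx2
      simp only [hx1, Pi.add_apply, hx2, Pi.smul_apply, smul_eq_mul]
      have := potential_sub_le hc hm (y x) (y x + t * v x)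
      nlinarith
    have h3 := mul_le_mul_of_nonneg_left h2 hτ.le
    simp only [norm_add_sq_real, inner_add_right, inner_smul_right, norm_smul, mul_pow,
      Real.norm_eq_abs, sq_abs] at h1
    refine nonneg_of_mul_nonneg_right (a := t) ?_ ht0
    linear_combination h1 + h3
  have h1 := key v s hvs
  have h2 := key _ _ (hvs.smul (-1))
  have h3 : ∫ x in O, h (y x) * ((-1 : ℝ) • v : H O) x = -∫ x in O, h (y x) * v x := by
    rw [← integral_neg]
    refine integral_congr_ae ?_
    filter_upwards [Lp.coeFn_smul (-1 : ℝ) v] with x hx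
    rw [hx]
    simp
  rw [h3] at h2
  simp only [inner_smul_right] at h2
  linarith

end Step
end DIE

namespace DIE

/-! ### The solution map: contraction, dissipation, compactness -/

section StepMap

variable {d : ℕ} {O : Set (E d)} {f : ℝ → ℝ} {L₁ L₂ L₃ L₄ L₅ q τ : ℝ}

/-- State and noise enter only through their sum, so a single solution map w ↦ y suffices. -/
theorem isStep_iff_add {x z y : H O} : IsStep O f τ x z y ↔ IsStep O f τ (x + z) 0 y := by
  unfold IsStep
  refine exists_congr fun p => and_congr_right fun _ => forall_congr' fun v => forall_congr'
    fun r => imp_congr_right fun _ => and_congr_right fun _ => ?_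
  rw [inner_add_left, inner_zero_left]
  constructor <;> intro h <;> linarith

theorem exists_isStep (hd : 1 ≤ d) (hd3 : d ≤ 3) (hO : MeasurableSet O)
    (hOb : Bornology.IsBounded O) (hf : DriftAssumption d f L₁ L₂ L₃ L₄ L₅ q) (hτ : 0 < τ)
    (hL : L₁ < lambda1 O) (w : H O) : ∃ y, IsStep O f τ w 0 y := by
  have hfin := isFiniteMeasure_restrict hOb
  -- The constant f(0) missing from the monotone remainder is moved into the data as the function
  -- τf(0).
  let e : H O := Lp.const 2 (volume.restrict O) (τ * f 0)
  have he : e =ᵐ[volume.restrict O] fun _ => τ * f 0 := Lp.coeFn_const _ _ _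
  obtain ⟨y, p, hyp, hEL⟩ := exists_eulerLagrange hd hd3 hO hOb hf hτ hL (w + e)
  refine ⟨y, p, hyp, fun v r hvr => ?_⟩
  obtain ⟨hint, heq⟩ := hEL v r hvr
  have hiv := integrable_H hOb v
  have hiyv := integrable_mul_H y v
  have hfun : (fun x => f (y x) * v x) = fun x => L₁ * (y x * v x) + f 0 * v x -
      driftRemainder f L₁ (y x) * v x := by
    ext x
    simp only [driftRemainder]
    ring
  have hsum : Integrable (fun x => L₁ * (y x * v x) + f 0 * v x) (volume.restrict O) :=
    (hiyv.const_mul L₁).add (hiv.const_mul (f 0))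
  refine ⟨by rw [hfun]; exact hsum.sub hint, ?_⟩
  have h1 : ∫ x in O, f (y x) * v x = L₁ * ⟪y, v⟫ + f 0 * (∫ x in O, v x) -
      ∫ x in O, driftRemainder f L₁ (y x) * v x := by
    rw [hfun, integral_sub hsum hint, integral_add (hiyv.const_mul L₁) (hiv.const_mul (f 0)),
      integral_const_mul, integral_const_mul, inner_eq_integral]
  have h2 : ⟪e, v⟫ = τ * f 0 * ∫ x in O, v x := by
    rw [inner_eq_integral, ← integral_const_mul]
    refine integral_congr_ae ?_
    filter_upwards [he] with x hx
    rw [hx]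
  rw [inner_add_left, h2] at heq
  rw [h1, inner_zero_left]
  linear_combination heq

/-- The solution map `w ↦ y` of `y = w + τ A y + τ F(y)`. -/
noncomputable def stepMap (O : Set (E d)) (f : ℝ → ℝ) (τ : ℝ) (w : H O) : H O :=
  Classical.epsilon fun y => IsStep O f τ w 0 y

theorem isStep_stepMap (hd : 1 ≤ d) (hd3 : d ≤ 3) (hO : MeasurableSet O)
    (hOb : Bornology.IsBounded O) (hf : DriftAssumption d f L₁ L₂ L₃ L₄ L₅ q) (hτ : 0 < τ)
    (hL : L₁ < lambda1 O) (w : H O) : IsStep O f τ w 0 (stepMap O f τ w) :=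
  Classical.epsilon_spec (exists_isStep hd hd3 hO hOb hf hτ hL w)

/-- The difference of the two equations is tested with y - y'. The one-sided Lipschitz condition
bounds the drift, Poincaré's inequality the Laplacian, and Cauchy-Schwarz the data. -/
theorem IsStep.norm_sub_le (hO : MeasurableSet O) (hOb : Bornology.IsBounded O)
    (hf : DriftAssumption d f L₁ L₂ L₃ L₄ L₅ q) (hτ : 0 < τ) {w w' y y' : H O}
    (h : IsStep O f τ w 0 y) (h' : IsStep O f τ w' 0 y') :
    (1 + τ * (lambda1 O - L₁)) * ‖y - y'‖ ≤ ‖w - w'‖ := by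
  obtain ⟨p, hyp, heq⟩ := h
  obtain ⟨p', hyp', heq'⟩ := h'
  have hv := hyp.sub hyp'
  obtain ⟨hi, e1⟩ := heq _ _ hv
  obtain ⟨hi', e2⟩ := heq' _ _ hv
  have hP := lambda1_mul_norm_sq_le hO hOb hv
  have hmono : (∫ x in O, f (y x) * (y - y' : H O) x) - ∫ x in O, f (y' x) * (y - y' : H O) x ≤
      L₁ * ‖y - y'‖ ^ 2 := by
    rw [← integral_sub hi hi', ← real_inner_self_eq_norm_sq, inner_eq_integral,
      ← integral_const_mul]
    refine integral_mono_ae (hi.sub hi') ((integrable_mul_H _ _).const_mul _) ?_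
    filter_upwards [Lp.coeFn_sub y y'] with x hx
    simp only [hx, Pi.sub_apply]
    have := hf.monotone (y x) (y' x)
    nlinarith
  rw [inner_zero_left] at e1 e2
  have e3 : ⟪y - y', y - y'⟫ = ⟪w - w', y - y'⟫ - τ * ⟪p - p', p - p'⟫ +
      τ * ((∫ x in O, f (y x) * (y - y' : H O) x) - ∫ x in O, f (y' x) * (y - y' : H O) x) := by
    rw [inner_sub_left y, inner_sub_left w, inner_sub_left p]
    linear_combination e1 - e2
  rw [real_inner_self_eq_norm_sq, real_inner_self_eq_norm_sq] at e3
  have h1 := real_inner_le_norm (w - w') (y - y')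
  have h2 := mul_le_mul_of_nonneg_left hP hτ.le
  have h3 := mul_le_mul_of_nonneg_left hmono hτ.le
  rcases (norm_nonneg (y - y')).eq_or_lt with h0 | h0
  · rw [← h0]; simp
  · refine le_of_mul_le_mul_right ?_ h0
    nlinarith

theorem IsStep.unique (hO : MeasurableSet O) (hOb : Bornology.IsBounded O)
    (hf : DriftAssumption d f L₁ L₂ L₃ L₄ L₅ q) (hτ : 0 < τ) (hL : L₁ < lambda1 O) {w y y' : H O}
    (h : IsStep O f τ w 0 y) (h' : IsStep O f τ w 0 y') : y = y' := by
  have h1 := h.norm_sub_le hO hOb hf hτ h'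
  rw [sub_self, norm_zero] at h1
  have h2 : 0 < 1 + τ * (lambda1 O - L₁) := by
    have := mul_pos hτ (sub_pos.2 hL)
    linarith
  rw [← sub_eq_zero, ← norm_eq_zero]
  exact le_antisymm (nonpos_of_mul_nonpos_right h1 h2) (norm_nonneg _)

/-- The equation is tested with y itself, and the coercivity of f is integrated over `O`. -/
theorem IsStep.energy (hOb : Bornology.IsBounded O)
    (hf : DriftAssumption d f L₁ L₂ L₃ L₄ L₅ q) (hτ : 0 < τ) {w y : H O}
    (h : IsStep O f τ w 0 y) :
    ∃ p, IsH1Zero O y p ∧ ‖y‖ ^ 2 + τ * ‖p‖ ^ 2 ≤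
      ⟪w, y⟫ + τ * (L₂ * ‖y‖ ^ 2 + L₃ * volume.real O) := by
  have hfin := isFiniteMeasure_restrict hOb
  obtain ⟨p, hyp, heq⟩ := h
  obtain ⟨hi, e1⟩ := heq _ _ hyp
  refine ⟨p, hyp, ?_⟩
  have h1 : ∫ x in O, f (y x) * y x ≤ L₂ * ‖y‖ ^ 2 + L₃ * volume.real O := by
    have h2 : ∫ x in O, (L₂ * (y x * y x) + L₃) = L₂ * ‖y‖ ^ 2 + L₃ * volume.real O := by
      rw [integral_add ((integrable_mul_H _ _).const_mul _) (integrable_const _),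
        integral_const_mul, ← inner_eq_integral, real_inner_self_eq_norm_sq]
      simp [mul_comm]
    rw [← h2]
    refine integral_mono hi (((integrable_mul_H _ _).const_mul _).add (integrable_const _))
      fun x => ?_
    have := hf.coercive (y x)
    rw [sq_abs] at this
    simp only
    linarith
  rw [inner_zero_left, real_inner_self_eq_norm_sq, real_inner_self_eq_norm_sq] at e1
  have h3 := mul_le_mul_of_nonneg_left h1 hτ.le
  linarith

theorem IsStep.norm_sq_le (hO : MeasurableSet O) (hOb : Bornology.IsBounded O)
    (hf : DriftAssumption d f L₁ L₂ L₃ L₄ L₅ q) (hτ : 0 < τ) {w y : H O}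
    (h : IsStep O f τ w 0 y) :
    (1 + 2 * τ * (lambda1 O - L₂)) * ‖y‖ ^ 2 ≤ ‖w‖ ^ 2 + 2 * τ * (L₃ * volume.real O) := by
  obtain ⟨p, hyp, hE⟩ := h.energy hOb hf hτ
  have hP := mul_le_mul_of_nonneg_left (lambda1_mul_norm_sq_le hO hOb hyp) hτ.le
  have h1 := real_inner_le_norm w y
  nlinarith [sq_nonneg (‖w‖ - ‖y‖)]

theorem DriftAssumption.L₃_nonneg (hf : DriftAssumption d f L₁ L₂ L₃ L₄ L₅ q) : 0 ≤ L₃ := by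
  simpa using hf.coercive 0

/-- One step of the scheme maps bounded sets to relatively compact sets. -/
theorem exists_isCompact_isStep (hO : MeasurableSet O) (hOb : Bornology.IsBounded O)
    (hf : DriftAssumption d f L₁ L₂ L₃ L₄ L₅ q) (hτ : 0 < τ) (hL : L₂ < lambda1 O) (R : ℝ) :
    ∃ K : Set (H O), IsCompact K ∧ ∀ w y, ‖w‖ ≤ R → IsStep O f τ w 0 y → y ∈ K := by
  -- `B` bounds ‖y‖² by dissipation, and `D` then bounds ‖∇y‖² by the energy inequality; Rellich's
  -- theorem gives the compact set.
  set B : ℝ := R ^ 2 + 2 * τ * (L₃ * volume.real O) with hB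
  set D : ℝ := ((R ^ 2 + B) / 2 + τ * (|L₂| * B + L₃ * volume.real O)) / τ with hD
  refine ⟨closure {u : H O | ∃ p, IsH1Zero O u p ∧ ‖u‖ ≤ max √B √D ∧ ‖p‖ ≤ max √B √D},
    isCompact_iff_totallyBounded_isComplete.2
      ⟨(totallyBounded_h1Zero_ball hO hOb _).closure, isClosed_closure.isComplete⟩,
    fun w y hw hy => ?_⟩
  have h1 := hy.norm_sq_le hO hOb hf hτ
  obtain ⟨p, hyp, hE⟩ := hy.energy hOb hf hτ
  have hw2 : ‖w‖ ^ 2 ≤ R ^ 2 := by gcongr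
  have h2 : 0 < τ * (lambda1 O - L₂) := mul_pos hτ (sub_pos.2 hL)
  have hyB : ‖y‖ ^ 2 ≤ B := by nlinarith [sq_nonneg ‖y‖]
  have h3 : L₂ * ‖y‖ ^ 2 ≤ |L₂| * B :=
    mul_le_mul (le_abs_self _) hyB (sq_nonneg _) (abs_nonneg _)
  have hpD : ‖p‖ ^ 2 ≤ D := by
    rw [hD, le_div_iff₀ hτ]
    have h4 := real_inner_le_norm w y
    have h5 := mul_le_mul_of_nonneg_left h3 hτ.le
    nlinarith [sq_nonneg (‖w‖ - ‖y‖), sq_nonneg ‖y‖]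
  exact subset_closure ⟨p, hyp, le_max_of_le_left (Real.le_sqrt_of_sq_le hyB),
    le_max_of_le_right (Real.le_sqrt_of_sq_le hpD)⟩

end StepMap
end DIE

namespace DIE

instance secondCountableTopology_H {d : ℕ} (O : Set (E d)) : SecondCountableTopology (H O) :=
  have : Fact ((2 : ℝ≥0∞) ≠ ∞) := ⟨ENNReal.ofNat_ne_top⟩
  Lp.SecondCountableTopology

/-! ### White sequences, freezing and the Itô isometry -/

section Noise

theorem enorm_sq_eq_ofReal {X : Type*} [SeminormedAddCommGroup X] (x : X) :
    ‖x‖ₑ ^ 2 = ENNReal.ofReal (‖x‖ ^ 2) := by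
  rw [← ofReal_norm, ENNReal.ofReal_pow (norm_nonneg _)]

theorem lintegral_enorm_sq_le_of_tendsto_ae {X Ω : Type*} [NormedAddCommGroup X]
    {mΩ : MeasurableSpace Ω} {P : Measure Ω} {f : ℕ → Ω → X} {g : Ω → X} {C : ℝ≥0∞}
    (hf : ∀ n, AEStronglyMeasurable (f n) P) (hb : ∀ n, ∫⁻ ω, ‖f n ω‖ₑ ^ 2 ∂P ≤ C)
    (hlim : ∀ᵐ ω ∂P, Tendsto (fun n => f n ω) atTop (𝓝 (g ω))) :
    ∫⁻ ω, ‖g ω‖ₑ ^ 2 ∂P ≤ C := by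
  have h1 : ∀ᵐ ω ∂P, ‖g ω‖ₑ ^ 2 = liminf (fun n => ‖f n ω‖ₑ ^ 2) atTop := by
    filter_upwards [hlim] with ω hω
    exact (((ENNReal.continuous_pow 2).tendsto _).comp hω.enorm).liminf_eq.symm
  rw [lintegral_congr_ae h1]
  refine (lintegral_liminf_le' fun n => (hf n).enorm.pow_const 2).trans ?_
  exact liminf_le_of_le (by isBoundedDefault) fun b hb' => by
    obtain ⟨n, hn⟩ := hb'.exists
    exact hn.trans (hb n)

theorem tendstoInMeasure_sub {X Ω : Type*} [NormedAddCommGroup X]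
    {mΩ : MeasurableSpace Ω} {P : Measure Ω} {f g : ℕ → Ω → X} {F G : Ω → X}
    (hf : TendstoInMeasure P f atTop F) (hg : TendstoInMeasure P g atTop G) :
    TendstoInMeasure P (fun n ω => f n ω - g n ω) atTop fun ω => F ω - G ω := by
  rw [tendstoInMeasure_iff_norm] at *
  intro ε hε
  have h1 := (hf (ε / 2) (by positivity)).add (hg (ε / 2) (by positivity))
  rw [add_zero] at h1
  refine tendsto_of_tendsto_of_tendsto_of_le_of_le tendsto_const_nhds h1 (fun n => zero_le) fun n => ?_
  refine (measure_mono ?_).trans (measure_union_le _ _)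
  intro ω hω
  by_contra hcon
  simp only [Set.mem_union, Set.mem_ofPred_eq, not_or, not_le] at hcon hω
  have h2 : ‖f n ω - g n ω - (F ω - G ω)‖ ≤ ‖f n ω - F ω‖ + ‖g n ω - G ω‖ := by
    rw [sub_sub_sub_comm]
    exact norm_sub_le _ _
  linarith [hcon.1, hcon.2]

variable {𝓗 : Type*} [NormedAddCommGroup 𝓗] [InnerProductSpace ℝ 𝓗]

/-- `γ` is the law of a sequence of centred, uncorrelated random variables with variances `σ`. -/
structure IsWhite (γ : Measure (ℕ → ℝ)) (σ : ℕ → ℝ) : Prop where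
  isProb : IsProbabilityMeasure γ
  memLp : ∀ k, MemLp (fun ξ : ℕ → ℝ => ξ k) 2 γ
  mean : ∀ k, ∫ ξ, ξ k ∂γ = 0
  orth : ∀ j k, j ≠ k → ∫ ξ, ξ j * ξ k ∂γ = 0
  var : ∀ k, ∫ ξ, ξ k * ξ k ∂γ = σ k

/-- The squared norm `∑ₖ σₖ ‖Aₖ‖²`. -/
noncomputable def weightedSq (σ : ℕ → ℝ) (A : ℕ → 𝓗) : ℝ≥0∞ :=
  ∑' k, ENNReal.ofReal (σ k) * ‖A k‖ₑ ^ 2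

theorem IsWhite.nonneg {γ : Measure (ℕ → ℝ)} {σ : ℕ → ℝ} (h : IsWhite γ σ) (k : ℕ) : 0 ≤ σ k := by
  rw [← h.var k]
  exact integral_nonneg fun ξ => mul_self_nonneg _

theorem IsWhite.integrable {γ : Measure (ℕ → ℝ)} {σ : ℕ → ℝ} (h : IsWhite γ σ) (k : ℕ) :
    Integrable (fun ξ : ℕ → ℝ => ξ k) γ :=
  have := h.isProb
  (h.memLp k).integrable (by norm_num)

theorem IsWhite.integrable_mul {γ : Measure (ℕ → ℝ)} {σ : ℕ → ℝ} (h : IsWhite γ σ) (j k : ℕ) :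
    Integrable (fun ξ : ℕ → ℝ => ξ j * ξ k) γ :=
  (h.memLp j).integrable_mul (h.memLp k)

/-- Pythagoras: when an index k is added, the cross terms are linear in ξ_k or of the form ξ_jξ_k
with j ≠ k, and they integrate to zero. Only first and second moments of γ matter. -/
theorem IsWhite.hasIntegral_norm_sq {γ : Measure (ℕ → ℝ)} {σ : ℕ → ℝ} (h : IsWhite γ σ)
    (I : Finset ℕ) (a : 𝓗) (A : ℕ → 𝓗) :
    Integrable (fun ξ : ℕ → ℝ => ‖a + ∑ k ∈ I, ξ k • A k‖ ^ 2) γ ∧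
      ∫ ξ, ‖a + ∑ k ∈ I, ξ k • A k‖ ^ 2 ∂γ = ‖a‖ ^ 2 + ∑ k ∈ I, σ k * ‖A k‖ ^ 2 := by
  classical
  have := h.isProb
  induction I using Finset.induction_on with
  | empty => simp
  | insert k I hk ih =>
    have hfun : (fun ξ : ℕ → ℝ => ‖a + ∑ j ∈ insert k I, ξ j • A j‖ ^ 2) = fun ξ =>
        ‖a + ∑ j ∈ I, ξ j • A j‖ ^ 2 + (2 * ⟪a, A k⟫ * ξ k +
          ∑ j ∈ I, 2 * ⟪A j, A k⟫ * (ξ j * ξ k) + ‖A k‖ ^ 2 * (ξ k * ξ k)) := by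
      ext ξ
      rw [Finset.sum_insert hk, add_comm (ξ k • A k), ← add_assoc, norm_add_sq_real,
        inner_smul_right, inner_add_left, sum_inner, norm_smul, mul_pow, Real.norm_eq_abs, sq_abs,
        mul_add, Finset.mul_sum, mul_add, Finset.mul_sum]
      simp only [inner_smul_left, conj_trivial]
      have : ∑ i ∈ I, 2 * (ξ k * (ξ i * ⟪A i, A k⟫)) = ∑ j ∈ I, 2 * ⟪A j, A k⟫ * (ξ j * ξ k) :=
        Finset.sum_congr rfl fun j _ => by ring
      rw [this]
      ring
    have i1 : Integrable (fun ξ : ℕ → ℝ => 2 * ⟪a, A k⟫ * ξ k) γ := (h.integrable k).const_mul _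
    have i2 : Integrable (fun ξ : ℕ → ℝ => ∑ j ∈ I, 2 * ⟪A j, A k⟫ * (ξ j * ξ k)) γ :=
      integrable_finsetSum _ fun j _ => (h.integrable_mul j k).const_mul _
    have i3 : Integrable (fun ξ : ℕ → ℝ => ‖A k‖ ^ 2 * (ξ k * ξ k)) γ :=
      (h.integrable_mul k k).const_mul _
    have i12 : Integrable (fun ξ : ℕ → ℝ => 2 * ⟪a, A k⟫ * ξ k +
          ∑ j ∈ I, 2 * ⟪A j, A k⟫ * (ξ j * ξ k)) γ := i1.add i2
    have i123 : Integrable (fun ξ : ℕ → ℝ => 2 * ⟪a, A k⟫ * ξ k +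
          ∑ j ∈ I, 2 * ⟪A j, A k⟫ * (ξ j * ξ k) + ‖A k‖ ^ 2 * (ξ k * ξ k)) γ := i12.add i3
    rw [hfun]
    refine ⟨ih.1.add i123, ?_⟩
    rw [integral_add ih.1 i123, integral_add i12 i3, integral_add i1 i2, integral_const_mul,
      integral_const_mul, h.mean, h.var, integral_finsetSum _ fun j _ =>
        (h.integrable_mul j k).const_mul _, ih.2, Finset.sum_insert hk]
    have hz : ∑ j ∈ I, ∫ ξ, 2 * ⟪A j, A k⟫ * (ξ j * ξ k) ∂γ = 0 := by
      refine Finset.sum_eq_zero fun j hj => ?_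
      rw [integral_const_mul, h.orth j k (fun hjk => hk (hjk ▸ hj)), mul_zero]
    rw [hz]
    ring

theorem IsWhite.lintegral_norm_sq {γ : Measure (ℕ → ℝ)} {σ : ℕ → ℝ} (h : IsWhite γ σ)
    (I : Finset ℕ) (a : 𝓗) (A : ℕ → 𝓗) :
    ∫⁻ ξ, ‖a + ∑ k ∈ I, ξ k • A k‖ₑ ^ 2 ∂γ =
      ‖a‖ₑ ^ 2 + ∑ k ∈ I, ENNReal.ofReal (σ k) * ‖A k‖ₑ ^ 2 := by
  obtain ⟨h1, h2⟩ := h.hasIntegral_norm_sq I a A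
  simp only [enorm_sq_eq_ofReal]
  rw [← ofReal_integral_eq_lintegral_ofReal h1 (ae_of_all _ fun ξ => sq_nonneg _), h2,
    ENNReal.ofReal_add (sq_nonneg _) (Finset.sum_nonneg fun k _ =>
      mul_nonneg (h.nonneg k) (sq_nonneg _)),
    ENNReal.ofReal_sum_of_nonneg fun k _ => mul_nonneg (h.nonneg k) (sq_nonneg _)]
  simp only [ENNReal.ofReal_mul (h.nonneg _)]

/-- The random sequence `c` has law `γ` and is independent of `m`. -/
structure IsIndepIncrement {Ω : Type*} (m : MeasurableSpace Ω) {mΩ : MeasurableSpace Ω}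
    (P : Measure Ω) (γ : Measure (ℕ → ℝ)) (c : Ω → ℕ → ℝ) : Prop where
  le : m ≤ mΩ
  measurable : Measurable c
  indep : Indep (MeasurableSpace.comap c inferInstance) m P
  law : P.map c = γ

variable {Ω : Type*} {m m' mΩ : MeasurableSpace Ω} {P : Measure Ω} {γ : Measure (ℕ → ℝ)}
  {σ : ℕ → ℝ} {c : Ω → ℕ → ℝ}

theorem IsIndepIncrement.stronglyMeasurable_sum (hc : IsIndepIncrement m P γ c)
    {A : Ω → ℕ → 𝓗} (hA : ∀ k, StronglyMeasurable[m] fun ω => A ω k) (I : Finset ℕ) :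
    StronglyMeasurable fun ω => ∑ k ∈ I, c ω k • A ω k := by
  refine Finset.stronglyMeasurable_fun_sum _ fun k _ => ?_
  exact ((measurable_pi_apply k).comp hc.measurable).stronglyMeasurable.smul ((hA k).mono hc.le)

variable [SecondCountableTopology 𝓗] [MeasurableSpace 𝓗] [BorelSpace 𝓗] [IsProbabilityMeasure P]

/-- Freezing: expectations of functions of two independent variables. -/
theorem IsIndepIncrement.map_prod {β : Type*} [MeasurableSpace β]
    (hc : IsIndepIncrement m P γ c) {V : Ω → β} (hV : Measurable[m] V) :
    P.map (fun ω => (V ω, c ω)) = (P.map V).prod γ := by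
  have hV' : Measurable V := hV.mono hc.le le_rfl
  have hif : IndepFun V c P := by
    rw [IndepFun_iff_Indep]
    exact (indep_of_indep_of_le_right hc.indep hV.comap_le).symm
  rw [← hc.law]
  exact (indepFun_iff_map_prod_eq_prod_map_map hV'.aemeasurable hc.measurable.aemeasurable).1 hif

theorem IsIndepIncrement.lintegral_comp_prod {β : Type*} [MeasurableSpace β]
    (hc : IsIndepIncrement m P γ c) {V : Ω → β} (hV : Measurable[m] V)
    {Φ : β × (ℕ → ℝ) → ℝ≥0∞} (hΦ : Measurable Φ) :
    ∫⁻ ω, Φ (V ω, c ω) ∂P = ∫⁻ ω, ∫⁻ ξ, Φ (V ω, ξ) ∂γ ∂P := by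
  have hV' : Measurable V := hV.mono hc.le le_rfl
  have hγ : IsProbabilityMeasure γ :=
    hc.law ▸ Measure.isProbabilityMeasure_map hc.measurable.aemeasurable
  rw [← lintegral_map hΦ (hV'.prodMk hc.measurable), hc.map_prod hV,
    lintegral_prod _ hΦ.aemeasurable, lintegral_map hΦ.lintegral_prod_right' hV']

/-- The `m`-measurable data a and A are frozen by independence, which reduces the claim to
deterministic coefficients. -/
theorem IsWhite.lintegral_norm_sq_of_indep (h : IsWhite γ σ) (hc : IsIndepIncrement m P γ c)
    {a : Ω → 𝓗} (ha : StronglyMeasurable[m] a) {A : Ω → ℕ → 𝓗}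
    (hA : ∀ k, StronglyMeasurable[m] fun ω => A ω k) (I : Finset ℕ) :
    ∫⁻ ω, ‖a ω + ∑ k ∈ I, c ω k • A ω k‖ₑ ^ 2 ∂P =
      ∫⁻ ω, (‖a ω‖ₑ ^ 2 + ∑ k ∈ I, ENNReal.ofReal (σ k) * ‖A ω k‖ₑ ^ 2) ∂P := by
  have hV : Measurable[m] fun ω => (a ω, A ω) :=
    ha.measurable.prodMk (@measurable_pi_lambda _ _ _ m _ _ fun k => (hA k).measurable)
  have hΦ : Measurable fun z : (𝓗 × (ℕ → 𝓗)) × (ℕ → ℝ) =>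
      ‖z.1.1 + ∑ k ∈ I, z.2 k • z.1.2 k‖ₑ ^ 2 := by
    refine Measurable.pow_const (Measurable.enorm ?_) 2
    fun_prop
  rw [hc.lintegral_comp_prod hV hΦ]
  simp only [h.lintegral_norm_sq]

/-- The limit form of the Itô isometry for the noise increment. -/
theorem IsWhite.lintegral_norm_add_sq_le (h : IsWhite γ σ) (hc : IsIndepIncrement m P γ c)
    {a : Ω → 𝓗} (ha : StronglyMeasurable[m] a) {A : Ω → ℕ → 𝓗}
    (hA : ∀ k, StronglyMeasurable[m] fun ω => A ω k) {Z : Ω → 𝓗}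
    (hZ : TendstoInMeasure P (fun n ω => ∑ k ∈ Finset.range n, c ω k • A ω k) atTop Z) :
    ∫⁻ ω, ‖a ω + Z ω‖ₑ ^ 2 ∂P ≤ ∫⁻ ω, (‖a ω‖ₑ ^ 2 + weightedSq σ (A ω)) ∂P := by
  obtain ⟨φ, hφ, hae⟩ := hZ.exists_seq_tendsto_ae
  refine lintegral_enorm_sq_le_of_tendsto_ae
    (f := fun n ω => a ω + ∑ k ∈ Finset.range (φ n), c ω k • A ω k) (fun n => ?_) (fun n => ?_) ?_
  · exact ((ha.mono hc.le).add (hc.stronglyMeasurable_sum hA _)).aestronglyMeasurable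
  · rw [h.lintegral_norm_sq_of_indep hc ha hA]
    refine lintegral_mono fun ω => ?_
    gcongr
    exact ENNReal.sum_le_tsum _
  · filter_upwards [hae] with ω hω
    exact hω.const_add _

/-- Existence of the noise increment as a limit in probability. -/
theorem IsWhite.exists_tendstoInMeasure [CompleteSpace 𝓗] (h : IsWhite γ σ)
    (hc : IsIndepIncrement m P γ c) (hmm' : m ≤ m') (hm' : m' ≤ mΩ)
    (hcm' : Measurable[m'] c) {A : Ω → ℕ → 𝓗} (hA : ∀ k, StronglyMeasurable[m] fun ω => A ω k)
    (hfin : ∫⁻ ω, weightedSq σ (A ω) ∂P ≠ ∞) :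
    ∃ Z : Ω → 𝓗, StronglyMeasurable[m'] Z ∧
      TendstoInMeasure P (fun n ω => ∑ k ∈ Finset.range n, c ω k • A ω k) atTop Z := by
  set S : ℕ → Ω → 𝓗 := fun n ω => ∑ k ∈ Finset.range n, c ω k • A ω k with hS
  -- By the isometry, the squared L² distance of two partial sums is the difference of the values of
  -- `t`. Since `t` is increasing and bounded, the partial sums are Cauchy.
  set t : ℕ → ℝ≥0∞ := fun n =>
    ∫⁻ ω, ∑ k ∈ Finset.range n, ENNReal.ofReal (σ k) * ‖A ω k‖ₑ ^ 2 ∂P with ht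
  have htop : ∀ n, t n ≠ ∞ := fun n => ne_top_of_le_ne_top hfin
    (lintegral_mono fun ω => ENNReal.sum_le_tsum _)
  have htmono : Monotone t := fun i j hij => lintegral_mono fun ω =>
    Finset.sum_le_sum_of_subset (Finset.range_mono hij)
  have hAm : ∀ k, Measurable fun ω => ENNReal.ofReal (σ k) * ‖A ω k‖ₑ ^ 2 := fun k =>
    ((((hA k).mono hc.le).measurable.enorm).pow_const 2).const_mul _
  have hSm : ∀ n, StronglyMeasurable[m'] (S n) := fun n =>
    Finset.stronglyMeasurable_fun_sum _ fun k _ =>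
      StronglyMeasurable.smul (((measurable_pi_apply k).comp hcm').stronglyMeasurable)
        ((hA k).mono hmm')
  have hIto : ∀ I : Finset ℕ, ∫⁻ ω, ‖∑ k ∈ I, c ω k • A ω k‖ₑ ^ 2 ∂P =
      ∫⁻ ω, ∑ k ∈ I, ENNReal.ofReal (σ k) * ‖A ω k‖ₑ ^ 2 ∂P := by
    intro I
    simpa using h.lintegral_norm_sq_of_indep hc (a := fun _ => 0) stronglyMeasurable_const hA I
  have hdiff : ∀ i j, i ≤ j → ∫⁻ ω, ‖S j ω - S i ω‖ₑ ^ 2 ∂P = t j - t i := by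
    intro i j hij
    have h1 : ∀ ω, S j ω - S i ω = ∑ k ∈ Finset.Ico i j, c ω k • A ω k := fun ω =>
      (Finset.sum_Ico_eq_sub _ hij).symm
    simp only [h1, hIto]
    refine ENNReal.eq_sub_of_add_eq (htop i) ?_
    simp only [ht]
    rw [← lintegral_add_left (Finset.measurable_fun_sum _ fun k _ => hAm k)]
    refine lintegral_congr fun ω => ?_
    rw [add_comm, Finset.sum_range_add_sum_Ico _ hij]
  have hmemLp : ∀ n, MemLp (S n) 2 (P.trim hm') := by
    intro n
    refine ⟨(hSm n).aestronglyMeasurable, ?_⟩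
    rw [eLpNorm_trim hm' (hSm n),
      eLpNorm_lt_top_iff_lintegral_rpow_enorm_lt_top two_ne_zero ENNReal.ofNat_ne_top]
    simp only [ENNReal.toReal_ofNat, ENNReal.rpow_ofNat]
    rw [hIto]
    exact (htop n).lt_top
  -- The limit is taken in L² over `m'`, so that its representative is measurable for `m'` and the
  -- next state is adapted.
  let F : ℕ → Lp 𝓗 2 (P.trim hm') := fun n => (hmemLp n).toLp (S n)
  have hFd : ∀ i j, ‖F j - F i‖ₑ ^ 2 = ∫⁻ ω, ‖S j ω - S i ω‖ₑ ^ 2 ∂P := by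
    intro i j
    have hmeas : Measurable[m'] fun ω => ‖S j ω - S i ω‖ₑ ^ 2 :=
      Measurable.pow_const (StronglyMeasurable.enorm ((hSm j).sub (hSm i))) 2
    rw [enorm_sq_eq_lintegral, ← lintegral_trim hm' hmeas]
    refine lintegral_congr_ae ?_
    filter_upwards [Lp.coeFn_sub (F j) (F i), (hmemLp i).coeFn_toLp, (hmemLp j).coeFn_toLp]
      with ω h1 h2 h3
    rw [h1, Pi.sub_apply, h2, h3]
  obtain ⟨L, hL⟩ : ∃ L, Tendsto (fun n => (t n).toReal) atTop (𝓝 L) := by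
    refine ⟨_, tendsto_atTop_ciSup (fun i j hij => ENNReal.toReal_mono (htop j) (htmono hij))
      ⟨(∫⁻ ω, weightedSq σ (A ω) ∂P).toReal, ?_⟩⟩
    rintro _ ⟨n, rfl⟩
    exact ENNReal.toReal_mono hfin (lintegral_mono fun ω => ENNReal.sum_le_tsum _)
  have hTL : ∀ n, (t n).toReal ≤ L := fun n =>
    (show Monotone fun n => (t n).toReal from
      fun i j hij => ENNReal.toReal_mono (htop j) (htmono hij)).ge_of_tendsto hL n
  have hle : ∀ i j, i ≤ j → ‖F j - F i‖ ^ 2 = (t j).toReal - (t i).toReal := by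
    intro i j hij
    have h1 := hFd i j
    rw [hdiff i j hij, enorm_sq_eq_ofReal] at h1
    have h2 := congrArg ENNReal.toReal h1
    rwa [ENNReal.toReal_ofReal (sq_nonneg _), ENNReal.toReal_sub_of_le (htmono hij) (htop j)] at h2
  have hcau : CauchySeq F := by
    refine cauchySeq_of_norm_sub_sq_le (a := fun n => L - (t n).toReal) ?_
      (cauchySeq_const (0 : ℝ)) le_rfl fun i j => ?_
    · simpa using hL.const_sub L
    · rcases le_total i j with hij | hij
      · rw [norm_sub_rev, hle i j hij]
        linarith [hTL i, hTL j]
      · rw [hle j i hij]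
        linarith [hTL i, hTL j]
  obtain ⟨Z, hZ⟩ := cauchySeq_tendsto_of_complete hcau
  refine ⟨Z, Lp.stronglyMeasurable Z, ?_⟩
  have h1 : TendstoInMeasure (P.trim hm') S atTop Z :=
    (tendstoInMeasure_of_tendsto_Lp hZ).congr_left fun n => (hmemLp n).coeFn_toLp
  intro ε hε
  exact tendsto_of_tendsto_of_tendsto_of_le_of_le tendsto_const_nhds (h1 ε hε)
    (fun n => zero_le) fun n => le_trim hm'

end Noise
end DIE

namespace DIE

/-! ### The abstract scheme: moments, contraction, existence -/

section Scheme

variable {𝓗 : Type*} [NormedAddCommGroup 𝓗] [InnerProductSpace ℝ 𝓗]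

/-- Assumptions on the coefficients of the abstract scheme `X ↦ S (X + G(X) c)`: the solution map
`S` is Lipschitz with linear growth, and so is the noise coefficient `G`, in such a way that the
scheme contracts distances and dissipates energy in mean square. -/
structure SchemeCoeff (S : 𝓗 → 𝓗) (G : 𝓗 → ℕ → 𝓗) (σ : ℕ → ℝ) (ρ ℓ α β κ₁ κ₂ : ℝ≥0) : Prop where
  S_lip : LipschitzWith ρ S
  S_growth : ∀ w, ‖S w‖ₑ ^ 2 ≤ α * ‖w‖ₑ ^ 2 + β
  G_cont : ∀ k, Continuous fun x => G x k
  G_lip : ∀ x y, weightedSq σ (fun k => G x k - G y k) ≤ ℓ * ‖x - y‖ₑ ^ 2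
  G_growth : ∀ x, weightedSq σ (G x) ≤ κ₁ * ‖x‖ₑ ^ 2 + κ₂
  dissipative : α * (1 + κ₁) < 1

/-- The random sequences `cₙ` are adapted increments with common law `γ`. -/
structure IsNoise {Ω : Type*} (𝓖 : ℕ → MeasurableSpace Ω) {mΩ : MeasurableSpace Ω} (P : Measure Ω)
    (γ : Measure (ℕ → ℝ)) (c : ℕ → Ω → ℕ → ℝ) : Prop where
  mono : ∀ n, 𝓖 n ≤ 𝓖 (n + 1)
  meas : ∀ n, Measurable[𝓖 (n + 1)] (c n)
  incr : ∀ n, IsIndepIncrement (𝓖 n) P γ (c n)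

/-- `X` solves `X_{n+1} = S (X_n + G(X_n) c_n)`, `X_0 = x`. -/
structure IsScheme {Ω : Type*} (𝓖 : ℕ → MeasurableSpace Ω) {mΩ : MeasurableSpace Ω} (P : Measure Ω)
    (S : 𝓗 → 𝓗) (G : 𝓗 → ℕ → 𝓗) (c : ℕ → Ω → ℕ → ℝ) (x : 𝓗) (X : ℕ → Ω → 𝓗) : Prop where
  initial : ∀ᵐ ω ∂P, X 0 ω = x
  adapted : ∀ n, StronglyMeasurable[𝓖 n] (X n)
  step : ∀ n, ∃ Z : Ω → 𝓗,
    TendstoInMeasure P (fun N ω => ∑ k ∈ Finset.range N, c n ω k • G (X n ω) k) atTop Z ∧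
    ∀ᵐ ω ∂P, X (n + 1) ω = S (X n ω + Z ω)

/-- Solutions of the scheme are almost surely unique. -/
theorem IsScheme.unique {Ω : Type*} {𝓖 : ℕ → MeasurableSpace Ω} {mΩ : MeasurableSpace Ω}
    {P : Measure Ω} {S : 𝓗 → 𝓗} {G : 𝓗 → ℕ → 𝓗} {c : ℕ → Ω → ℕ → ℝ} {x : 𝓗} {X Y : ℕ → Ω → 𝓗}
    (hX : IsScheme 𝓖 P S G c x X) (hY : IsScheme 𝓖 P S G c x Y) (n : ℕ) : Y n =ᵐ[P] X n := by
  induction n with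
  | zero =>
    filter_upwards [hX.initial, hY.initial] with ω h1 h2
    rw [h1, h2]
  | succ n ih =>
    obtain ⟨Z, hZ, hstep⟩ := hX.step n
    obtain ⟨Z', hZ', hstep'⟩ := hY.step n
    have h1 : TendstoInMeasure P (fun N ω => ∑ k ∈ Finset.range N, c n ω k • G (X n ω) k)
        atTop Z' := by
      refine hZ'.congr_left fun N => ?_
      filter_upwards [ih] with ω hω
      rw [hω]
    filter_upwards [ih, hstep, hstep', tendstoInMeasure_ae_unique hZ h1] with ω h1 h2 h3 h4
    rw [h2, h3, h1, h4]

variable [SecondCountableTopology 𝓗] [MeasurableSpace 𝓗] [BorelSpace 𝓗]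
  {Ω : Type*} {𝓖 : ℕ → MeasurableSpace Ω} {m mΩ : MeasurableSpace Ω} {P : Measure Ω}
  [IsProbabilityMeasure P] {γ : Measure (ℕ → ℝ)} {σ : ℕ → ℝ} {c : ℕ → Ω → ℕ → ℝ}
  {S : 𝓗 → 𝓗} {G : 𝓗 → ℕ → 𝓗} {ρ ℓ α β κ₁ κ₂ : ℝ≥0}

theorem SchemeCoeff.lintegral_add_sq_le (hco : SchemeCoeff S G σ ρ ℓ α β κ₁ κ₂)
    (hw : IsWhite γ σ) {b : Ω → ℕ → ℝ} (hb : IsIndepIncrement m P γ b) {X : Ω → 𝓗}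
    (hX : StronglyMeasurable[m] X) {Z : Ω → 𝓗}
    (hZ : TendstoInMeasure P (fun N ω => ∑ k ∈ Finset.range N, b ω k • G (X ω) k) atTop Z) :
    ∫⁻ ω, ‖X ω + Z ω‖ₑ ^ 2 ∂P ≤ (1 + κ₁) * ∫⁻ ω, ‖X ω‖ₑ ^ 2 ∂P + κ₂ := by
  have hXm : Measurable fun ω => ‖X ω‖ₑ ^ 2 := ((hX.mono hb.le).enorm).pow_const 2
  refine (hw.lintegral_norm_add_sq_le hb hX
    (fun k => (hco.G_cont k).comp_stronglyMeasurable hX) hZ).trans ?_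
  calc _ ≤ ∫⁻ ω, ((1 + κ₁) * ‖X ω‖ₑ ^ 2 + κ₂) ∂P := by
        refine lintegral_mono fun ω => ?_
        rw [add_mul, one_mul, add_assoc]
        gcongr
        exact hco.G_growth _
    _ = _ := by
        rw [lintegral_add_right _ measurable_const, lintegral_const_mul _ hXm]
        simp

theorem SchemeCoeff.lintegral_step_sq_le (hco : SchemeCoeff S G σ ρ ℓ α β κ₁ κ₂)
    (hw : IsWhite γ σ) {b : Ω → ℕ → ℝ} (hb : IsIndepIncrement m P γ b) {X : Ω → 𝓗}
    (hX : StronglyMeasurable[m] X) {Z : Ω → 𝓗}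
    (hZ : TendstoInMeasure P (fun N ω => ∑ k ∈ Finset.range N, b ω k • G (X ω) k) atTop Z) :
    ∫⁻ ω, ‖S (X ω + Z ω)‖ₑ ^ 2 ∂P ≤
      α * (1 + κ₁) * ∫⁻ ω, ‖X ω‖ₑ ^ 2 ∂P + (α * κ₂ + β) := by
  calc _ ≤ ∫⁻ ω, (α * ‖X ω + Z ω‖ₑ ^ 2 + β) ∂P := lintegral_mono fun ω => hco.S_growth _
    _ = α * ∫⁻ ω, ‖X ω + Z ω‖ₑ ^ 2 ∂P + β := by
        rw [lintegral_add_right _ measurable_const, lintegral_const_mul' _ _ ENNReal.coe_ne_top]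
        simp
    _ ≤ α * ((1 + κ₁) * ∫⁻ ω, ‖X ω‖ₑ ^ 2 ∂P + κ₂) + β := by
        gcongr
        exact hco.lintegral_add_sq_le hw hb hX hZ
    _ = _ := by ring

/-- The second moments of the scheme are bounded uniformly in time. -/
theorem IsScheme.lintegral_sq_le (hco : SchemeCoeff S G σ ρ ℓ α β κ₁ κ₂) (hw : IsWhite γ σ)
    (hc : IsNoise 𝓖 P γ c) {x : 𝓗} {X : ℕ → Ω → 𝓗} (hX : IsScheme 𝓖 P S G c x X) (n : ℕ) :
    ∫⁻ ω, ‖X n ω‖ₑ ^ 2 ∂P ≤ ‖x‖ₑ ^ 2 + ((α * κ₂ + β) / (1 - α * (1 + κ₁)) : ℝ≥0) := by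
  induction n with
  | zero =>
    have h1 : ∫⁻ ω, ‖X 0 ω‖ₑ ^ 2 ∂P = ∫⁻ _, ‖x‖ₑ ^ 2 ∂P := by
      refine lintegral_congr_ae ?_
      filter_upwards [hX.initial] with ω hω
      rw [hω]
    rw [h1]
    simp
  | succ n ih =>
    obtain ⟨Z, hZ, hstep⟩ := hX.step n
    have h1 : ∫⁻ ω, ‖X (n + 1) ω‖ₑ ^ 2 ∂P = ∫⁻ ω, ‖S (X n ω + Z ω)‖ₑ ^ 2 ∂P := by
      refine lintegral_congr_ae ?_
      filter_upwards [hstep] with ω hω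
      rw [hω]
    rw [h1]
    refine (hco.lintegral_step_sq_le hw (hc.incr n) (hX.adapted n) hZ).trans ?_
    set θ : ℝ≥0 := α * (1 + κ₁) with hθ
    have hθ1 : θ < 1 := hco.dissipative
    set b : ℝ≥0 := α * κ₂ + β with hb
    -- The moment bound is the fixed point b/(1 - θ) of s ↦ θs + b, which is why it does not
    -- deteriorate with n.
    have hid : θ * (b / (1 - θ)) + b = b / (1 - θ) := by
      have h2 : 1 - θ ≠ 0 := (tsub_pos_of_lt hθ1).ne'
      have h3 : θ + (1 - θ) = 1 := add_tsub_cancel_of_le hθ1.le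
      calc θ * (b / (1 - θ)) + b = θ * (b / (1 - θ)) + (1 - θ) * (b / (1 - θ)) := by
            rw [mul_div_cancel₀ _ h2]
        _ = b / (1 - θ) := by rw [← add_mul, h3, one_mul]
    have hc1 : (α : ℝ≥0∞) * (1 + κ₁) = (θ : ℝ≥0∞) := by rw [hθ]; push_cast; rfl
    have hc2 : (α : ℝ≥0∞) * κ₂ + β = (b : ℝ≥0∞) := by rw [hb]; push_cast; rfl
    rw [hc1, hc2]
    calc (θ : ℝ≥0∞) * ∫⁻ ω, ‖X n ω‖ₑ ^ 2 ∂P + b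
        ≤ θ * (‖x‖ₑ ^ 2 + (b / (1 - θ) : ℝ≥0)) + b := by gcongr
      _ = θ * ‖x‖ₑ ^ 2 + ((θ * (b / (1 - θ)) + b : ℝ≥0) : ℝ≥0∞) := by
          rw [mul_add, add_assoc, ENNReal.coe_add (θ * _) b, ENNReal.coe_mul θ]
      _ ≤ _ := by
          rw [hid]
          gcongr
          calc (θ : ℝ≥0∞) * ‖x‖ₑ ^ 2 ≤ 1 * ‖x‖ₑ ^ 2 := by
                gcongr
                exact_mod_cast hθ1.le
            _ = _ := one_mul _

/-- The scheme is a contraction in mean square. -/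
theorem IsScheme.lintegral_sub_sq_le (hco : SchemeCoeff S G σ ρ ℓ α β κ₁ κ₂) (hw : IsWhite γ σ)
    (hc : IsNoise 𝓖 P γ c) {θ : ℝ≥0} (hθ : ρ ^ 2 * (1 + ℓ) ≤ θ) {x y : 𝓗} {X Y : ℕ → Ω → 𝓗}
    (hX : IsScheme 𝓖 P S G c x X) (hY : IsScheme 𝓖 P S G c y Y) (n : ℕ) :
    ∫⁻ ω, ‖X n ω - Y n ω‖ₑ ^ 2 ∂P ≤ θ ^ n * ‖x - y‖ₑ ^ 2 := by
  induction n with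
  | zero =>
    have h1 : ∫⁻ ω, ‖X 0 ω - Y 0 ω‖ₑ ^ 2 ∂P = ∫⁻ _, ‖x - y‖ₑ ^ 2 ∂P := by
      refine lintegral_congr_ae ?_
      filter_upwards [hX.initial, hY.initial] with ω h1 h2
      rw [h1, h2]
    rw [h1]
    simp
  | succ n ih =>
    obtain ⟨Z, hZ, hstep⟩ := hX.step n
    obtain ⟨Z', hZ', hstep'⟩ := hY.step n
    have hXY := (hX.adapted n).sub (hY.adapted n)
    have hm : Measurable fun ω => ‖X n ω - Y n ω‖ₑ ^ 2 :=
      ((hXY.mono (hc.incr n).le).enorm).pow_const 2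
    -- The difference of the two noise terms is the noise term with coefficient G(X) - G(Y), so the
    -- isometry and the Lipschitz bound on G apply to it.
    have hdiff : TendstoInMeasure P (fun N ω => ∑ k ∈ Finset.range N,
        c n ω k • (G (X n ω) k - G (Y n ω) k)) atTop fun ω => Z ω - Z' ω := by
      simp only [smul_sub, Finset.sum_sub_distrib]
      exact tendstoInMeasure_sub hZ hZ'
    have h2 := hw.lintegral_norm_add_sq_le (hc.incr n) hXY (fun k =>
      ((hco.G_cont k).comp_stronglyMeasurable (hX.adapted n)).sub
        ((hco.G_cont k).comp_stronglyMeasurable (hY.adapted n))) hdiff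
    calc ∫⁻ ω, ‖X (n + 1) ω - Y (n + 1) ω‖ₑ ^ 2 ∂P
        ≤ ∫⁻ ω, (ρ : ℝ≥0∞) ^ 2 * ‖(X n - Y n) ω + (Z ω - Z' ω)‖ₑ ^ 2 ∂P := by
          refine lintegral_mono_ae ?_
          filter_upwards [hstep, hstep'] with ω h1 h2
          rw [h1, h2, ← mul_pow]
          refine pow_le_pow_left₀ zero_le ?_ 2
          have h3 := hco.S_lip (X n ω + Z ω) (Y n ω + Z' ω)
          rw [edist_eq_enorm_sub, edist_eq_enorm_sub, add_sub_add_comm] at h3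
          exact h3
      _ = (ρ : ℝ≥0∞) ^ 2 * ∫⁻ ω, ‖(X n - Y n) ω + (Z ω - Z' ω)‖ₑ ^ 2 ∂P :=
          lintegral_const_mul' _ _ (by simp)
      _ ≤ (ρ : ℝ≥0∞) ^ 2 * ∫⁻ ω, (1 + ℓ) * ‖X n ω - Y n ω‖ₑ ^ 2 ∂P := by
          refine mul_le_mul_right (h2.trans (lintegral_mono fun ω => ?_)) _
          rw [add_mul, one_mul]
          gcongr
          · rfl
          · exact hco.G_lip _ _
      _ = (ρ ^ 2 * (1 + ℓ) : ℝ≥0) * ∫⁻ ω, ‖X n ω - Y n ω‖ₑ ^ 2 ∂P := by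
          rw [lintegral_const_mul _ hm]
          push_cast
          ring
      _ ≤ θ * (θ ^ n * ‖x - y‖ₑ ^ 2) := by gcongr
      _ = _ := by ring

theorem exists_isScheme [CompleteSpace 𝓗] (hco : SchemeCoeff S G σ ρ ℓ α β κ₁ κ₂)
    (hw : IsWhite γ σ) (hc : IsNoise 𝓖 P γ c) (x : 𝓗) :
    ∃ X : ℕ → Ω → 𝓗, IsScheme 𝓖 P S G c x X := by
  let good (n : ℕ) (Y : Ω → 𝓗) (Z : Ω → 𝓗) : Prop := StronglyMeasurable[𝓖 (n + 1)] Z ∧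
    TendstoInMeasure P (fun N ω => ∑ k ∈ Finset.range N, c n ω k • G (Y ω) k) atTop Z
  -- The noise term exists only for adapted square integrable states, which is known for X_n by
  -- induction alone. It is therefore chosen for every `Y`, and the choice is justified afterwards.
  let noise (n : ℕ) (Y : Ω → 𝓗) : Ω → 𝓗 := Classical.epsilon (good n Y)
  let X : ℕ → Ω → 𝓗 := fun n => Nat.rec (fun _ => x) (fun n Y ω => S (Y ω + noise n Y ω)) n
  have hgood : ∀ n Y, StronglyMeasurable[𝓖 n] Y → ∫⁻ ω, ‖Y ω‖ₑ ^ 2 ∂P < ∞ →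
      good n Y (noise n Y) := by
    intro n Y hY hfin
    refine Classical.epsilon_spec (p := good n Y) ?_
    refine hw.exists_tendstoInMeasure (hc.incr n) (hc.mono n) (hc.incr (n + 1)).le (hc.meas n)
      (fun k => (hco.G_cont k).comp_stronglyMeasurable hY) ?_
    have hm : Measurable fun ω => ‖Y ω‖ₑ ^ 2 := ((hY.mono (hc.incr n).le).enorm).pow_const 2
    refine ((lintegral_mono fun ω => hco.G_growth (Y ω)).trans_lt ?_).ne
    rw [lintegral_add_right _ measurable_const, lintegral_const_mul _ hm]
    simp only [lintegral_const, measure_univ, mul_one]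
    exact ENNReal.add_lt_top.2 ⟨ENNReal.mul_lt_top ENNReal.coe_lt_top hfin, ENNReal.coe_lt_top⟩
  have hind : ∀ n, StronglyMeasurable[𝓖 n] (X n) ∧ ∫⁻ ω, ‖X n ω‖ₑ ^ 2 ∂P < ∞ := by
    intro n
    induction n with
    | zero =>
      refine ⟨stronglyMeasurable_const, ?_⟩
      change ∫⁻ _, ‖x‖ₑ ^ 2 ∂P < ∞
      rw [lintegral_const, measure_univ, mul_one]
      exact ENNReal.pow_lt_top enorm_lt_top
    | succ n ih =>
      have hg := hgood n (X n) ih.1 ih.2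
      refine ⟨hco.S_lip.continuous.comp_stronglyMeasurable ((ih.1.mono (hc.mono n)).add hg.1), ?_⟩
      refine (hco.lintegral_step_sq_le hw (hc.incr n) ih.1 hg.2).trans_lt ?_
      refine ENNReal.add_lt_top.2 ⟨ENNReal.mul_lt_top (by finiteness) ih.2, by finiteness⟩
  refine ⟨X, ae_of_all _ fun ω => rfl, fun n => (hind n).1, fun n => ?_⟩
  exact ⟨noise n (X n), (hgood n (X n) (hind n).1 (hind n).2).2, ae_of_all _ fun ω => rfl⟩

end Scheme
end DIE

namespace DIE

/-! ### Transition operators, Feller and Markov properties -/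

section Markov

variable {𝓗 : Type*} [NormedAddCommGroup 𝓗]

theorem lintegral_enorm_sq_le {Ω : Type*} {mΩ : MeasurableSpace Ω} {P : Measure Ω}
    [IsProbabilityMeasure P] {f : Ω → 𝓗} (hf : AEStronglyMeasurable f P) :
    (∫⁻ ω, ‖f ω‖ₑ ∂P) ^ 2 ≤ ∫⁻ ω, ‖f ω‖ₑ ^ 2 ∂P := by
  have h := eLpNorm_le_eLpNorm_of_exponent_le (p := 1) (q := 2) one_le_two hf
  rw [eLpNorm_one_eq_lintegral_enorm,
    eLpNorm_eq_lintegral_rpow_enorm_toReal two_ne_zero ENNReal.ofNat_ne_top] at h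
  simp only [ENNReal.toReal_ofNat, ENNReal.rpow_ofNat, one_div] at h
  calc _ ≤ ((∫⁻ ω, ‖f ω‖ₑ ^ 2 ∂P) ^ (2⁻¹ : ℝ)) ^ 2 := pow_le_pow_left₀ zero_le h 2
    _ = _ := by rw [← ENNReal.rpow_natCast, ← ENNReal.rpow_mul]; simp

theorem tendsto_integral_of_tendstoInMeasure {Ω : Type*} {mΩ : MeasurableSpace Ω} {P : Measure Ω}
    [IsProbabilityMeasure P] [MeasurableSpace 𝓗] [BorelSpace 𝓗] {f : ℕ → Ω → 𝓗} {F : Ω → 𝓗}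
    (hf : ∀ n, AEMeasurable (f n) P) (h : TendstoInMeasure P f atTop F) (φ : 𝓗 →ᵇ ℝ) :
    Tendsto (fun n => ∫ ω, φ (f n ω) ∂P) atTop (𝓝 (∫ ω, φ (F ω) ∂P)) := by
  have hd := h.tendstoInDistribution hf
  have h1 := ProbabilityMeasure.tendsto_iff_forall_integral_tendsto.1 hd.tendsto φ
  simp only [ProbabilityMeasure.coe_mk] at h1
  rw [integral_map hd.aemeasurable_limit φ.continuous.aestronglyMeasurable] at h1
  refine h1.congr fun n => ?_
  rw [integral_map (hf n) φ.continuous.aestronglyMeasurable]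

theorem IsIndepIncrement.integral_comp_prod {Ω V : Type*} [MeasurableSpace V]
    {m mΩ : MeasurableSpace Ω} {P : Measure Ω} [IsProbabilityMeasure P] {γ : Measure (ℕ → ℝ)}
    {b : Ω → ℕ → ℝ} (hb : IsIndepIncrement m P γ b) {Y : Ω → V} (hY : Measurable[m] Y)
    {Φ : V × (ℕ → ℝ) → ℝ} (hΦ : StronglyMeasurable Φ) {C : ℝ} (hC : ∀ z, ‖Φ z‖ ≤ C) :
    ∫ ω, Φ (Y ω, b ω) ∂P = ∫ ω, ∫ ξ, Φ (Y ω, ξ) ∂γ ∂P := by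
  have hY' : Measurable Y := hY.mono hb.le le_rfl
  have hγ : IsProbabilityMeasure γ :=
    hb.law ▸ Measure.isProbabilityMeasure_map hb.measurable.aemeasurable
  have hPY : IsProbabilityMeasure (P.map Y) := Measure.isProbabilityMeasure_map hY'.aemeasurable
  rw [← integral_map (hY'.prodMk hb.measurable).aemeasurable hΦ.aestronglyMeasurable,
    hb.map_prod hY, integral_prod _ (Integrable.of_bound hΦ.aestronglyMeasurable C
      (ae_of_all _ hC)), integral_map hY'.aemeasurable
      hΦ.integral_prod_right'.aestronglyMeasurable]

theorem tendstoInMeasure_const_add {Ω : Type*} {mΩ : MeasurableSpace Ω} {P : Measure Ω}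
    {f : ℕ → Ω → 𝓗} {F a : Ω → 𝓗} (hf : TendstoInMeasure P f atTop F) :
    TendstoInMeasure P (fun n ω => a ω + f n ω) atTop fun ω => a ω + F ω := by
  rw [tendstoInMeasure_iff_norm] at *
  simpa only [add_sub_add_left_eq_sub] using hf

variable [InnerProductSpace ℝ 𝓗]

/-- A family of solutions of the scheme, one for each initial value, whose coefficients make it a
contraction in mean square with rate `κ`. -/
structure IsFlow {Ω : Type*} (𝓖 : ℕ → MeasurableSpace Ω) {mΩ : MeasurableSpace Ω} (P : Measure Ω)
    (S : 𝓗 → 𝓗) (G : 𝓗 → ℕ → 𝓗) (σ : ℕ → ℝ) (γ : Measure (ℕ → ℝ)) (c : ℕ → Ω → ℕ → ℝ)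
    (ρ ℓ α β κ₁ κ₂ κ : ℝ≥0) (X : 𝓗 → ℕ → Ω → 𝓗) : Prop where
  coeff : SchemeCoeff S G σ ρ ℓ α β κ₁ κ₂
  white : IsWhite γ σ
  noise : IsNoise 𝓖 P γ c
  scheme : ∀ x, IsScheme 𝓖 P S G c x (X x)
  rate : ρ ^ 2 * (1 + ℓ) ≤ κ ^ 2
  rate_lt_one : κ < 1

variable [MeasurableSpace 𝓗] [BorelSpace 𝓗]
  {Ω : Type*} {𝓖 : ℕ → MeasurableSpace Ω} {m mΩ : MeasurableSpace Ω} {P : Measure Ω}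
  {γ : Measure (ℕ → ℝ)} {σ : ℕ → ℝ} {c : ℕ → Ω → ℕ → ℝ}
  {S : 𝓗 → 𝓗} {G : 𝓗 → ℕ → 𝓗} {ρ ℓ α β κ₁ κ₂ κ : ℝ≥0} {X : 𝓗 → ℕ → Ω → 𝓗}

theorem IsFlow.measurable (h : IsFlow 𝓖 P S G σ γ c ρ ℓ α β κ₁ κ₂ κ X) (x : 𝓗) (n : ℕ) :
    Measurable (X x n) :=
  (((h.scheme x).adapted n).mono (h.noise.incr n).le).measurable

variable [IsProbabilityMeasure P]

theorem SchemeCoeff.tendsto_integral_step (hco : SchemeCoeff S G σ ρ ℓ α β κ₁ κ₂)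
    {b : Ω → ℕ → ℝ} (hb : IsIndepIncrement m P γ b) {Y : Ω → 𝓗} (hY : StronglyMeasurable[m] Y)
    {Z : Ω → 𝓗}
    (hZ : TendstoInMeasure P (fun N ω => ∑ k ∈ Finset.range N, b ω k • G (Y ω) k) atTop Z)
    (φ : 𝓗 →ᵇ ℝ) :
    Tendsto (fun N => ∫ ω, φ (S (Y ω + ∑ k ∈ Finset.range N, b ω k • G (Y ω) k)) ∂P) atTop
      (𝓝 (∫ ω, φ (S (Y ω + Z ω)) ∂P)) := by
  refine tendsto_integral_of_tendstoInMeasure (fun N => ?_) (tendstoInMeasure_const_add hZ)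
    (φ.compContinuous ⟨S, hco.S_lip.continuous⟩)
  exact ((hY.mono hb.le).add (hb.stronglyMeasurable_sum
    (fun k => (hco.G_cont k).comp_stronglyMeasurable hY) _)).measurable.aemeasurable

variable [SecondCountableTopology 𝓗]

theorem IsFlow.lintegral_sub_le (h : IsFlow 𝓖 P S G σ γ c ρ ℓ α β κ₁ κ₂ κ X) (x y : 𝓗) (n : ℕ) :
    ∫⁻ ω, ‖X x n ω - X y n ω‖ₑ ∂P ≤ κ ^ n * ‖x - y‖ₑ := by
  have h1 := (h.scheme x).lintegral_sub_sq_le h.coeff h.white h.noise h.rate (h.scheme y) n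
  have h2 := lintegral_enorm_sq_le (P := P)
    ((h.measurable x n).sub (h.measurable y n)).aestronglyMeasurable
  refine (ENNReal.pow_le_pow_left_iff two_ne_zero).1 ((h2.trans h1).trans_eq ?_)
  push_cast
  ring

/-- The L¹ contraction in the initial value gives convergence in probability, hence in law. This is
the Feller property. -/
theorem IsFlow.continuous_integral (h : IsFlow 𝓖 P S G σ γ c ρ ℓ α β κ₁ κ₂ κ X) (n : ℕ)
    (φ : 𝓗 →ᵇ ℝ) : Continuous fun x => ∫ ω, φ (X x n ω) ∂P := by
  refine continuous_iff_seqContinuous.2 fun y x hy => ?_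
  refine tendsto_integral_of_tendstoInMeasure (fun j => (h.measurable _ n).aemeasurable) ?_ φ
  refine tendstoInMeasure_of_tendsto_eLpNorm one_ne_zero
    (fun j => (h.measurable _ n).aestronglyMeasurable)
    (h.measurable _ n).aestronglyMeasurable ?_
  simp only [eLpNorm_one_eq_lintegral_enorm, Pi.sub_apply]
  refine tendsto_of_tendsto_of_tendsto_of_le_of_le tendsto_const_nhds ?_ (fun j => zero_le)
    fun j => h.lintegral_sub_le _ _ n
  have h1 : Tendsto (fun j => ‖y j - x‖ₑ) atTop (𝓝 0) := by
    simpa using (hy.sub_const x).enorm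
  simpa using ENNReal.Tendsto.const_mul h1 (Or.inr (by finiteness))

/-- The transition operators of the scheme on bounded continuous functions. -/
noncomputable def IsFlow.transition (h : IsFlow 𝓖 P S G σ γ c ρ ℓ α β κ₁ κ₂ κ X) (n : ℕ)
    (φ : 𝓗 →ᵇ ℝ) : 𝓗 →ᵇ ℝ :=
  .ofNormedAddCommGroup (fun x => ∫ ω, φ (X x n ω) ∂P) (h.continuous_integral n φ) ‖φ‖ fun x => by
    simpa using norm_integral_le_of_norm_le_const (μ := P) (f := fun ω => φ (X x n ω))
      (ae_of_all _ fun ω => φ.norm_coe_le_norm _)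

theorem IsFlow.transition_apply (h : IsFlow 𝓖 P S G σ γ c ρ ℓ α β κ₁ κ₂ κ X) (n : ℕ)
    (φ : 𝓗 →ᵇ ℝ) (x : 𝓗) : h.transition n φ x = ∫ ω, φ (X x n ω) ∂P := rfl

theorem IsFlow.integrable_comp (h : IsFlow 𝓖 P S G σ γ c ρ ℓ α β κ₁ κ₂ κ X) (n : ℕ)
    (φ : 𝓗 →ᵇ ℝ) (x : 𝓗) : Integrable (fun ω => φ (X x n ω)) P :=
  Integrable.of_bound (φ.continuous.measurable.comp (h.measurable x n)).aestronglyMeasurable ‖φ‖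
    (ae_of_all _ fun _ => φ.norm_coe_le_norm _)

theorem IsFlow.lipschitzWith_transition (h : IsFlow 𝓖 P S G σ γ c ρ ℓ α β κ₁ κ₂ κ X) (n : ℕ)
    {φ : 𝓗 →ᵇ ℝ} {K : ℝ≥0} (hφ : LipschitzWith K φ) :
    LipschitzWith (K * κ ^ n) (h.transition n φ) := by
  intro x y
  rw [edist_eq_enorm_sub, edist_eq_enorm_sub, h.transition_apply, h.transition_apply,
    ← integral_sub (h.integrable_comp n φ x) (h.integrable_comp n φ y)]
  calc _ ≤ ∫⁻ ω, ‖φ (X x n ω) - φ (X y n ω)‖ₑ ∂P := enorm_integral_le_lintegral_enorm _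
    _ ≤ ∫⁻ ω, K * ‖X x n ω - X y n ω‖ₑ ∂P := by
        refine lintegral_mono fun ω => ?_
        have h1 := hφ (X x n ω) (X y n ω)
        rwa [edist_eq_enorm_sub, edist_eq_enorm_sub] at h1
    _ = K * ∫⁻ ω, ‖X x n ω - X y n ω‖ₑ ∂P := lintegral_const_mul' _ _ ENNReal.coe_ne_top
    _ ≤ K * (κ ^ n * ‖x - y‖ₑ) := by gcongr; exact h.lintegral_sub_le x y n
    _ = _ := by push_cast; ring

theorem IsFlow.transition_zero (h : IsFlow 𝓖 P S G σ γ c ρ ℓ α β κ₁ κ₂ κ X) (φ : 𝓗 →ᵇ ℝ) : h.transition 0 φ = φ := by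
  ext x
  rw [h.transition_apply, integral_congr_ae (g := fun _ => φ x)]
  · simp
  · filter_upwards [(h.scheme x).initial] with ω hω
    rw [hω]

/-- The Markov property of the scheme. -/
theorem IsFlow.transition_succ (h : IsFlow 𝓖 P S G σ γ c ρ ℓ α β κ₁ κ₂ κ X) (n : ℕ)
    (φ : 𝓗 →ᵇ ℝ) : h.transition (n + 1) φ = h.transition n (h.transition 1 φ) := by
  have := h.white.isProb
  -- The full noise term is only a limit in probability and not a function of state and increment.
  -- Its truncations are jointly measurable functions of both, so the increment can be integrated
  -- out for a frozen state before N tends to infinity.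
  let Φ : ℕ → 𝓗 × (ℕ → ℝ) → ℝ := fun N z =>
    φ (S (z.1 + ∑ k ∈ Finset.range N, z.2 k • G z.1 k))
  have hΦ : ∀ N, StronglyMeasurable (Φ N) := by
    intro N
    refine Measurable.stronglyMeasurable (φ.continuous.measurable.comp
      (h.coeff.S_lip.continuous.measurable.comp (measurable_fst.add ?_)))
    refine Finset.measurable_fun_sum _ fun k _ => ?_
    exact ((measurable_pi_apply k).comp measurable_snd).smul
      ((h.coeff.G_cont k).measurable.comp measurable_fst)
  have hΦb : ∀ N z, ‖Φ N z‖ ≤ ‖φ‖ := fun N z => φ.norm_coe_le_norm _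
  have key : ∀ (x : 𝓗) (n : ℕ), Tendsto (fun N => ∫ ω, ∫ ξ, Φ N (X x n ω, ξ) ∂γ ∂P) atTop
      (𝓝 (h.transition (n + 1) φ x)) := by
    intro x n
    obtain ⟨Z, hZ, hstep⟩ := (h.scheme x).step n
    have h1 := h.coeff.tendsto_integral_step (h.noise.incr n) ((h.scheme x).adapted n) hZ φ
    have h2 : ∫ ω, φ (S (X x n ω + Z ω)) ∂P = h.transition (n + 1) φ x := by
      rw [h.transition_apply]
      refine integral_congr_ae ?_
      filter_upwards [hstep] with ω hω
      rw [hω]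
    rw [h2] at h1
    refine h1.congr fun N => ?_
    exact (h.noise.incr n).integral_comp_prod ((h.scheme x).adapted n).measurable (hΦ N) (hΦb N)
  -- For n = 0 the state is deterministic, so the inner integral converges to the one-step
  -- transition at that point.
  have key0 : ∀ x : 𝓗, Tendsto (fun N => ∫ ξ, Φ N (x, ξ) ∂γ) atTop
      (𝓝 (h.transition 1 φ x)) := by
    intro x
    refine (key x 0).congr fun N => ?_
    rw [integral_congr_ae (g := fun _ => ∫ ξ, Φ N (x, ξ) ∂γ)]
    · simp
    · filter_upwards [(h.scheme x).initial] with ω hω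
      rw [hω]
  ext x
  refine tendsto_nhds_unique (key x n) ?_
  rw [h.transition_apply]
  refine tendsto_integral_of_dominated_convergence (fun _ => ‖φ‖) (fun N => ?_)
    (integrable_const _) (fun N => ae_of_all _ fun ω => ?_) (ae_of_all _ fun ω => key0 _)
  · exact ((hΦ N).integral_prod_right'.measurable.comp (h.measurable x n)).aestronglyMeasurable
  · simpa using norm_integral_le_of_norm_le_const (μ := γ) (f := fun ξ => Φ N (X x n ω, ξ))
      (ae_of_all _ fun ξ => hΦb N _)

theorem IsFlow.transition_succ' (h : IsFlow 𝓖 P S G σ γ c ρ ℓ α β κ₁ κ₂ κ X) (n : ℕ)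
    (φ : 𝓗 →ᵇ ℝ) : h.transition (n + 1) φ = h.transition 1 (h.transition n φ) := by
  induction n generalizing φ with
  | zero => rw [h.transition_zero, zero_add]
  | succ n ih => rw [h.transition_succ (n + 1), ih, ← h.transition_succ n]

end Markov
end DIE

namespace DIE

/-! ### Invariant measure: existence, mixing, uniqueness -/

section Invariant

/-- Weak limits of laws with bounded first moments have finite first moment. -/
theorem lintegral_enorm_le_of_tendsto {𝓗 : Type*} [NormedAddCommGroup 𝓗] [MeasurableSpace 𝓗]
    [BorelSpace 𝓗] {ν : ℕ → ProbabilityMeasure 𝓗}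
    {π : ProbabilityMeasure 𝓗}
    (hν : Tendsto ν atTop (𝓝 π)) {C : ℝ≥0∞} (hC : ∀ n, ∫⁻ y, ‖y‖ₑ ∂(ν n : Measure 𝓗) ≤ C) :
    ∫⁻ y, ‖y‖ₑ ∂(π : Measure 𝓗) ≤ C := by
  -- The norm is not a bounded test function, so it is truncated at R; monotone convergence removes
  -- the truncation.
  let φ : ℕ → 𝓗 →ᵇ ℝ≥0 := fun R => .mkOfBound
    ⟨fun y => min ‖y‖₊ R, continuous_nnnorm.min continuous_const⟩ R fun x y => by
      simp only [ContinuousMap.coe_mk, NNReal.dist_eq, NNReal.coe_min, NNReal.coe_natCast]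
      rw [abs_le]
      have h1 : 0 ≤ min (‖x‖₊ : ℝ) R := by positivity
      have h2 : 0 ≤ min (‖y‖₊ : ℝ) R := by positivity
      constructor <;> linarith [min_le_right (‖x‖₊ : ℝ) R, min_le_right (‖y‖₊ : ℝ) R]
  have hφ : ∀ R y, (φ R y : ℝ≥0∞) = min ‖y‖ₑ R := fun R y => by
    change ((min ‖y‖₊ (R : ℝ≥0) : ℝ≥0) : ℝ≥0∞) = _
    rw [ENNReal.coe_min, ENNReal.coe_natCast]
    rfl
  have hsup : ∀ y : 𝓗, ‖y‖ₑ = ⨆ R : ℕ, (φ R y : ℝ≥0∞) := by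
    intro y
    refine le_antisymm ?_ (iSup_le fun R => by rw [hφ]; exact min_le_left _ _)
    obtain ⟨R, hR⟩ := ENNReal.exists_nat_gt (enorm_ne_top (x := y))
    refine le_iSup_of_le R ?_
    rw [hφ, min_eq_left hR.le]
  simp only [hsup]
  rw [lintegral_iSup (fun R => (φ R).continuous.measurable.coe_nnreal_ennreal) (fun i j hij y => by
    simp only [hφ]
    gcongr)]
  refine iSup_le fun R => ?_
  refine le_of_tendsto' (ProbabilityMeasure.tendsto_iff_forall_lintegral_tendsto.1 hν (φ R))
    fun n => (lintegral_mono fun y => ?_).trans (hC n)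
  rw [hφ]
  exact min_le_left _ _

variable {𝓗 : Type*} [NormedAddCommGroup 𝓗] [InnerProductSpace ℝ 𝓗]
  [SecondCountableTopology 𝓗] [MeasurableSpace 𝓗] [BorelSpace 𝓗]
  {Ω : Type*} {𝓖 : ℕ → MeasurableSpace Ω} {mΩ : MeasurableSpace Ω} {P : Measure Ω}
  [IsProbabilityMeasure P] {γ : Measure (ℕ → ℝ)} {σ : ℕ → ℝ} {c : ℕ → Ω → ℕ → ℝ}
  {S : 𝓗 → 𝓗} {G : 𝓗 → ℕ → 𝓗} {ρ ℓ α β κ₁ κ₂ κ : ℝ≥0} {X : 𝓗 → ℕ → Ω → 𝓗}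

/-- The law of the scheme at time `n`. -/
noncomputable def IsFlow.law (h : IsFlow 𝓖 P S G σ γ c ρ ℓ α β κ₁ κ₂ κ X) (x : 𝓗) (n : ℕ) :
    ProbabilityMeasure 𝓗 :=
  ⟨P.map (X x n), Measure.isProbabilityMeasure_map (h.measurable x n).aemeasurable⟩

theorem IsFlow.integral_law (h : IsFlow 𝓖 P S G σ γ c ρ ℓ α β κ₁ κ₂ κ X) (x : 𝓗) (n : ℕ)
    (φ : 𝓗 →ᵇ ℝ) : ∫ y, φ y ∂(h.law x n : Measure 𝓗) = h.transition n φ x :=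
  integral_map (h.measurable x n).aemeasurable φ.continuous.aestronglyMeasurable

/-- A solution map which sends balls into compact sets makes the laws of the scheme tight. -/
theorem IsFlow.isTightMeasureSet_law (h : IsFlow 𝓖 P S G σ γ c ρ ℓ α β κ₁ κ₂ κ X)
    (hS : ∀ R : ℝ, ∃ K : Set 𝓗, IsCompact K ∧ ∀ w, ‖w‖ ≤ R → S w ∈ K) (x : 𝓗) :
    IsTightMeasureSet {((μ : ProbabilityMeasure 𝓗) : Measure 𝓗) |
      μ ∈ Set.range fun n => h.law x (n + 1)} := by
  rw [isTightMeasureSet_iff_exists_isCompact_measure_compl_le]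
  intro ε hε
  rcases eq_or_ne ε ∞ with rfl | hεt
  · exact ⟨∅, isCompact_empty, fun _ _ => le_top⟩
  lift ε to ℝ≥0 using hεt
  have hε' : ε ≠ 0 := by exact_mod_cast hε.ne'
  -- `b` bounds the second moment of X_n + Z before the solution map is applied. Markov's inequality
  -- at radius `R` leaves mass at most ε outside the ball, and the solution map sends that ball into
  -- K.
  set b : ℝ≥0 := (1 + κ₁) * (‖x‖₊ ^ 2 + (α * κ₂ + β) / (1 - α * (1 + κ₁))) + κ₂ with hb
  set R : ℝ≥0 := NNReal.sqrt (b / ε) + 1 with hR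
  have hR0 : R ≠ 0 := by positivity
  have hbR : b ≤ ε * R ^ 2 := by
    calc b = ε * NNReal.sqrt (b / ε) ^ 2 := by rw [NNReal.sq_sqrt, mul_div_cancel₀ _ hε']
      _ ≤ ε * R ^ 2 := by gcongr; exact le_self_add
  obtain ⟨K, hK, hKS⟩ := hS R
  refine ⟨K, hK, ?_⟩
  rintro _ ⟨_, ⟨n, rfl⟩, rfl⟩
  obtain ⟨Z, hZ, hstep⟩ := (h.scheme x).step n
  have hZm : AEMeasurable Z P := hZ.aemeasurable fun N => (((h.noise.incr n).stronglyMeasurable_sum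
    (fun k => (h.coeff.G_cont k).comp_stronglyMeasurable ((h.scheme x).adapted n))
      (Finset.range N)).measurable).aemeasurable
  have hmom : ∫⁻ ω, ‖X x n ω + Z ω‖ₑ ^ 2 ∂P ≤ b := by
    refine (h.coeff.lintegral_add_sq_le h.white (h.noise.incr n) ((h.scheme x).adapted n) hZ).trans ?_
    rw [hb]
    simp only [ENNReal.coe_add, ENNReal.coe_mul, ENNReal.coe_one, ENNReal.coe_pow]
    gcongr
    exact (h.scheme x).lintegral_sq_le h.coeff h.white h.noise n
  change (P.map (X x (n + 1))) Kᶜ ≤ ε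
  rw [Measure.map_apply (h.measurable x _) hK.isClosed.measurableSet.compl]
  calc P (X x (n + 1) ⁻¹' Kᶜ) ≤ P {ω | (R : ℝ≥0∞) ^ 2 ≤ ‖X x n ω + Z ω‖ₑ ^ 2} := by
        refine measure_mono_ae ?_
        filter_upwards [hstep] with ω hω hωK
        by_contra hlt
        have h1 : ‖X x n ω + Z ω‖ₑ < R :=
          lt_of_not_ge fun hge => hlt (pow_le_pow_left₀ zero_le hge 2)
        refine hωK ?_
        rw [hω]
        refine hKS _ ?_
        have h2 : ‖X x n ω + Z ω‖₊ < R := by exact_mod_cast h1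
        exact_mod_cast h2.le
    _ ≤ (∫⁻ ω, ‖X x n ω + Z ω‖ₑ ^ 2 ∂P) / (R : ℝ≥0∞) ^ 2 := by
        refine meas_ge_le_lintegral_div ?_ (by positivity) (by finiteness)
        exact (((h.measurable x n).aemeasurable.add hZm).enorm).pow_const 2
    _ ≤ ε := by
        refine ENNReal.div_le_of_le_mul (hmom.trans ?_)
        exact_mod_cast hbR

theorem IsFlow.lintegral_enorm_le (h : IsFlow 𝓖 P S G σ γ c ρ ℓ α β κ₁ κ₂ κ X) (x : 𝓗) :
    ∃ C : ℝ≥0, ∀ n, ∫⁻ ω, ‖X x n ω‖ₑ ∂P ≤ C := by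
  refine ⟨NNReal.sqrt (‖x‖₊ ^ 2 + (α * κ₂ + β) / (1 - α * (1 + κ₁))), fun n => ?_⟩
  refine (ENNReal.pow_le_pow_left_iff two_ne_zero).1
    ((lintegral_enorm_sq_le (h.measurable x n).aestronglyMeasurable).trans
    (((h.scheme x).lintegral_sq_le h.coeff h.white h.noise n).trans_eq ?_))
  rw [← ENNReal.coe_pow, NNReal.sq_sqrt]
  push_cast
  rfl

/-- P_{n+1}φ(0) is the mean of P_nφ over the law of X_1 started at 0, and P_nφ has Lipschitz
constant Kκⁿ. -/
theorem IsFlow.dist_transition_succ_le (h : IsFlow 𝓖 P S G σ γ c ρ ℓ α β κ₁ κ₂ κ X) {C : ℝ≥0}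
    (hC : ∀ n, ∫⁻ ω, ‖X 0 n ω‖ₑ ∂P ≤ C) {φ : 𝓗 →ᵇ ℝ} {K : ℝ≥0} (hφ : LipschitzWith K φ) (n : ℕ) :
    dist (h.transition (n + 1) φ 0) (h.transition n φ 0) ≤ K * κ ^ n * C := by
  have h1 : edist (h.transition (n + 1) φ 0) (h.transition n φ 0) ≤ (K * κ ^ n * C : ℝ≥0) := by
    have h2 : h.transition (n + 1) φ 0 - h.transition n φ 0 =
        ∫ ω, (h.transition n φ (X 0 1 ω) - h.transition n φ 0) ∂P := by
      rw [integral_sub (h.integrable_comp 1 _ 0) (integrable_const _), h.transition_succ',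
        ← h.transition_apply 1]
      simp
    rw [edist_eq_enorm_sub, h2]
    calc _ ≤ ∫⁻ ω, ‖h.transition n φ (X 0 1 ω) - h.transition n φ 0‖ₑ ∂P :=
          enorm_integral_le_lintegral_enorm _
      _ ≤ ∫⁻ ω, (K * κ ^ n : ℝ≥0) * ‖X 0 1 ω‖ₑ ∂P := by
          refine lintegral_mono fun ω => ?_
          have h3 := h.lipschitzWith_transition n hφ (X 0 1 ω) 0
          rwa [edist_eq_enorm_sub, edist_eq_enorm_sub, sub_zero] at h3
      _ = (K * κ ^ n : ℝ≥0) * ∫⁻ ω, ‖X 0 1 ω‖ₑ ∂P := lintegral_const_mul' _ _ ENNReal.coe_ne_top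
      _ ≤ (K * κ ^ n : ℝ≥0) * C := by gcongr; exact hC 1
      _ = _ := (ENNReal.coe_mul _ _).symm
  rw [edist_nndist, ENNReal.coe_le_coe] at h1
  exact_mod_cast h1

/-- Existence of an invariant probability measure with finite first moment. -/
theorem IsFlow.exists_invariant (h : IsFlow 𝓖 P S G σ γ c ρ ℓ α β κ₁ κ₂ κ X)
    (hS : ∀ R : ℝ, ∃ K : Set 𝓗, IsCompact K ∧ ∀ w, ‖w‖ ≤ R → S w ∈ K) :
    ∃ π : ProbabilityMeasure 𝓗, Integrable (fun y => y) (π : Measure 𝓗) ∧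
      ∀ n (φ : 𝓗 →ᵇ ℝ), ∫ y, h.transition n φ y ∂(π : Measure 𝓗) = ∫ y, φ y ∂(π : Measure 𝓗) := by
  obtain ⟨C, hC⟩ := h.lintegral_enorm_le 0
  obtain ⟨π, -, ψ, hψ, hlim⟩ :=
    (isCompact_closure_of_isTightMeasureSet (h.isTightMeasureSet_law hS 0)).tendsto_subseq
      (x := fun n => h.law 0 (n + 1)) fun n => subset_closure (Set.mem_range_self n)
  have hlim1 := ProbabilityMeasure.tendsto_iff_forall_integral_tendsto.1 hlim
  simp only [Function.comp_apply, h.integral_law] at hlim1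
  -- The laws one step later have the same limit, because consecutive laws merge against Lipschitz
  -- functions. As P_1 preserves bounded continuous functions, this makes π invariant.
  have hlim2 : Tendsto (fun j => h.law 0 (ψ j + 1 + 1)) atTop (𝓝 π) := by
    rw [tendsto_iff_forall_lipschitz_integral_tendsto]
    rintro f ⟨B, hB⟩ ⟨K, hK⟩
    let φ : 𝓗 →ᵇ ℝ := .mkOfBound ⟨f, hK.continuous⟩ B hB
    have hφ : LipschitzWith K φ := hK
    have e : ∀ j, ∫ y, f y ∂(h.law 0 (ψ j + 1 + 1) : Measure 𝓗) = h.transition (ψ j + 1 + 1) φ 0 :=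
      fun j => h.integral_law 0 _ φ
    simp only [e]
    refine (tendsto_iff_of_dist ?_).1 (hlim1 φ)
    refine squeeze_zero (fun _ => dist_nonneg) (fun j => ?_)
      (g := fun j => (K * κ ^ (ψ j + 1) * C : ℝ)) ?_
    · rw [dist_comm]
      exact h.dist_transition_succ_le hC hφ (ψ j + 1)
    · have h1 := (tendsto_pow_atTop_nhds_zero_of_lt_one κ.coe_nonneg
        (NNReal.coe_lt_one.2 h.rate_lt_one)).comp
        ((tendsto_add_atTop_nat 1).comp hψ.tendsto_atTop)
      simpa using (h1.const_mul (K : ℝ)).mul_const (C : ℝ)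
  have hlim2' := ProbabilityMeasure.tendsto_iff_forall_integral_tendsto.1 hlim2
  simp only [h.integral_law] at hlim2'
  have hone : ∀ φ : 𝓗 →ᵇ ℝ,
      ∫ y, h.transition 1 φ y ∂(π : Measure 𝓗) = ∫ y, φ y ∂(π : Measure 𝓗) := by
    intro φ
    refine tendsto_nhds_unique (hlim1 (h.transition 1 φ)) ((hlim2' φ).congr fun j => ?_)
    rw [h.transition_succ]
  refine ⟨π, ⟨aestronglyMeasurable_id, ?_⟩, fun n => ?_⟩
  · refine (lintegral_enorm_le_of_tendsto (C := C) hlim fun n => ?_).trans_lt ENNReal.coe_lt_top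
    refine le_trans (le_of_eq ?_) (hC (ψ n + 1))
    exact lintegral_map measurable_enorm (h.measurable 0 _)
  · induction n with
    | zero => intro φ; rw [h.transition_zero]
    | succ n ih => intro φ; rw [h.transition_succ, ih, hone]

/-- Exponential mixing. -/
theorem IsFlow.abs_transition_sub_le (h : IsFlow 𝓖 P S G σ γ c ρ ℓ α β κ₁ κ₂ κ X)
    {π : Measure 𝓗} [IsProbabilityMeasure π] (hint : Integrable (fun y => y) π)
    (hinv : ∀ n (φ : 𝓗 →ᵇ ℝ), ∫ y, h.transition n φ y ∂π = ∫ y, φ y ∂π)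
    {φ : 𝓗 →ᵇ ℝ} {K : ℝ≥0} (hφ : LipschitzWith K φ) (n : ℕ) (x : 𝓗) :
    |h.transition n φ x - ∫ y, φ y ∂π| ≤ K * κ ^ n * ∫ y, ‖x - y‖ ∂π := by
  have hi : Integrable (fun y => ‖x - y‖) π := ((integrable_const x).sub hint).norm
  have h1 : h.transition n φ x - ∫ y, φ y ∂π =
      ∫ y, (h.transition n φ x - h.transition n φ y) ∂π := by
    rw [integral_sub (integrable_const _) ((h.transition n φ).integrable π), hinv]
    simp
  rw [h1, ← integral_const_mul, ← Real.norm_eq_abs]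
  refine norm_integral_le_of_norm_le (hi.const_mul _) (ae_of_all _ fun y => ?_)
  have h2 := (h.lipschitzWith_transition n hφ).dist_le_mul x y
  rw [dist_eq_norm, dist_eq_norm] at h2
  exact_mod_cast h2

theorem IsFlow.invariant_unique (h : IsFlow 𝓖 P S G σ γ c ρ ℓ α β κ₁ κ₂ κ X)
    {π μ : ProbabilityMeasure 𝓗} (hint : Integrable (fun y => y) (π : Measure 𝓗))
    (hinv : ∀ n (φ : 𝓗 →ᵇ ℝ),
      ∫ y, h.transition n φ y ∂(π : Measure 𝓗) = ∫ y, φ y ∂(π : Measure 𝓗))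
    (hμ : ∀ n (φ : 𝓗 →ᵇ ℝ),
      ∫ y, h.transition n φ y ∂(μ : Measure 𝓗) = ∫ y, φ y ∂(μ : Measure 𝓗)) : μ = π := by
  -- The constant sequence μ converges to π: for Lipschitz φ the integral of P_nφ against μ does not
  -- depend on n, while P_nφ tends pointwise to the π-mean of φ. Only π needs a first moment.
  have hlim : Tendsto (fun _ : ℕ => μ) atTop (𝓝 π) := by
    rw [tendsto_iff_forall_lipschitz_integral_tendsto]
    rintro f ⟨B, hB⟩ ⟨K, hK⟩
    let φ : 𝓗 →ᵇ ℝ := .mkOfBound ⟨f, hK.continuous⟩ B hB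
    have hφ : LipschitzWith K φ := hK
    change Tendsto (fun _ => ∫ y, φ y ∂(μ : Measure 𝓗)) atTop (𝓝 (∫ y, φ y ∂(π : Measure 𝓗)))
    have h1 : Tendsto (fun n => ∫ y, h.transition n φ y ∂(μ : Measure 𝓗)) atTop
        (𝓝 (∫ _, (∫ y, φ y ∂(π : Measure 𝓗)) ∂(μ : Measure 𝓗))) := by
      refine tendsto_integral_of_dominated_convergence (fun _ => ‖φ‖)
        (fun n => (h.transition n φ).continuous.aestronglyMeasurable) (integrable_const _)
        (fun n => ae_of_all _ fun y => ?_) (ae_of_all _ fun y => ?_)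
      · rw [h.transition_apply]
        simpa using norm_integral_le_of_norm_le_const (μ := P) (f := fun ω => φ (X y n ω))
          (ae_of_all _ fun ω => φ.norm_coe_le_norm _)
      · rw [tendsto_iff_dist_tendsto_zero]
        refine squeeze_zero (fun _ => dist_nonneg) (fun n => ?_)
          (g := fun n => (K * κ ^ n * ∫ z, ‖y - z‖ ∂(π : Measure 𝓗) : ℝ)) ?_
        · rw [Real.dist_eq]
          exact h.abs_transition_sub_le hint hinv hφ n y
        · have h1 := tendsto_pow_atTop_nhds_zero_of_lt_one κ.coe_nonneg
            (NNReal.coe_lt_one.2 h.rate_lt_one)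
          simpa using (h1.const_mul (K : ℝ)).mul_const (∫ z, ‖y - z‖ ∂(π : Measure 𝓗))
    simpa [hμ] using h1
  exact tendsto_nhds_unique tendsto_const_nhds hlim

end Invariant
end DIE

namespace DIE

/-! ### Increments of the Q-Wiener process as white noise -/

section Wiener

theorem isWhite_infinitePi_gaussianReal (v : ℕ → ℝ≥0) :
    IsWhite (Measure.infinitePi fun k => gaussianReal 0 (v k)) fun k => v k := by
  have hmp : ∀ k, MeasurePreserving (fun ξ : ℕ → ℝ => ξ k)
      (Measure.infinitePi fun k => gaussianReal 0 (v k)) (gaussianReal 0 (v k)) := fun k =>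
    measurePreserving_eval_infinitePi _ k
  have hmean : ∀ k, ∫ ξ : ℕ → ℝ, ξ k ∂(Measure.infinitePi fun k => gaussianReal 0 (v k)) = 0 := by
    intro k
    have h := integral_map (hmp k).aemeasurable (f := fun x : ℝ => x)
      aestronglyMeasurable_id
    rw [(hmp k).map_eq, integral_id_gaussianReal] at h
    exact h.symm
  refine ⟨inferInstance, fun k => ?_, hmean, fun j k hjk => ?_, fun k => ?_⟩
  · exact (memLp_id_gaussianReal' 2 ENNReal.ofNat_ne_top).comp_measurePreserving (hmp k)
  · have hind := (iIndepFun_infinitePi (P := fun k => gaussianReal 0 (v k))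
      (X := fun _ x => x) fun k => measurable_id).indepFun hjk
    have h := hind.integral_fun_mul_eq_mul_integral (measurable_pi_apply j).aestronglyMeasurable
      (measurable_pi_apply k).aestronglyMeasurable
    rw [h, hmean, zero_mul]
  · have h := integral_map (hmp k).aemeasurable (f := fun x : ℝ => x * x)
      (by fun_prop)
    rw [← h, (hmp k).map_eq]
    have h2 := variance_fun_id_gaussianReal (μ := 0) (v := v k)
    rw [variance_of_integral_eq_zero (by fun_prop) integral_id_gaussianReal] at h2
    simpa only [sq] using h2

variable {d : ℕ} {O : Set (E d)} {Q : Covariance O} {Ω : Type*} {mΩ : MeasurableSpace Ω}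
  {𝓕 : Filtration ℝ≥0 mΩ} {P : Measure Ω} [IsProbabilityMeasure P] {W : ℝ≥0 → Ω → H O}

theorem inner_basis_eq_of_hasSum {a : ℕ → ℝ} {w : H O} (h : HasSum (fun k => a k • Q.basis k) w)
    (k : ℕ) : ⟪Q.basis k, w⟫ = a k := by
  have h1 := (innerSL ℝ (Q.basis k)).hasSum h
  have h2 := hasSum_single (f := fun j => innerSL ℝ (Q.basis k) (a j • Q.basis j)) k fun j hj => by
    rw [innerSL_apply_apply, inner_smul_right, Q.basis.orthonormal.2 hj.symm, mul_zero]
  rw [← innerSL_apply_apply ℝ, h1.unique h2, innerSL_apply_apply, inner_smul_right,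
    real_inner_self_eq_norm_sq, Q.basis.orthonormal.1]
  norm_num

/-- The coefficients of W(t) - W(s) in the eigenbasis are √qₖ(βₖ(t) - βₖ(s)), which are independent
centred Gaussians of variance (t - s)qₖ. -/
theorem IsQWiener.map_inner_eq (hW : IsQWiener Q 𝓕 P W) {s t : ℝ≥0} (hst : s ≤ t) :
    P.map (fun ω k => ⟪Q.basis k, W t ω - W s ω⟫) =
      Measure.infinitePi fun k => gaussianReal 0 ((t - s) * (Q.eig k).toNNReal) := by
  obtain ⟨β, hβ, hind, hsum⟩ := hW.expansion
  have hae : (fun ω k => ⟪Q.basis k, W t ω - W s ω⟫) =ᵐ[P]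
      fun ω k => √(Q.eig k) * (β k t ω - β k s ω) := by
    filter_upwards [hsum t, hsum s] with ω h1 h2
    ext k
    rw [inner_sub_right, inner_basis_eq_of_hasSum h1, inner_basis_eq_of_hasSum h2, mul_sub]
  have hlaw : ∀ k, HasLaw (fun ω => √(Q.eig k) * (β k t ω - β k s ω))
      (gaussianReal 0 ((t - s) * (Q.eig k).toNNReal)) P := by
    intro k
    have h1 := gaussianReal_const_mul ((hβ k).toIsPreBrownianReal.hasLaw_sub t s) (√(Q.eig k))
    convert! h1 using 2
    · simp
    · ext
      simp only [NNReal.coe_mul, NNReal.coe_sub hst, Real.coe_toNNReal _ (Q.eig_pos k).le,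
        coe_nndist, NNReal.coe_mk, Real.sq_sqrt (Q.eig_pos k).le]
      rw [mul_comm]
      exact congrArg _ (abs_of_nonneg (sub_nonneg.2 (NNReal.coe_le_coe.2 hst))).symm
  have hind' : iIndepFun (fun k ω => √(Q.eig k) * (β k t ω - β k s ω)) P :=
    hind.comp (fun k b => √(Q.eig k) * (b t - b s)) fun k => by fun_prop
  rw [Measure.map_congr hae, (iIndepFun_iff_map_fun_eq_infinitePi_map₀'
    fun k => (hlaw k).aemeasurable).1 hind']
  congr with k
  rw [(hlaw k).map_eq]

/-- The increments of the Wiener process along a grid. -/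
theorem IsQWiener.isNoise (hW : IsQWiener Q 𝓕 P W) (τ : ℝ≥0) :
    IsNoise (fun n => 𝓕 (n * τ)) P
      (Measure.infinitePi fun k => gaussianReal 0 (τ * (Q.eig k).toNNReal))
      fun n ω k => ⟪Q.basis k, W ((n + 1 : ℕ) * τ) ω - W (n * τ) ω⟫ := by
  have hle : ∀ n : ℕ, (n : ℝ≥0) * τ ≤ (n + 1 : ℕ) * τ := fun n => by
    gcongr
    exact n.le_succ
  have hinner : Measurable fun (w : H O) (k : ℕ) => ⟪Q.basis k, w⟫ :=
    measurable_pi_lambda _ fun k => (innerSL ℝ (Q.basis k)).continuous.measurable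
  have hmeas : ∀ n : ℕ, Measurable[𝓕 ((n + 1 : ℕ) * τ)]
      fun ω (k : ℕ) => ⟪Q.basis k, W ((n + 1 : ℕ) * τ) ω - W (n * τ) ω⟫ := fun n =>
    hinner.comp ((hW.adapted _).sub ((hW.adapted _).mono (𝓕.mono (hle n)))).measurable
  refine ⟨fun n => 𝓕.mono (hle n), hmeas, fun n => ⟨𝓕.le _, (hmeas n).mono (𝓕.le _) le_rfl, ?_, ?_⟩⟩
  · refine indep_of_indep_of_le_left (hW.indep_increment _ _ (hle n)) ?_
    rintro _ ⟨B, hB, rfl⟩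
    exact ⟨_, hinner hB, rfl⟩
  · rw [hW.map_inner_eq (hle n)]
    congr with k
    have : ((n + 1 : ℕ) : ℝ≥0) * τ - n * τ = τ := by
      push_cast
      rw [add_mul, one_mul, add_tsub_cancel_left]
    rw [this]

end Wiener
end DIE

namespace DIE

/-! ### From the Euler scheme to the abstract scheme -/

section Euler

variable {d : ℕ} {O : Set (E d)} {f : ℝ → ℝ} {L₁ L₂ L₃ L₄ L₅ q : ℝ} {Q : Covariance O}
  {G : H O → ℕ → H O} {L₆ L₇ L₈ : ℝ} {τ : ℝ≥0}

theorem weightedSq_eq_mul_hsNormSq (Q : Covariance O) (τ : ℝ≥0) (A : ℕ → H O) :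
    weightedSq (fun k => ((τ * (Q.eig k).toNNReal : ℝ≥0) : ℝ)) A = τ * hsNormSq Q A := by
  unfold weightedSq hsNormSq
  rw [← ENNReal.tsum_mul_left]
  refine tsum_congr fun k => ?_
  rw [ENNReal.ofReal_coe_nnreal, ENNReal.coe_mul, mul_assoc]
  rfl

/-- A single term of the Hilbert-Schmidt sum is at most the whole sum, and dividing by qₖ > 0 gives
a Lipschitz bound. -/
theorem DiffusionAssumption.continuous (hG : DiffusionAssumption Q G L₆ L₇ L₈) (k : ℕ) :
    Continuous fun x => G x k := by
  have hq := Q.eig_pos k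
  refine LipschitzWith.continuous (K := Real.toNNReal √(L₆ / Q.eig k))
    (LipschitzWith.of_dist_le_mul fun x y => ?_)
  rw [dist_eq_norm, dist_eq_norm, Real.coe_toNNReal _ (Real.sqrt_nonneg _)]
  have h1 : ENNReal.ofReal (Q.eig k * ‖G x k - G y k‖ ^ 2) ≤ ENNReal.ofReal (L₆ * ‖x - y‖ ^ 2) := by
    rw [ENNReal.ofReal_mul hq.le, ← enorm_sq_eq_ofReal]
    exact (ENNReal.le_tsum (f := fun k => ENNReal.ofReal (Q.eig k) * ‖G x k - G y k‖ₑ ^ 2) k).trans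
      (hG.lipschitz x y)
  have h2 := (ENNReal.ofReal_le_ofReal_iff (mul_nonneg hG.L₆_nonneg (sq_nonneg _))).1 h1
  refine abs_le_of_sq_le_sq' ?_ (by positivity) |>.2
  rw [mul_pow, Real.sq_sqrt (div_nonneg hG.L₆_nonneg hq.le), div_mul_eq_mul_div, le_div_iff₀ hq]
  linarith

/-- The Lipschitz constant of one step of the scheme. -/
noncomputable def stepLip (O : Set (E d)) (L₁ : ℝ) (τ : ℝ≥0) : ℝ≥0 :=
  (1 + τ * (lambda1 O - L₁)).toNNReal⁻¹

/-- The energy dissipation factor of one step of the scheme. -/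
noncomputable def stepDissip (O : Set (E d)) (L₂ : ℝ) (τ : ℝ≥0) : ℝ≥0 :=
  (1 + 2 * τ * (lambda1 O - L₂)).toNNReal⁻¹

theorem schemeCoeff_stepMap (hd : 1 ≤ d) (hd3 : d ≤ 3) (hO : MeasurableSet O)
    (hOb : Bornology.IsBounded O) (hf : DriftAssumption d f L₁ L₂ L₃ L₄ L₅ q)
    (hG : DiffusionAssumption Q G L₆ L₇ L₈) (hτ : 0 < τ) (hL₁ : L₁ < lambda1 O)
    (hL₂ : L₂ + L₇ / 2 < lambda1 O) :
    SchemeCoeff (stepMap O f τ) G (fun k => ((τ * (Q.eig k).toNNReal : ℝ≥0) : ℝ))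
      (stepLip O L₁ τ) (τ * L₆.toNNReal) (stepDissip O L₂ τ)
      (stepDissip O L₂ τ * (2 * τ * (L₃ * volume.real O)).toNNReal)
      (τ * L₇.toNNReal) (τ * L₈.toNNReal) := by
  have hτ' : (0 : ℝ) < τ := hτ
  have h7 := hG.L₇_nonneg
  have hstep := isStep_stepMap hd hd3 hO hOb hf hτ' hL₁
  have ha : 0 < 1 + τ * (lambda1 O - L₁) := by
    have := mul_pos hτ' (sub_pos.2 hL₁)
    linarith
  have hb : 0 < 1 + 2 * τ * (lambda1 O - L₂) := by
    have := mul_pos hτ' (sub_pos.2 (show L₂ < lambda1 O by linarith))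
    linarith
  have hB : 0 ≤ 2 * τ * (L₃ * volume.real O) := by
    have := hf.L₃_nonneg
    positivity
  refine ⟨LipschitzWith.of_dist_le_mul fun w w' => ?_, fun w => ?_, hG.continuous, fun x y => ?_,
    fun x => ?_, ?_⟩
  · have h1 := (hstep w).norm_sub_le hO hOb hf hτ' (hstep w')
    rw [stepLip, NNReal.coe_inv, Real.coe_toNNReal _ ha.le, dist_eq_norm, dist_eq_norm,
      ← div_eq_inv_mul, le_div_iff₀ ha]
    linarith
  · have h1 := (hstep w).norm_sq_le hO hOb hf hτ'
    have h2 : ‖stepMap O f τ w‖₊ ^ 2 ≤ stepDissip O L₂ τ * ‖w‖₊ ^ 2 +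
        stepDissip O L₂ τ * (2 * τ * (L₃ * volume.real O)).toNNReal := by
      rw [← NNReal.coe_le_coe]
      push_cast
      rw [stepDissip, NNReal.coe_inv, Real.coe_toNNReal _ hb.le, Real.coe_toNNReal _ hB, ← mul_add,
        ← div_eq_inv_mul, le_div_iff₀ hb]
      linarith
    simp only [enorm_eq_nnnorm]
    exact_mod_cast h2
  · rw [weightedSq_eq_mul_hsNormSq, ENNReal.coe_mul, mul_assoc]
    gcongr
    refine (hG.lipschitz x y).trans_eq ?_
    rw [ENNReal.ofReal_mul hG.L₆_nonneg, ← enorm_sq_eq_ofReal]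
    rfl
  · rw [weightedSq_eq_mul_hsNormSq, ENNReal.coe_mul, ENNReal.coe_mul, mul_assoc, ← mul_add]
    gcongr
    refine (hG.growth x).trans_eq ?_
    rw [ENNReal.ofReal_add (mul_nonneg h7 (sq_nonneg _)) hG.L₈_nonneg, ENNReal.ofReal_mul h7,
      ← enorm_sq_eq_ofReal]
    rfl
  · rw [← NNReal.coe_lt_coe, stepDissip]
    push_cast
    rw [Real.coe_toNNReal _ hb.le, Real.coe_toNNReal _ h7, ← div_eq_inv_mul, div_lt_one hb]
    nlinarith

theorem gamma6_pos {lam : ℝ} (h6 : 0 ≤ L₆) (h : L₁ + L₆ / 2 < lam) : 0 < gamma6 lam L₁ L₆ :=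
  div_pos (by linarith) (by linarith)

theorem stepLip_sq_mul_le (h6 : 0 ≤ L₆) (h : L₁ + L₆ / 2 < lambda1 O) (hτ1 : τ < 1) :
    stepLip O L₁ τ ^ 2 * (1 + τ * L₆.toNNReal) ≤
      (Real.exp (-(gamma6 (lambda1 O) L₁ L₆ * τ) / 2)).toNNReal ^ 2 := by
  set γ := gamma6 (lambda1 O) L₁ L₆ with hγ
  set a := lambda1 O - L₁ with ha
  have hτ0 : (0 : ℝ) ≤ τ := τ.2
  have hτ1' : (τ : ℝ) < 1 := hτ1
  have ha0 : 0 < a := by linarith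
  have hpos : 0 < 1 + τ * a := by positivity
  have hγa : γ * (2 * a + 1) = 2 * a - L₆ := by
    rw [hγ, gamma6]
    exact div_mul_cancel₀ _ (by positivity)
  rw [← NNReal.coe_le_coe, stepLip]
  push_cast
  rw [Real.coe_toNNReal _ hpos.le, Real.coe_toNNReal _ h6, Real.coe_toNNReal _ (Real.exp_pos _).le,
    ← Real.exp_nat_mul, inv_pow, ← div_eq_inv_mul, div_le_iff₀ (by positivity)]
  have he : 1 - γ * τ ≤ Real.exp ((2 : ℕ) * (-(γ * τ) / 2)) := by
    have h1 := Real.add_one_le_exp ((2 : ℕ) * (-(γ * τ) / 2))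
    push_cast at h1 ⊢
    linarith
  -- With a = λ₁ - L₁, the difference of the two sides times 2a + 1 is 2a(2a - L₆)τ(1 - τ), so τ < 1
  -- enters here. The value of γ₆ is the one for which equality holds at τ = 1.
  have hmain : 1 + τ * L₆ ≤ (1 - γ * τ) * (1 + 2 * a * τ) := by
    have h1 : 0 ≤ 2 * a * (2 * a - L₆) * τ * (1 - τ) := by
      have : 0 ≤ 2 * a - L₆ := by linarith
      have : 0 ≤ 1 - (τ : ℝ) := by linarith
      positivity
    have h2 : (2 * a + 1) * ((1 - γ * τ) * (1 + 2 * a * τ) - (1 + τ * L₆)) =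
        2 * a * (2 * a - L₆) * τ * (1 - τ) := by
      linear_combination (-(τ : ℝ) * (1 + 2 * a * τ)) * hγa
    have h3 := nonneg_of_mul_nonneg_right (h2 ▸ h1) (by positivity)
    linarith
  calc 1 + τ * L₆ ≤ (1 - γ * τ) * (1 + 2 * a * τ) := hmain
    _ ≤ Real.exp ((2 : ℕ) * (-(γ * τ) / 2)) * (1 + 2 * a * τ) := by gcongr
    _ ≤ _ := by
        gcongr
        nlinarith [sq_nonneg ((τ : ℝ) * a)]

/-- Existence and uniqueness for one step make the relation `IsStep` the graph of `stepMap`. -/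
theorem isSolution_iff_isScheme {Ω : Type*} {mΩ : MeasurableSpace Ω} {𝓕 : Filtration ℝ≥0 mΩ}
    {P : Measure Ω} {W : ℝ≥0 → Ω → H O} (hd : 1 ≤ d) (hd3 : d ≤ 3) (hO : MeasurableSet O)
    (hOb : Bornology.IsBounded O) (hf : DriftAssumption d f L₁ L₂ L₃ L₄ L₅ q) (hτ : 0 < τ)
    (hL₁ : L₁ < lambda1 O) {x : H O} {X : ℕ → Ω → H O} :
    IsSolution Q f G τ 𝓕 P W x X ↔ IsScheme (fun n => 𝓕 (n * τ)) P (stepMap O f τ) G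
      (fun n ω k => ⟪Q.basis k, W ((n + 1 : ℕ) * τ) ω - W (n * τ) ω⟫) x X := by
  have hτ' : (0 : ℝ) < τ := hτ
  have hiff : ∀ x z y : H O, IsStep O f τ x z y ↔ y = stepMap O f τ (x + z) := by
    intro x z y
    rw [isStep_iff_add]
    refine ⟨fun h => h.unique hO hOb hf hτ' hL₁ (isStep_stepMap hd hd3 hO hOb hf hτ' hL₁ _), ?_⟩
    rintro rfl
    exact isStep_stepMap hd hd3 hO hOb hf hτ' hL₁ _
  constructor
  · rintro ⟨h1, h2, h3⟩
    simp only [hiff] at h3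
    exact ⟨h1, h2, h3⟩
  · rintro ⟨h1, h2, h3⟩
    simp only [← hiff] at h3
    exact ⟨h1, h2, h3⟩

theorem IsLipB.lipschitzWith {φ : H O → ℝ} (hφ : IsLipB φ) :
    0 ≤ lipSeminorm φ ∧ LipschitzWith (lipSeminorm φ).toNNReal φ := by
  obtain ⟨⟨K, hK⟩, -⟩ := hφ
  -- Without this bound the real supremum would take its default value 0 and give no Lipschitz
  -- constant.
  have hbdd : BddAbove {r | ∃ x y : H O, x ≠ y ∧ r = |φ x - φ y| / ‖x - y‖} := by
    refine ⟨K, ?_⟩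
    rintro _ ⟨x, y, hxy, rfl⟩
    rw [div_le_iff₀ (norm_pos_iff.2 (sub_ne_zero.2 hxy)), ← Real.dist_eq, ← dist_eq_norm]
    exact hK.dist_le_mul x y
  have h0 : 0 ≤ lipSeminorm φ := by
    refine Real.sSup_nonneg ?_
    rintro _ ⟨x, y, -, rfl⟩
    positivity
  refine ⟨h0, LipschitzWith.of_dist_le_mul fun x y => ?_⟩
  rw [Real.coe_toNNReal _ h0]
  rcases eq_or_ne x y with rfl | hxy
  · simp
  · rw [Real.dist_eq, dist_eq_norm, ← div_le_iff₀ (norm_pos_iff.2 (sub_ne_zero.2 hxy))]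
    exact le_csSup hbdd ⟨x, y, hxy, rfl⟩

end Euler
end DIE

/-! ### Assembly of the theorem -/

theorem theorem3p1 {d : ℕ} (hd : 1 ≤ d) (hd3 : d ≤ 3)
    (O : Set (E d)) (hO : IsOpen O) (hOb : Bornology.IsBounded O) (hOn : O.Nonempty)
    (f : ℝ → ℝ) (L₁ L₂ L₃ L₄ L₅ q : ℝ) (hf : DriftAssumption d f L₁ L₂ L₃ L₄ L₅ q)
    (Q : Covariance O) (g : ℝ → ℝ) (G : H O → ℕ → H O) (hgG : IsNemytskii Q g G)
    (L₆ L₇ L₈ : ℝ) (hG : DiffusionAssumption Q G L₆ L₇ L₈)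
    (hL : max (L₁ + L₆ / 2) (L₂ + L₇ / 2) < lambda1 O)
    {Ω : Type*} {mΩ : MeasurableSpace Ω} (𝓕 : Filtration ℝ≥0 mΩ)
    (P : Measure Ω) [IsProbabilityMeasure P]
    (W : ℝ≥0 → Ω → H O) (hW : IsQWiener Q 𝓕 P W)
    (τ : ℝ≥0) (hτ : 0 < τ) (hτ1 : τ < 1) :
    -- the scheme is well-posed
    (∀ x : H O, ∃ X : ℕ → Ω → H O, IsSolution Q f G τ 𝓕 P W x X ∧
      ∀ Y : ℕ → Ω → H O, IsSolution Q f G τ 𝓕 P W x Y → ∀ m, Y m =ᵐ[P] X m) ∧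
    0 < gamma6 (lambda1 O) L₁ L₆ ∧
    -- it has a unique invariant measure, which is exponentially mixing
    ∀ X : H O → ℕ → Ω → H O, (∀ x, IsSolution Q f G τ 𝓕 P W x (X x)) →
      ∃ π : Measure (H O), IsInvariantMeasure P X π ∧
        (∀ μ : Measure (H O), IsInvariantMeasure P X μ → μ = π) ∧
        (∀ x : H O, Integrable (fun y => ‖x - y‖) π) ∧
        ∀ (m : ℕ) (x : H O) (φ : H O → ℝ), IsLipB φ →
          |semigroup P X m φ x - ∫ y, φ y ∂π| ≤
            Real.exp (-(gamma6 (lambda1 O) L₁ L₆ * (m * τ)) / 2) * lipSeminorm φ *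
              ∫ y, ‖x - y‖ ∂π := by
  have hOm := hO.measurableSet
  have hL₁ : L₁ + L₆ / 2 < lambda1 O := (le_max_left _ _).trans_lt hL
  have hL₂ : L₂ + L₇ / 2 < lambda1 O := (le_max_right _ _).trans_lt hL
  have h6 := hG.L₆_nonneg
  have hL₁' : L₁ < lambda1 O := by linarith
  have hL₂' : L₂ < lambda1 O := by linarith [hG.L₇_nonneg]
  have hγ := gamma6_pos h6 hL₁
  have hco := schemeCoeff_stepMap hd hd3 hOm hOb hf hG hτ hL₁' hL₂
  have hwhite := isWhite_infinitePi_gaussianReal fun k => τ * (Q.eig k).toNNReal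
  have hnoise := hW.isNoise τ
  have hiff : ∀ x X, IsSolution Q f G τ 𝓕 P W x X ↔ _ := fun x X =>
    isSolution_iff_isScheme hd hd3 hOm hOb hf hτ hL₁'
  refine ⟨fun x => ?_, hγ, fun X hX => ?_⟩
  · obtain ⟨X, hX⟩ := exists_isScheme hco hwhite hnoise x
    exact ⟨X, (hiff x X).2 hX, fun Y hY => hX.unique ((hiff x Y).1 hY)⟩
  have hτ0 : (0 : ℝ) < τ := hτ
  -- Here κ = exp(-γ₆τ/2), the square root of the mean-square factor; its m-th power is the decay
  -- factor at time mτ.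
  have hrate : (Real.exp (-(gamma6 (lambda1 O) L₁ L₆ * τ) / 2)).toNNReal < 1 := by
    rw [Real.toNNReal_lt_one, Real.exp_lt_one_iff]
    have := mul_pos hγ hτ0
    linarith
  have hflow : IsFlow _ P _ G _ _ _ _ _ _ _ _ _ _ X :=
    ⟨hco, hwhite, hnoise, fun x => (hiff x _).1 (hX x), stepLip_sq_mul_le h6 hL₁ hτ1, hrate⟩
  obtain ⟨π, hint, hinv⟩ := hflow.exists_invariant fun R => by
    obtain ⟨K, hK, hKS⟩ := exists_isCompact_isStep hOm hOb hf hτ0 hL₂' R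
    exact ⟨K, hK, fun w hw => hKS w _ hw (isStep_stepMap hd hd3 hOm hOb hf hτ0 hL₁' w)⟩
  refine ⟨π, ⟨π.2, hinv⟩, fun μ hμ => ?_, fun x => ((integrable_const x).sub hint).norm,
    fun m x φ hφ => ?_⟩
  · have h1 : (⟨μ, hμ.1⟩ : ProbabilityMeasure (H O)) = π := hflow.invariant_unique hint hinv hμ.2
    exact congrArg Subtype.val h1
  · obtain ⟨h0, hlip⟩ := hφ.lipschitzWith
    obtain ⟨C, hC⟩ := hφ.2
    have h1 := hflow.abs_transition_sub_le hint hinv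
      (φ := .ofNormedAddCommGroup φ hlip.continuous C hC) hlip m x
    refine h1.trans_eq ?_
    rw [Real.coe_toNNReal _ h0, Real.coe_toNNReal _ (Real.exp_pos _).le, ← Real.exp_nat_mul,
      mul_comm (lipSeminorm φ)]
    congr 3
    ring
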